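/- Notation. $\mathbb N=\{1,2,\dots\}$; for finite sets $E,F\subset\mathbb N$, $E<F$ means $\max E<\min F$ (with $\min\varnothing=\infty$, $\max\varnothing=0$), and sequences of sets with $E_1<E_2<\cdots$ are called successive. For families $\mathcal F,\mathcal G$ of finite subsets of $\mathbb N$ let $\mathcal F[\mathcal G]=\{\bigcup_{i=1}^nE_i: E_1<\dots<E_n,\ \varnothing\ne E_i\in\mathcal G,\ \{\min E_i\}_{i=1}^n\in\mathcal F\}$. The Schreier families are $\mathcal S_0=\{\varnothing\}\cup\{\{n\}:n\in\mathbb N\}$, $\mathcal S_1=\{E:|E|\le\min E\}$, $\mathcal S_{\zeta+1}=\mathcal S_1[\mathcal S_\zeta]$ and, for a countable limit ordinal $\zeta$, $\mathcal S_\zeta=\{E:\exists n\le \min E,\ E\in\mathcal S_{\zeta_n}\}$, where $\zeta_n\uparrow\zeta$ is a fixed strictly increasing sequence of ordinals with supremum $\zeta$, chosen so that $\mathcal S_{\zeta_n}\subset\mathcal S_{\zeta_{n+1}}$ for all $n$. Let $\xi<\omega_1$. Let $W_0=\{\pm e_n:n\in\mathbb N\}\subset c_{00}(\mathbb N)$ (real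 scalars), and let $W_{m+1}$ be the union of $W_m$, of all $\alpha$-averages $\frac1\ell\sum_{q=1}^df_q$ with $f_1<\dots<f_d$ in $W_m$ (successive supports), $\ell\ge2$, $1\le d\le\ell$ (such a vector is said to have size $\ell$), and of all sums $\sum_{q=1}^d\alpha_q$, $d\ge1$, where $\alpha_1<\dots<\alpha_d$ are elements of $W_m$ that are $\alpha$-averages $\frac1{s_q}\sum_p f_p$ of elements of $W_m$ of sizes $s_1<\dots<s_d$ with $s_q>\max\operatorname{supp}\alpha_{q-1}$ for $q>1$, and $\{\min\operatorname{supp}\alpha_q\}_{q=1}^d\in\mathcal S_{\omega^\xi}$. Put $W=\bigcup_mW_m$, and let $\mathfrak X_{0,1}^{\omega^\xi}$ be the completion of $c_{00}(\mathbb N)$ under $\|x\|=\sup\{f(x):f\in W\}$. Block sequences are taken with respect to its basis $(e_n)$. For $K\ge1$ and a family $\mathcal F$ of finite sets, a basic sequence $(x_i)$ is a $K$-$\ell_1^{\mathcal F}$ (respectively $K$-$c_0^{\mathcal F}$) spreading model if there are $c,C>0$ with $cC\le K$ such that for all $E\in\mathcal F$ and scalars $(a_i)_{i\in E}$ one has $c^{-1}\rho(a)\le\|\sum_{i\in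 E}a_ix_i\|\le C\rho(a)$, where $\rho(a)=\sum_{i\in E}|a_i|$ (respectively $\rho(a)=\max_{i\in E}|a_i|$). For $\mathcal F=\mathcal S_\zeta$ one writes $\ell_1^\zeta$ and $c_0^\zeta$, and the constant is omitted if it is only required to exist. Proposition. Let $\xi<\omega_1$ and let $(x_i)$ be a normalized block sequence in $\mathfrak X_{0,1}^{\omega^\xi}$. Then either some subsequence of $(x_i)$ is an $\ell_1^{\omega^\xi}$ spreading model, or for every $\varepsilon>0$ some subsequence of $(x_i)$ is a $(1+\varepsilon)$-$c_0^1$ spreading model. Moreover, for every subsequence $(x_{m_i})_i$ of $(x_i)$: (i) If $(x_{m_i})_i$ is a $c_0^1$ spreading model, then there is a successive sequence $(E_i)$ in $\mathcal S_1$ such that $y_i=\sum_{j\in E_i}x_{m_j}$ defines an $\ell_1^{\omega^\xi}$ spreading model. More precisely, for every successive sequence $(F_i)$ in $\mathcal S_1$ with $|F_i|\to\infty$, the sequence $\bigl(\sum_{j\in F_i}x_{m_j}\bigr)_i$ has a subsequence that is an $\ell_1^{\omega^\xi}$ spreading model. (ii) If $(x_{m_i})_i$ is an $\ell_1^{\omega^\xi}$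 spreading model, then for every $\varepsilon>0$ there are a successive sequence $(E_i)$ in $\mathcal S_{\omega^\xi}$ and scalars $(a_j)$ such that the vectors $y_i=\sum_{j\in E_i}a_jx_{m_j}$ have norm one and form a $(1+\varepsilon)$-$c_0^1$ spreading model. -/

import Mathlib

open scoped NNReal Ordinal

noncomputable section

namespace X01

/-! The natural numbers of this development start at `1`, so they are the type `ℕ+`. -/

/-! ### Families of finite sets -/

/-- `E < F`: every element of `E` is smaller than every element of `F`. -/
def Before (E F : Finset ℕ+) : Prop := ∀ a ∈ E, ∀ b ∈ F, a < b

/-- An infinite sequence of finite sets with `E₁ < E₂ < ⋯`. -/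
def Successive (E : ℕ+ → Finset ℕ+) : Prop := ∀ i j, i < j → Before (E i) (E j)

/-- `𝓕[𝓖]`: the unions `E₁ ∪ ⋯ ∪ Eₙ` with `E₁ < ⋯ < Eₙ` non-empty members of `𝓖` such that
`{min E₁, …, min Eₙ} ∈ 𝓕`. -/
def compFamily (𝓕 𝓖 : Set (Finset ℕ+)) : Set (Finset ℕ+) :=
  {A | ∃ (n : ℕ) (E : Fin n → Finset ℕ+) (hE : ∀ i, (E i).Nonempty),
    (∀ i j, i < j → Before (E i) (E j)) ∧ (∀ i, E i ∈ 𝓖) ∧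
    (Finset.univ.image fun i => (E i).min' (hE i)) ∈ 𝓕 ∧ A = Finset.univ.biUnion E}

/-- `𝓢₀`: the empty set and the singletons. -/
def schreierZero : Set (Finset ℕ+) := {E | E.card ≤ 1}

/-- `𝓢₁ = {E : |E| ≤ min E}`, where `min ∅ = ∞`. -/
def schreierOne : Set (Finset ℕ+) := {E | ∀ n ∈ E, E.card ≤ (n : ℕ)}

/-- A choice, for every countable limit ordinal `o`, of a sequence `o₁ < o₂ < ⋯` of ordinals
with supremum `o`. -/
structure FundamentalSystem where
  seq : Ordinal.{0} → ℕ+ → Ordinal.{0}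
  seq_lt : ∀ o, Order.IsSuccLimit o → o < ω₁ → ∀ n, seq o n < o
  strictMono : ∀ o, Order.IsSuccLimit o → o < ω₁ → StrictMono (seq o)
  cofinal : ∀ o, Order.IsSuccLimit o → o < ω₁ → ∀ a < o, ∃ n, a < seq o n

/-- The Schreier families: `𝓢₀` as above, `𝓢_{o+1} = 𝓢₁[𝓢_o]`, and, for limit `o`,
`𝓢_o = {E : ∃ n ≤ E, E ∈ 𝓢_{oₙ}}`. -/
def schreier (Φ : FundamentalSystem) (o : Ordinal.{0}) : Set (Finset ℕ+) :=
  Ordinal.limitRecOn o schreierZero (fun _ S => compFamily schreierOne S)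
    (fun o _ S => {E | ∃ n : ℕ+, (∀ k ∈ E, n ≤ k) ∧ ∃ h : Φ.seq o n < o, E ∈ S (Φ.seq o n) h})

theorem schreier_zero (Φ : FundamentalSystem) : schreier Φ 0 = schreierZero := by
  simp [schreier]

theorem schreier_add_one (Φ : FundamentalSystem) (o : Ordinal.{0}) :
    schreier Φ (o + 1) = compFamily schreierOne (schreier Φ o) := by
  simp [schreier]

theorem schreier_limit (Φ : FundamentalSystem) (o : Ordinal.{0}) (ho : Order.IsSuccLimit o)
    (ho' : o < ω₁) :
    schreier Φ o = {E | ∃ n : ℕ+, (∀ k ∈ E, n ≤ k) ∧ E ∈ schreier Φ (Φ.seq o n)} := by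
  unfold schreier
  rw [Ordinal.limitRecOn_limit _ _ _ _ ho]
  ext E
  simp [Φ.seq_lt o ho ho']

/-- The standing convention on the chosen sequences: `𝓢_{oₙ} ⊆ 𝓢_{oₙ₊₁}` for every countable
limit ordinal `o` and every `n`. -/
def FundamentalSystem.Nested (Φ : FundamentalSystem) : Prop :=
  ∀ o, Order.IsSuccLimit o → o < ω₁ → ∀ n,
    schreier Φ (Φ.seq o n) ⊆ schreier Φ (Φ.seq o (n + 1))

/-! ### The norming set -/

/-- All `(f₁ + ⋯ + f_d) / ℓ` with `f₁ < ⋯ < f_d` in `G` and `1 ≤ d ≤ ℓ`. -/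
def averages (G : Set (ℕ+ →₀ ℝ)) (ℓ : ℕ) : Set (ℕ+ →₀ ℝ) :=
  {f | ∃ (d : ℕ) (g : Fin d → ℕ+ →₀ ℝ), 1 ≤ d ∧ d ≤ ℓ ∧ (∀ i, g i ∈ G) ∧
    (∀ i j, i < j → Before (g i).support (g j).support) ∧ f = (ℓ : ℝ)⁻¹ • ∑ i, g i}

/-- `f` is an `α`-average in `G` of size `ℓ ≥ 2`. A vector may have several sizes. -/
def IsAverage (G : Set (ℕ+ →₀ ℝ)) (ℓ : ℕ) (f : ℕ+ →₀ ℝ) : Prop :=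
  f ∈ G ∧ 2 ≤ ℓ ∧ f ∈ averages G ℓ

/-- All sums `α₁ + ⋯ + α_d`, `d ≥ 1`, of `α`-averages of `G` that are `𝓕`-admissible
(`α₁ < ⋯ < α_d` and `{min supp α_q : q ≤ d} ∈ 𝓕`) and very fast growing (they have sizes
`s₁ < ⋯ < s_d` with `s_q > max supp α_{q-1}`). -/
def schreierSums (𝓕 : Set (Finset ℕ+)) (G : Set (ℕ+ →₀ ℝ)) : Set (ℕ+ →₀ ℝ) :=
  {f | ∃ (d : ℕ) (α : Fin d → ℕ+ →₀ ℝ) (s : Fin d → ℕ) (m : Fin d → ℕ+), 1 ≤ d ∧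
    (∀ q, IsAverage G (s q) (α q)) ∧
    (∀ p q, p < q → Before (α p).support (α q).support) ∧
    (∀ q, IsLeast ((α q).support : Set ℕ+) (m q)) ∧ Finset.univ.image m ∈ 𝓕 ∧
    StrictMono s ∧ (∀ p q, p < q → ∀ k ∈ (α p).support, (k : ℕ) < s q) ∧
    f = ∑ q, α q}

/-- The sets `W₀ ⊆ W₁ ⊆ ⋯`; `W₀ = {±eₙ}`. -/
def normingStep (𝓕 : Set (Finset ℕ+)) : ℕ → Set (ℕ+ →₀ ℝ)
  | 0 => {f | ∃ n, f = Finsupp.single n 1 ∨ f = Finsupp.single n (-1)}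
  | m + 1 => {f | ∃ ℓ, 2 ≤ ℓ ∧ f ∈ averages (normingStep 𝓕 m) ℓ} ∪
      schreierSums 𝓕 (normingStep 𝓕 m) ∪ normingStep 𝓕 m

/-- The norming set `W = ⋃ₘ Wₘ`. -/
def normingSet (𝓕 : Set (Finset ℕ+)) : Set (ℕ+ →₀ ℝ) := ⋃ m, normingStep 𝓕 m

/-- The action of `f ∈ c₀₀` on `x ∈ c₀₀`. -/
def pairing (f x : ℕ+ →₀ ℝ) : ℝ := f.sum fun i a => a * x i

/-! ### The space -/

/-- `c₀₀`, to be normed by the norming set built from the family `𝓕`. -/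
def C00 (_𝓕 : Set (Finset ℕ+)) : Type := ℕ+ →₀ ℝ

instance (𝓕 : Set (Finset ℕ+)) : AddCommGroup (C00 𝓕) :=
  inferInstanceAs (AddCommGroup (ℕ+ →₀ ℝ))

instance (𝓕 : Set (Finset ℕ+)) : Module ℝ (C00 𝓕) :=
  inferInstanceAs (Module ℝ (ℕ+ →₀ ℝ))

/-- A finitely supported vector as an element of the normed `c₀₀`. -/
def C00.of (𝓕 : Set (Finset ℕ+)) : (ℕ+ →₀ ℝ) ≃ₗ[ℝ] C00 𝓕 := LinearEquiv.refl ℝ (ℕ+ →₀ ℝ)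

/-- `‖x‖ = sup {f(x) : f ∈ W}`. -/
instance (𝓕 : Set (Finset ℕ+)) : Norm (C00 𝓕) :=
  ⟨fun x => sSup ((fun f => pairing f ((C00.of 𝓕).symm x)) '' normingSet 𝓕)⟩

theorem abs_le_one_of_mem_normingStep (𝓕 : Set (Finset ℕ+)) (m : ℕ) (f : ℕ+ →₀ ℝ)
    (hf : f ∈ normingStep 𝓕 m) (k : ℕ+) : |f k| ≤ 1 := by
  induction m generalizing f with
  | zero =>
    obtain ⟨n, rfl | rfl⟩ := hf <;> rw [Finsupp.single_apply] <;> split_ifs <;> simp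
  | succ m ih =>
    rcases hf with (⟨ℓ, hℓ, d, g, -, hd, hg, -, rfl⟩ | ⟨d, α, s, l, -, hα, hB, -, -, -, -, rfl⟩) | hf
    · have h1 : |∑ i, g i k| ≤ ℓ := by
        calc |∑ i, g i k| ≤ ∑ i, |g i k| := Finset.abs_sum_le_sum_abs _ _
          _ ≤ ∑ _i : Fin d, (1 : ℝ) := Finset.sum_le_sum fun i _ => ih _ (hg i)
          _ = d := by simp
          _ ≤ ℓ := by exact_mod_cast hd
      have h2 : (0 : ℝ) < ℓ := by exact_mod_cast (by omega : 0 < ℓ)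
      rw [Finsupp.smul_apply, Finsupp.finsetSum_apply, smul_eq_mul, abs_mul, abs_inv,
        abs_of_pos h2, inv_mul_le_iff₀ h2, mul_one]
      exact h1
    · rw [Finsupp.finsetSum_apply]
      by_cases h : ∃ q, α q k ≠ 0
      · obtain ⟨q, hq⟩ := h
        rw [Finset.sum_eq_single q]
        · exact ih _ (hα q).1
        · intro p _ hpq
          by_contra hp
          rcases lt_or_gt_of_ne hpq with h | h
          · exact lt_irrefl _ (hB _ _ h k (by simpa using hp) k (by simpa using hq))
          · exact lt_irrefl _ (hB _ _ h k (by simpa using hq) k (by simpa using hp))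
        · simp
      · push Not at h
        simp [h]
    · exact ih _ hf

theorem neg_mem_averages {G : Set (ℕ+ →₀ ℝ)} (hG : ∀ f ∈ G, -f ∈ G) {ℓ : ℕ} {f : ℕ+ →₀ ℝ}
    (hf : f ∈ averages G ℓ) : -f ∈ averages G ℓ := by
  obtain ⟨d, g, h1, h2, h3, h4, rfl⟩ := hf
  exact ⟨d, fun i => -g i, h1, h2, fun i => hG _ (h3 i), by simpa using h4, by simp⟩

theorem neg_mem_normingStep (𝓕 : Set (Finset ℕ+)) (m : ℕ) (f : ℕ+ →₀ ℝ)
    (hf : f ∈ normingStep 𝓕 m) : -f ∈ normingStep 𝓕 m := by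
  induction m generalizing f with
  | zero =>
    obtain ⟨n, rfl | rfl⟩ := hf
    · exact ⟨n, Or.inr (by simp)⟩
    · exact ⟨n, Or.inl (by simp)⟩
  | succ m ih =>
    rcases hf with (⟨ℓ, hℓ, hf⟩ | ⟨d, α, s, l, h1, h2, h3, h4, h5, h6, h7, rfl⟩) | hf
    · exact Or.inl (Or.inl ⟨ℓ, hℓ, neg_mem_averages ih hf⟩)
    · refine Or.inl (Or.inr ⟨d, fun q => -α q, s, l, h1, fun q => ?_, by simpa using h3,
        by simpa using h4, h5, h6, by simpa using h7, by simp⟩)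
      exact ⟨ih _ (h2 q).1, (h2 q).2.1, neg_mem_averages ih (h2 q).2.2⟩
    · exact Or.inr (ih _ hf)

theorem neg_mem_normingSet (𝓕 : Set (Finset ℕ+)) (f : ℕ+ →₀ ℝ)
    (hf : f ∈ normingSet 𝓕) : -f ∈ normingSet 𝓕 := by
  obtain ⟨m, hm⟩ := Set.mem_iUnion.1 hf
  exact Set.mem_iUnion.2 ⟨m, neg_mem_normingStep 𝓕 m f hm⟩

theorem single_mem_normingSet (𝓕 : Set (Finset ℕ+)) (n : ℕ+) :
    Finsupp.single n 1 ∈ normingSet 𝓕 :=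
  Set.mem_iUnion.2 ⟨0, n, Or.inl rfl⟩

theorem pairing_eq (f x : ℕ+ →₀ ℝ) : pairing f x = ∑ i ∈ x.support, f i * x i := by
  unfold pairing
  rw [Finsupp.sum_of_support_subset f (Finset.subset_union_left (s₂ := x.support)) _ (by simp)]
  refine (Finset.sum_subset Finset.subset_union_right fun i _ hi => ?_).symm
  simp [Finsupp.notMem_support_iff.1 hi]

theorem pairing_neg_left (f x : ℕ+ →₀ ℝ) : pairing (-f) x = -pairing f x := by
  simp [pairing_eq]

theorem pairing_add (f x y : ℕ+ →₀ ℝ) : pairing f (x + y) = pairing f x + pairing f y := by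
  simp [pairing, Finsupp.sum, mul_add, Finset.sum_add_distrib]

theorem pairing_smul (f : ℕ+ →₀ ℝ) (c : ℝ) (x : ℕ+ →₀ ℝ) :
    pairing f (c • x) = c * pairing f x := by
  simp [pairing, Finsupp.sum, Finset.mul_sum, mul_left_comm]

theorem abs_pairing_le (𝓕 : Set (Finset ℕ+)) (f : ℕ+ →₀ ℝ) (hf : f ∈ normingSet 𝓕)
    (x : ℕ+ →₀ ℝ) : |pairing f x| ≤ ∑ i ∈ x.support, |x i| := by
  obtain ⟨m, hm⟩ := Set.mem_iUnion.1 hf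
  rw [pairing_eq]
  refine (Finset.abs_sum_le_sum_abs _ _).trans (Finset.sum_le_sum fun i _ => ?_)
  rw [abs_mul]
  exact mul_le_of_le_one_left (abs_nonneg _) (abs_le_one_of_mem_normingStep 𝓕 m f hm i)

theorem abs_pairing_le_norm (𝓕 : Set (Finset ℕ+)) (f : ℕ+ →₀ ℝ) (hf : f ∈ normingSet 𝓕)
    (x : C00 𝓕) : |pairing f ((C00.of 𝓕).symm x)| ≤ ‖x‖ := by
  have hb : BddAbove ((fun f => pairing f ((C00.of 𝓕).symm x)) '' normingSet 𝓕) := by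
    refine ⟨∑ i ∈ ((C00.of 𝓕).symm x).support, |((C00.of 𝓕).symm x) i|, ?_⟩
    rintro _ ⟨g, hg, rfl⟩
    exact (le_abs_self _).trans (abs_pairing_le 𝓕 g hg _)
  refine abs_le'.2 ⟨le_csSup hb ⟨f, hf, rfl⟩, ?_⟩
  rw [← pairing_neg_left]
  exact le_csSup hb ⟨-f, neg_mem_normingSet 𝓕 f hf, rfl⟩

theorem norm_le_of_pairing_le (𝓕 : Set (Finset ℕ+)) (x : C00 𝓕) (r : ℝ)
    (h : ∀ f ∈ normingSet 𝓕, pairing f ((C00.of 𝓕).symm x) ≤ r) : ‖x‖ ≤ r := by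
  refine csSup_le ⟨_, _, single_mem_normingSet 𝓕 1, rfl⟩ ?_
  rintro _ ⟨f, hf, rfl⟩
  exact h f hf

theorem norm_smul_le (𝓕 : Set (Finset ℕ+)) (c : ℝ) (x : C00 𝓕) : ‖c • x‖ ≤ |c| * ‖x‖ := by
  refine norm_le_of_pairing_le 𝓕 _ _ fun f hf => ?_
  rw [map_smul, pairing_smul]
  refine (le_abs_self _).trans ?_
  rw [abs_mul]
  exact mul_le_mul_of_nonneg_left (abs_pairing_le_norm 𝓕 f hf x) (abs_nonneg c)

theorem normCore (𝓕 : Set (Finset ℕ+)) : NormedSpace.Core ℝ (C00 𝓕) where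
  norm_nonneg x := (abs_nonneg _).trans (abs_pairing_le_norm 𝓕 _ (single_mem_normingSet 𝓕 1) x)
  norm_smul c x := by
    refine le_antisymm (norm_smul_le 𝓕 c x) ?_
    rcases eq_or_ne c 0 with rfl | hc
    · rw [norm_zero, zero_mul]
      exact (abs_nonneg _).trans (abs_pairing_le_norm 𝓕 _ (single_mem_normingSet 𝓕 1) _)
    · have h := norm_smul_le 𝓕 c⁻¹ (c • x)
      rw [smul_smul, inv_mul_cancel₀ hc, one_smul, abs_inv] at h
      rw [Real.norm_eq_abs]
      exact (le_inv_mul_iff₀ (abs_pos.2 hc)).1 h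
  norm_triangle x y := by
    refine norm_le_of_pairing_le 𝓕 _ _ fun f hf => ?_
    rw [map_add, pairing_add]
    exact add_le_add ((le_abs_self _).trans (abs_pairing_le_norm 𝓕 f hf x))
      ((le_abs_self _).trans (abs_pairing_le_norm 𝓕 f hf y))
  norm_eq_zero_iff x := by
    constructor
    · intro h
      apply (C00.of 𝓕).symm.injective
      ext n
      have h1 := abs_pairing_le_norm 𝓕 _ (single_mem_normingSet 𝓕 n) x
      rw [h] at h1
      have h2 := abs_nonpos_iff.1 h1
      simpa [pairing] using h2
    · rintro rfl
      refine le_antisymm (norm_le_of_pairing_le 𝓕 _ _ fun f _ => ?_) ?_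
      · simp [pairing]
      · exact (abs_nonneg _).trans (abs_pairing_le_norm 𝓕 _ (single_mem_normingSet 𝓕 1) _)

instance (𝓕 : Set (Finset ℕ+)) : NormedAddCommGroup (C00 𝓕) :=
  NormedAddCommGroup.ofCore (normCore 𝓕)

instance (𝓕 : Set (Finset ℕ+)) : NormedSpace ℝ (C00 𝓕) := NormedSpace.ofCore (normCore 𝓕)

/-- The Banach space `𝔛_{0,1}^{ω^ξ}`: the completion of `c₀₀` normed by the set `W` built from
the Schreier family `𝓢_{ω^ξ}`. -/
abbrev Space (Φ : FundamentalSystem) (ξ : Ordinal.{0}) : Type :=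
  UniformSpace.Completion (C00 (schreier Φ (ω ^ ξ)))

/-- The image in the space of a finitely supported vector; `Finsupp.single n 1` gives `eₙ`. -/
def Space.of (Φ : FundamentalSystem) (ξ : Ordinal.{0}) (u : ℕ+ →₀ ℝ) : Space Φ ξ :=
  ((C00.of (schreier Φ (ω ^ ξ)) u : C00 (schreier Φ (ω ^ ξ))) : Space Φ ξ)

/-- A normalized block sequence of the basis `(eₙ)`: norm one vectors with finite supports
`supp x₁ < supp x₂ < ⋯`. (The members of an infinite block sequence have finite supports.) -/
def IsNormalizedBlock (Φ : FundamentalSystem) (ξ : Ordinal.{0}) (x : ℕ+ → Space Φ ξ) : Prop :=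
  ∃ u : ℕ+ → ℕ+ →₀ ℝ, (∀ i, x i = Space.of Φ ξ (u i)) ∧ (∀ i, ‖x i‖ = 1) ∧
    Successive fun i => (u i).support

/-! ### Spreading models -/

section SpreadingModels

variable {X : Type} [NormedAddCommGroup X] [NormedSpace ℝ X]

/-- A basic sequence: a Schauder basis of its closed linear span. -/
def IsBasicSequence (x : ℕ+ → X) : Prop :=
  ∃ b : GeneralSchauderBasis ℕ+ ℝ (Submodule.span ℝ (Set.range x)).topologicalClosure
    (SummationFilter.conditional ℕ+), ∀ i, (b.basis i : X) = x i

/-- A `K`-`ℓ₁^𝓕` spreading model. -/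
def IsEllOneSpreadingModelWith (K : ℝ) (𝓕 : Set (Finset ℕ+)) (x : ℕ+ → X) : Prop :=
  IsBasicSequence x ∧ ∃ c C : ℝ, 0 < c ∧ 0 < C ∧ c * C ≤ K ∧ ∀ E ∈ 𝓕, ∀ a : ℕ+ → ℝ,
    c⁻¹ * ∑ i ∈ E, |a i| ≤ ‖∑ i ∈ E, a i • x i‖ ∧ ‖∑ i ∈ E, a i • x i‖ ≤ C * ∑ i ∈ E, |a i|

/-- An `ℓ₁^𝓕` spreading model. -/
def IsEllOneSpreadingModel (𝓕 : Set (Finset ℕ+)) (x : ℕ+ → X) : Prop :=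
  ∃ K : ℝ, 1 ≤ K ∧ IsEllOneSpreadingModelWith K 𝓕 x

/-- A `K`-`c₀^𝓕` spreading model; the expression `E.sup` is `max_{i ∈ E} |aᵢ|`, and `0` for
`E = ∅`. -/
def IsCZeroSpreadingModelWith (K : ℝ) (𝓕 : Set (Finset ℕ+)) (x : ℕ+ → X) : Prop :=
  IsBasicSequence x ∧ ∃ c C : ℝ, 0 < c ∧ 0 < C ∧ c * C ≤ K ∧ ∀ E ∈ 𝓕, ∀ a : ℕ+ → ℝ,
    c⁻¹ * (E.sup fun i => ‖a i‖₊ : ℝ≥0) ≤ ‖∑ i ∈ E, a i • x i‖ ∧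
    ‖∑ i ∈ E, a i • x i‖ ≤ C * (E.sup fun i => ‖a i‖₊ : ℝ≥0)

/-- A `c₀^𝓕` spreading model. -/
def IsCZeroSpreadingModel (𝓕 : Set (Finset ℕ+)) (x : ℕ+ → X) : Prop :=
  ∃ K : ℝ, 1 ≤ K ∧ IsCZeroSpreadingModelWith K 𝓕 x

end SpreadingModels

end X01

end

/-! Everything is governed by one index. A block sequence has index zero (`IndexZero`) if, for each
fixed level 𝓖ₙ of 𝓕 = 𝓢_{ω^ξ}, the 𝓖ₙ-admissible very fast growing sequences of averages of large
size act on the tail with small total absolute value. The facts used about 𝓕 are collected in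
`GoodLevels`. Here 𝓕 consists of the sets A that lie in some 𝓖ₙ with n ≤ A. Since ζ + ω^ξ = ω^ξ for
ζ < ω^ξ, unions of members of 𝓖ₙ indexed by a member of 𝓕 stay in 𝓕 along a subsequence. Finally, 𝓕
carries convex combinations with little mass on 𝓖ₙ.

If the index is not zero, the sequences of averages that witness this for well separated vectors can
be concatenated into one functional of W, which gives a lower ℓ₁ estimate on 𝓕
(`exists_ellOne_subsequence`). If the index is zero, a sparse subsequence satisfies |f(∑ aᵢvᵢ)| ≤ 1
+ (|E|+1)η for |aᵢ| ≤ 1, by induction on f ∈ W (`CZeroData.bound`). In a Schreier sum, the first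
vector met bounds the level of admissibility, so the averages after the first one to meet it are
negligible on the other vectors. A single average is controlled because its size is at least 2.

For (i), averaging |F| almost norming functionals shows that sums over F with |F| → ∞ do not have
index zero (`exists_ellOne_of_sums`). For (ii), convex combinations with small mass on every fixed
level have index zero (`sum_abs_pairing_convex_le`), and the ℓ₁ estimate bounds their norms below,
so they may be normalized. Mass is tested through t(j) = max supp vⱼ, because admissibility of
functionals concerns supports and not indices. -/

namespace X01

/-! ### Regular families -/

/-- A family that is hereditary and closed under moving elements to the right. -/
def Regular (𝓖 : Set (Finset ℕ+)) : Prop :=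
  ∀ A ∈ 𝓖, ∀ (B : Finset ℕ+) (φ : ℕ+ → ℕ+), (∀ b ∈ B, φ b ∈ A ∧ φ b ≤ b) →
    StrictMonoOn φ B → B ∈ 𝓖

theorem Regular.subset {𝓖 : Set (Finset ℕ+)} (h : Regular 𝓖) {A B : Finset ℕ+} (hA : A ∈ 𝓖)
    (hB : B ⊆ A) : B ∈ 𝓖 :=
  h A hA B id (fun _ hb => ⟨hB hb, le_rfl⟩) (strictMono_id.strictMonoOn _)

/-- Minima of supports occur as images of an index set, so both the given set and its shift to the
right are written in that way. The map required by `Regular` is φ composed with the inverse of ψ. -/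
theorem Regular.subset_image {ι : Type} [LinearOrder ι] {𝓖 : Set (Finset ℕ+)} (h : Regular 𝓖)
    {A : Finset ℕ+} {B : Finset ι} (hA : A ∈ 𝓖) {φ ψ : ι → ℕ+} (hB : ∀ b ∈ B, φ b ∈ A)
    (hφ : StrictMonoOn φ B) (hψ : StrictMonoOn ψ B) (hle : ∀ b ∈ B, φ b ≤ ψ b) :
    B.image ψ ∈ 𝓖 := by
  classical
  rcases B.eq_empty_or_nonempty with rfl | ⟨b₀, -⟩
  · exact h.subset hA (by simp)
  have : Nonempty ι := ⟨b₀⟩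
  have hinv : ∀ b ∈ B, Function.invFunOn ψ B (ψ b) = b := fun b hb =>
    hψ.injOn.leftInvOn_invFunOn hb
  refine h A hA _ (fun c => φ (Function.invFunOn ψ B c)) ?_ ?_
  · intro c hc
    obtain ⟨b, hb, rfl⟩ := Finset.mem_image.1 hc
    rw [hinv b hb]
    exact ⟨hB b hb, hle b hb⟩
  · intro c hc d hd hcd
    obtain ⟨b, hb, rfl⟩ := Finset.mem_image.1 (Finset.mem_coe.1 hc)
    obtain ⟨e, he, rfl⟩ := Finset.mem_image.1 (Finset.mem_coe.1 hd)
    simp only [hinv b hb, hinv e he]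
    exact hφ hb he ((hψ.lt_iff_lt hb he).1 hcd)

theorem Regular.image_strictMono {𝓖 : Set (Finset ℕ+)} (h : Regular 𝓖) {A : Finset ℕ+}
    (hA : A ∈ 𝓖) {ψ : ℕ+ → ℕ+} (hψ : StrictMono ψ) : A.image ψ ∈ 𝓖 :=
  h.subset_image hA (φ := id) (fun _ hb => hb) (strictMono_id.strictMonoOn _) (hψ.strictMonoOn _)
    fun _ _ => hψ.le_apply

theorem Regular.empty_mem {𝓖 : Set (Finset ℕ+)} (h : Regular 𝓖) {A : Finset ℕ+} (hA : A ∈ 𝓖) :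
    ∅ ∈ 𝓖 := h.subset hA (Finset.empty_subset _)

theorem card_le_of_strictMonoOn {A B : Finset ℕ+} {φ : ℕ+ → ℕ+} (h : ∀ b ∈ B, φ b ∈ A)
    (hφ : StrictMonoOn φ B) : B.card ≤ A.card :=
  Finset.card_le_card_of_injOn φ h hφ.injOn

theorem regular_card_le (n : ℕ) : Regular {E | E.card ≤ n} := fun _ hA _ _ h hφ =>
  (card_le_of_strictMonoOn (fun b hb => (h b hb).1) hφ).trans hA

theorem regular_schreierZero : Regular schreierZero := regular_card_le 1

theorem mem_compFamily_of_finset {ι : Type} [LinearOrder ι] {𝓖 : Set (Finset ℕ+)} (R : Finset ι)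
    (E : ι → Finset ℕ+) (hB : ∀ i ∈ R, ∀ j ∈ R, i < j → Before (E i) (E j))
    (hG : ∀ i ∈ R, E i ∈ 𝓖) (hc : ∀ k ∈ R.biUnion E, R.card ≤ (k : ℕ)) :
    R.biUnion E ∈ compFamily schreierOne 𝓖 := by
  classical
  -- `compFamily` wants non-empty pieces; discarding the empty ones only lowers their number.
  set S := R.filter fun i => (E i).Nonempty with hS
  have hSR : ∀ i ∈ S, i ∈ R := fun i hi => (Finset.mem_filter.1 hi).1
  have hne : ∀ i ∈ S, (E i).Nonempty := fun i hi => (Finset.mem_filter.1 hi).2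
  let e := S.orderEmbOfFin rfl
  have he : ∀ i, e i ∈ S := S.orderEmbOfFin_mem rfl
  have hU : R.biUnion E = Finset.univ.biUnion fun i => E (e i) := by
    ext k
    simp only [Finset.mem_biUnion, Finset.mem_univ, true_and]
    constructor
    · rintro ⟨i, hi, hk⟩
      have : i ∈ S := Finset.mem_filter.2 ⟨hi, k, hk⟩
      have h2 : i ∈ Set.range e := by
        rw [Finset.range_orderEmbOfFin]; exact this
      obtain ⟨j, rfl⟩ := h2
      exact ⟨j, hk⟩
    · rintro ⟨j, hk⟩
      exact ⟨e j, hSR _ (he j), hk⟩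
  refine ⟨S.card, fun i => E (e i), fun i => hne _ (he i), fun i j hij => ?_, fun i => ?_, ?_, hU⟩
  · exact hB _ (hSR _ (he i)) _ (hSR _ (he j)) (e.strictMono hij)
  · exact hG _ (hSR _ (he i))
  · intro k hk
    obtain ⟨i, -, rfl⟩ := Finset.mem_image.1 hk
    refine (Finset.card_image_le.trans ?_).trans
      (hc _ (Finset.mem_biUnion.2 ⟨_, hSR _ (he i), Finset.min'_mem _ (hne _ (he i))⟩))
    simpa using Finset.card_le_card (Finset.filter_subset _ _)

theorem exists_of_mem_compFamily {𝓖 : Set (Finset ℕ+)} {A : Finset ℕ+}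
    (hA : A ∈ compFamily schreierOne 𝓖) : ∃ (n : ℕ) (E : Fin n → Finset ℕ+),
      (∀ i j, i < j → Before (E i) (E j)) ∧ (∀ i, E i ∈ 𝓖) ∧ (∀ k ∈ A, n ≤ (k : ℕ)) ∧
      A = Finset.univ.biUnion E := by
  obtain ⟨n, E, hE, hB, hG, hS, rfl⟩ := hA
  refine ⟨n, E, hB, hG, fun k hk => ?_, rfl⟩
  obtain ⟨i, -, hi⟩ := Finset.mem_biUnion.1 hk
  have hm : StrictMono fun i => (E i).min' (hE i) := fun i j hij =>
    hB i j hij _ (Finset.min'_mem _ _) _ (Finset.min'_mem _ _)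
  have h1 := hS ((E i).min' (hE i)) (Finset.mem_image_of_mem _ (Finset.mem_univ i))
  rw [Finset.card_image_of_injective _ hm.injective, Finset.card_univ, Fintype.card_fin] at h1
  exact h1.trans (by exact_mod_cast Finset.min'_le _ _ hi)

/-- Unions of at most `n` successive members of `𝓖`. -/
def unions (𝓖 : Set (Finset ℕ+)) (n : ℕ) : Set (Finset ℕ+) :=
  {A | ∃ E : Fin n → Finset ℕ+, (∀ i j, i < j → Before (E i) (E j)) ∧ (∀ i, E i ∈ 𝓖) ∧
    A = Finset.univ.biUnion E}

theorem Regular.unions {𝓖 : Set (Finset ℕ+)} (h : Regular 𝓖) (n : ℕ) : Regular (unions 𝓖 n) := by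
  classical
  rintro A ⟨E, hB, hG, rfl⟩ B φ hφ hmono
  refine ⟨fun i => B.filter fun b => φ b ∈ E i, fun i j hij a ha b hb => ?_, fun i => ?_, ?_⟩
  · rw [Finset.mem_filter] at ha hb
    exact (hmono.lt_iff_lt ha.1 hb.1).1 (hB i j hij _ ha.2 _ hb.2)
  · refine h _ (hG i) _ φ (fun b hb => ?_) (hmono.mono fun b hb => ?_)
    · rw [Finset.mem_filter] at hb
      exact ⟨hb.2, (hφ b hb.1).2⟩
    · exact (Finset.mem_filter.1 (Finset.mem_coe.1 hb)).1
  · ext b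
    simp only [Finset.mem_biUnion, Finset.mem_univ, true_and, Finset.mem_filter]
    constructor
    · intro hb
      obtain ⟨i, -, hi⟩ := Finset.mem_biUnion.1 (hφ b hb).1
      exact ⟨i, hb, hi⟩
    · rintro ⟨i, hb, -⟩
      exact hb

theorem unions_mono {𝓖 : Set (Finset ℕ+)} (h : ∅ ∈ 𝓖) {m n : ℕ} (hmn : m ≤ n) :
    unions 𝓖 m ⊆ unions 𝓖 n := by
  classical
  rintro A ⟨E, hB, hG, rfl⟩
  refine ⟨fun i => if hi : (i : ℕ) < m then E ⟨i, hi⟩ else ∅, fun i j hij => ?_, fun i => ?_, ?_⟩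
  · by_cases hj : (j : ℕ) < m
    · have hi : (i : ℕ) < m := lt_trans hij hj
      simp only [hi, hj, dif_pos]
      exact hB _ _ hij
    · simp [hj, Before]
  · dsimp only
    split_ifs
    · exact hG _
    · exact h
  · ext b
    simp only [Finset.mem_biUnion, Finset.mem_univ, true_and]
    constructor
    · rintro ⟨i, hi⟩
      exact ⟨⟨i, i.2.trans_le hmn⟩, by simpa using hi⟩
    · rintro ⟨i, hi⟩
      split_ifs at hi with h1
      · exact ⟨_, hi⟩
      · simp at hi

/-- This puts 𝓢₁[𝓖] in the form of the definition at limit ordinals, so that successor and limit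
steps can share their arguments through `IsLevels`. -/
theorem mem_compFamily_iff {𝓖 : Set (Finset ℕ+)} (h0 : ∅ ∈ 𝓖) {A : Finset ℕ+} :
    A ∈ compFamily schreierOne 𝓖 ↔ ∃ n : ℕ+, (∀ k ∈ A, n ≤ k) ∧ A ∈ unions 𝓖 n := by
  classical
  constructor
  · intro hA
    obtain ⟨n, E, hB, hG, hn, rfl⟩ := exists_of_mem_compFamily hA
    -- Levels are positive, while the empty set may be a union of zero pieces; hence the maximum
    -- with 1.
    obtain ⟨N, hN⟩ : ∃ N : ℕ+, (N : ℕ) = max n 1 := ⟨⟨max n 1, by simp⟩, rfl⟩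
    refine ⟨N, fun k hk => ?_, unions_mono h0 (hN ▸ le_max_left n 1) ⟨E, hB, hG, rfl⟩⟩
    rw [← PNat.coe_le_coe, hN]
    exact max_le (hn k hk) k.2
  · rintro ⟨n, hn, E, hB, hG, rfl⟩
    refine mem_compFamily_of_finset _ _ (fun i _ j _ => hB i j) (fun i _ => hG i) fun k hk => ?_
    simpa using hn k hk

theorem regular_of_levels {𝓕 : Set (Finset ℕ+)} {𝓖 : ℕ+ → Set (Finset ℕ+)}
    (hG : ∀ n, Regular (𝓖 n)) (h : ∀ A, A ∈ 𝓕 ↔ ∃ n : ℕ+, (∀ k ∈ A, n ≤ k) ∧ A ∈ 𝓖 n) :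
    Regular 𝓕 := by
  intro A hA B φ hφ hm
  obtain ⟨n, hn, hA'⟩ := (h A).1 hA
  exact (h B).2 ⟨n, fun k hk => (hn _ (hφ k hk).1).trans (hφ k hk).2, hG n A hA' B φ hφ hm⟩

/-! ### The Schreier families -/

/-- Induction on countable ordinals. -/
theorem countable_induction {P : ∀ o : Ordinal.{0}, o < ω₁ → Prop} (zero : ∀ h, P 0 h)
    (succ : ∀ o (h : o + 1 < ω₁), P o ((Order.lt_add_one_iff.2 le_rfl).trans h) → P (o + 1) h)
    (limit : ∀ o, Order.IsSuccLimit o → ∀ h : o < ω₁, (∀ a (ha : a < o), P a (ha.trans h)) → P o h)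
    (o : Ordinal.{0}) (ho : o < ω₁) : P o ho := by
  induction o using Ordinal.limitRecOn with
  | zero => exact zero ho
  | add_one o ih => exact succ o ho (ih _)
  | limit o hl ih => exact limit o hl ho fun a ha => ih a ha _

variable (Φ : FundamentalSystem)

theorem schreier_regular_and_empty (o : Ordinal.{0}) (ho : o < ω₁) :
    Regular (schreier Φ o) ∧ ∅ ∈ schreier Φ o := by
  induction o, ho using countable_induction with
  | zero => rw [schreier_zero]; exact ⟨regular_schreierZero, by simp [schreierZero]⟩
  | succ o ho ih =>
    rw [schreier_add_one]
    refine ⟨regular_of_levels (fun n => ih.1.unions n) fun A => mem_compFamily_iff ih.2, ?_⟩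
    rw [mem_compFamily_iff ih.2]
    exact ⟨1, by simp, (ih.1.unions _).empty_mem ⟨fun _ => ∅, by simp [Before], by simp [ih.2], rfl⟩⟩
  | limit o hl ho ih =>
    refine ⟨regular_of_levels (fun n => (ih _ (Φ.seq_lt o hl ho n)).1)
      fun A => by rw [schreier_limit Φ o hl ho]; rfl, ?_⟩
    rw [schreier_limit Φ o hl ho]
    exact ⟨1, by simp, (ih _ (Φ.seq_lt o hl ho 1)).2⟩

variable {Φ}

theorem regular_schreier {o : Ordinal.{0}} (ho : o < ω₁) : Regular (schreier Φ o) :=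
  (schreier_regular_and_empty Φ o ho).1

theorem empty_mem_schreier {o : Ordinal.{0}} (ho : o < ω₁) : ∅ ∈ schreier Φ o :=
  (schreier_regular_and_empty Φ o ho).2

theorem mem_unions_one {𝓖 : Set (Finset ℕ+)} {A : Finset ℕ+} (hA : A ∈ 𝓖) : A ∈ unions 𝓖 1 :=
  ⟨fun _ => A, fun i j hij => absurd hij (by simp [Subsingleton.elim i j]), fun _ => hA, by
    ext; simp⟩

theorem schreier_subset_add_one {o : Ordinal.{0}} (ho : o < ω₁) :
    schreier Φ o ⊆ schreier Φ (o + 1) := by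
  intro A hA
  rw [schreier_add_one, mem_compFamily_iff (empty_mem_schreier ho)]
  exact ⟨1, by simp, by simpa using mem_unions_one hA⟩

/-- The Schreier families increase only up to an initial segment: at a limit o a member of an
earlier family enters through some 𝓢_{oₙ}, and then it has to lie beyond n. -/
theorem schreier_tail_subset (θ : Ordinal.{0}) (hθ : θ < ω₁) :
    ∀ η ≤ θ, ∃ N : ℕ+, ∀ E ∈ schreier Φ η, (∀ k ∈ E, N ≤ k) → E ∈ schreier Φ θ := by
  induction θ, hθ using countable_induction with
  | zero =>
    intro η hη
    obtain rfl : η = 0 := by simpa using hη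
    exact ⟨1, fun E hE _ => hE⟩
  | succ o ho ih =>
    intro η hη
    rcases hη.eq_or_lt with rfl | hη
    · exact ⟨1, fun E hE _ => hE⟩
    · obtain ⟨N, hN⟩ := ih η (Order.lt_add_one_iff.1 hη)
      exact ⟨N, fun E hE hk =>
        schreier_subset_add_one ((Order.lt_add_one_iff.2 le_rfl).trans ho) (hN E hE hk)⟩
  | limit o hl ho ih =>
    intro η hη
    rcases hη.eq_or_lt with rfl | hη
    · exact ⟨1, fun E hE _ => hE⟩
    · obtain ⟨n, hn⟩ := Φ.cofinal o hl ho η hη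
      obtain ⟨N, hN⟩ := ih _ (Φ.seq_lt o hl ho n) η hn.le
      refine ⟨max N n, fun E hE hk => ?_⟩
      rw [schreier_limit Φ o hl ho]
      exact ⟨n, fun k h => (le_max_right _ _).trans (hk k h),
        hN E hE fun k h => (le_max_left _ _).trans (hk k h)⟩

theorem singleton_mem_schreier (o : Ordinal.{0}) (ho : o < ω₁) (k : ℕ+) : {k} ∈ schreier Φ o := by
  have h : ∀ k : ℕ+, {k} ∈ schreier Φ o := by
    induction o, ho using countable_induction with
    | zero => intro k; rw [schreier_zero]; simp [schreierZero]
    | succ o ho ih =>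
      exact fun k => schreier_subset_add_one ((Order.lt_add_one_iff.2 le_rfl).trans ho) (ih k)
    | limit o hl ho ih =>
      intro k
      rw [schreier_limit Φ o hl ho]
      exact ⟨1, by simp, ih _ (Φ.seq_lt o hl ho 1) k⟩
  exact h k

theorem FundamentalSystem.Nested.mono (hΦ : Φ.Nested) {o : Ordinal.{0}} (hl : Order.IsSuccLimit o)
    (ho : o < ω₁) {m n : ℕ+} (hmn : m ≤ n) : schreier Φ (Φ.seq o m) ⊆ schreier Φ (Φ.seq o n) := by
  induction n using PNat.recOn with
  | one => rw [le_antisymm hmn one_le]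
  | succ n ih =>
    rcases hmn.eq_or_lt with rfl | h
    · exact subset_rfl
    · exact (ih (PNat.lt_add_one_iff.1 h)).trans (hΦ o hl ho n)

/-! ### Small convex combinations -/

/-- Arbitrarily far out there are convex combinations supported by members of `𝓔` that give
arbitrarily small mass to the sets whose image under `t` belongs to `𝓖`. -/
def SmallConvex (𝓔 𝓖 : Set (Finset ℕ+)) : Prop :=
  ∀ t : ℕ+ → ℕ+, StrictMono t → ∀ δ : ℝ, 0 < δ → ∀ k : ℕ+, ∃ E ∈ 𝓔, ∃ a : ℕ+ → ℝ,
    (∀ i ∈ E, k < i) ∧ (∀ i, 0 ≤ a i) ∧ ∑ i ∈ E, a i = 1 ∧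
    ∀ G ⊆ E, G.image t ∈ 𝓖 → ∑ i ∈ G, a i ≤ δ

/-- Sequences of convex combinations supported by members of `𝓔` whose total mass on a set with
image in `𝓔` is at most `2`. -/
def BoundedConvexSeq (𝓔 : Set (Finset ℕ+)) : Prop :=
  ∀ t : ℕ+ → ℕ+, StrictMono t → ∀ k : ℕ+, ∃ (E : ℕ → Finset ℕ+) (a : ℕ → ℕ+ → ℝ),
    (∀ i, E i ∈ 𝓔) ∧ (∀ i, ∀ j ∈ E i, k < j) ∧ (∀ i j, i < j → Before (E i) (E j)) ∧
    (∀ i j, 0 ≤ a i j) ∧ (∀ i, ∑ j ∈ E i, a i j = 1) ∧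
    ∀ n G, G.image t ∈ 𝓔 → ∑ i ∈ Finset.range n, ∑ j ∈ G ∩ E i, a i j ≤ 2

/-- `𝓕 = {A : ∃ n ≤ A, A ∈ 𝓖ₙ}` with regular families `𝓖₁ ⊆ 𝓖₂ ⊆ ⋯`. -/
structure IsLevels (𝓕 : Set (Finset ℕ+)) (𝓖 : ℕ+ → Set (Finset ℕ+)) : Prop where
  regular : ∀ n, Regular (𝓖 n)
  mono : Monotone 𝓖
  mem_iff : ∀ A, A ∈ 𝓕 ↔ ∃ n : ℕ+, (∀ k ∈ A, n ≤ k) ∧ A ∈ 𝓖 n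

theorem SmallConvex.of_tail {𝓔 𝓔' 𝓖 : Set (Finset ℕ+)} (h : SmallConvex 𝓔 𝓖) {N : ℕ+}
    (hN : ∀ E ∈ 𝓔, (∀ k ∈ E, N ≤ k) → E ∈ 𝓔') : SmallConvex 𝓔' 𝓖 := by
  intro t ht δ hδ k
  obtain ⟨E, hE, a, h1, h2, h3, h4⟩ := h t ht δ hδ (max k N)
  exact ⟨E, hN E hE fun i hi => ((le_max_right _ _).trans_lt (h1 i hi)).le, a,
    fun i hi => (le_max_left _ _).trans_lt (h1 i hi), h2, h3, h4⟩

theorem sum_biUnion_le {ι κ : Type*} [DecidableEq κ] (R : Finset ι) (T : ι → Finset κ) {a : κ → ℝ}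
    (ha : ∀ j, 0 ≤ a j) : ∑ j ∈ R.biUnion T, a j ≤ ∑ i ∈ R, ∑ j ∈ T i, a j := by
  classical
  induction R using Finset.induction_on with
  | empty => simp
  | insert i R hi ih =>
    rw [Finset.biUnion_insert, Finset.sum_insert hi]
    have := Finset.sum_union_inter (s₁ := T i) (s₂ := R.biUnion T) (f := a)
    have := Finset.sum_nonneg fun j (_ : j ∈ T i ∩ R.biUnion T) => ha j
    linarith

/-- A union of n pieces has at most n times the largest mass of a piece, so mass δ/(n+1) per piece
suffices. -/
theorem SmallConvex.unions {𝓔 𝓖 : Set (Finset ℕ+)} (h : SmallConvex 𝓔 𝓖) (hG : Regular 𝓖)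
    (n : ℕ) : SmallConvex 𝓔 (unions 𝓖 n) := by
  classical
  intro t ht δ hδ k
  obtain ⟨E, hE, a, h1, h2, h3, h4⟩ := h t ht (δ / (n + 1)) (by positivity) k
  refine ⟨E, hE, a, h1, h2, h3, ?_⟩
  rintro G hGE ⟨A, -, hA, hU⟩
  have hsub : G ⊆ Finset.univ.biUnion fun i => G.filter fun j => t j ∈ A i := by
    intro j hj
    have := Finset.mem_image_of_mem t hj
    rw [hU] at this
    obtain ⟨i, -, hi⟩ := Finset.mem_biUnion.1 this
    exact Finset.mem_biUnion.2 ⟨i, Finset.mem_univ _, Finset.mem_filter.2 ⟨hj, hi⟩⟩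
  calc ∑ i ∈ G, a i ≤ ∑ i ∈ Finset.univ.biUnion fun i => G.filter fun j => t j ∈ A i, a i :=
        Finset.sum_le_sum_of_subset_of_nonneg hsub fun i _ _ => h2 i
    _ ≤ ∑ i : Fin n, ∑ j ∈ G.filter fun j => t j ∈ A i, a j :=
        sum_biUnion_le _ _ h2
    _ ≤ ∑ _i : Fin n, δ / (n + 1) := by
        refine Finset.sum_le_sum fun i _ => h4 _ ((Finset.filter_subset _ _).trans hGE) ?_
        refine hG.subset (hA i) fun x hx => ?_
        obtain ⟨j, hj, rfl⟩ := Finset.mem_image.1 hx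
        exact (Finset.mem_filter.1 hj).2
    _ ≤ δ := by
        rw [Finset.sum_const, Finset.card_univ, Fintype.card_fin, nsmul_eq_mul]
        rw [mul_div_assoc', div_le_iff₀ (by positivity)]
        nlinarith

theorem sum_half_pow_le (n : ℕ) : ∑ i ∈ Finset.range n, (1 / 2 : ℝ) ^ (i + 1) ≤ 1 := by
  have h : ∑ i ∈ Finset.range n, (1 / 2 : ℝ) ^ (i + 1) = 1 - (1 / 2) ^ n := by
    induction n with
    | zero => simp
    | succ n ih => rw [Finset.sum_range_succ, ih]; ring
  rw [h]
  have : (0 : ℝ) ≤ (1 / 2) ^ n := by positivity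
  linarith

theorem IsLevels.boundedConvexSeq {𝓔 : Set (Finset ℕ+)} {𝓗 : ℕ+ → Set (Finset ℕ+)}
    (h : IsLevels 𝓔 𝓗) (hs : ∀ n, SmallConvex 𝓔 (𝓗 n)) : BoundedConvexSeq 𝓔 := by
  classical
  intro t ht k
  have hc : ∀ (n k : ℕ+) (i : ℕ), ∃ p : Finset ℕ+ × (ℕ+ → ℝ), p.1 ∈ 𝓔 ∧ (∀ j ∈ p.1, k < j) ∧
      (∀ j, 0 ≤ p.2 j) ∧ ∑ j ∈ p.1, p.2 j = 1 ∧
      ∀ G ⊆ p.1, G.image t ∈ 𝓗 n → ∑ j ∈ G, p.2 j ≤ (1 / 2) ^ (i + 1) := by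
    intro n k i
    obtain ⟨E, hE, a, h⟩ := hs n t ht ((1 / 2) ^ (i + 1)) (by positivity) k
    exact ⟨(E, a), hE, h⟩
  choose f hf using hc
  -- The next combination is made small on the level t(max Eᵢ). If G meets Eᵢ and its image is in 𝓔,
  -- then that image belongs to a level not exceeding t(max Eᵢ).
  let p : ℕ → Finset ℕ+ × (ℕ+ → ℝ) := fun i => Nat.rec (f 1 k 0)
    (fun i q => f (t (q.1.sup id)) (max k (q.1.sup id)) (i + 1)) i
  have hp : ∀ i, p (i + 1) = f (t ((p i).1.sup id)) (max k ((p i).1.sup id)) (i + 1) := fun _ => rfl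
  have hmem : ∀ i, (p i).1 ∈ 𝓔 := fun i => by
    cases i with
    | zero => exact (hf 1 k 0).1
    | succ i => rw [hp]; exact (hf _ _ _).1
  have hk : ∀ i, ∀ j ∈ (p i).1, k < j := fun i => by
    cases i with
    | zero => exact (hf 1 k 0).2.1
    | succ i => rw [hp]; exact fun j hj => (le_max_left _ _).trans_lt ((hf _ _ _).2.1 j hj)
  have hnn : ∀ i j, 0 ≤ (p i).2 j := fun i => by
    cases i with
    | zero => exact (hf 1 k 0).2.2.1
    | succ i => rw [hp]; exact (hf _ _ _).2.2.1
  have hsum : ∀ i, ∑ j ∈ (p i).1, (p i).2 j = 1 := fun i => by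
    cases i with
    | zero => exact (hf 1 k 0).2.2.2.1
    | succ i => rw [hp]; exact (hf _ _ _).2.2.2.1
  have hne : ∀ i, (p i).1.Nonempty := fun i => by
    rw [Finset.nonempty_iff_ne_empty]
    intro h0
    simpa [h0] using hsum i
  have hnext : ∀ i, ∀ j ∈ (p (i + 1)).1, (p i).1.sup id < j := fun i j hj => by
    rw [hp] at hj
    exact (le_max_right _ _).trans_lt ((hf _ _ _).2.1 j hj)
  have hsup : StrictMono fun i => (p i).1.sup id := strictMono_nat_of_lt_succ fun i => by
    obtain ⟨j, hj⟩ := hne (i + 1)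
    exact (hnext i j hj).trans_le (Finset.le_sup (f := id) hj)
  refine ⟨fun i => (p i).1, fun i => (p i).2, hmem, hk, ?_, hnn, hsum, ?_⟩
  · intro i j hij x hx y hy
    obtain ⟨j, rfl⟩ : ∃ m, j = m + 1 := ⟨j - 1, by omega⟩
    exact (Finset.le_sup (f := id) hx).trans_lt
      ((hsup.monotone (Nat.lt_succ_iff.1 hij)).trans_lt (hnext j y hy))
  · intro n G hG
    obtain ⟨m, hm, hGm⟩ := (h.mem_iff _).1 hG
    by_cases hex : ∃ i, (G ∩ (p i).1).Nonempty
    swap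
    · refine (Finset.sum_nonpos fun i _ => ?_).trans zero_le_two
      rw [Finset.not_nonempty_iff_eq_empty.1 fun hh => hex ⟨i, hh⟩, Finset.sum_empty]
    -- Before i₀ nothing is met, the combination number i₀ contributes at most its whole mass 1, and
    -- the later ones contribute at most a geometric series of sum 1.
    set i₀ := Nat.find hex with hi₀
    have hle : ∀ i, ∑ j ∈ G ∩ (p i).1, (p i).2 j ≤ (if i = i₀ then 1 else 0) + (1 / 2) ^ (i + 1) := by
      intro i
      rcases lt_trichotomy i i₀ with hi | hi | hi
      · rw [Finset.not_nonempty_iff_eq_empty.1 (Nat.find_min hex hi), Finset.sum_empty]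
        positivity
      · rw [if_pos hi]
        refine le_add_of_le_of_nonneg ?_ (by positivity)
        rw [← hsum i]
        exact Finset.sum_le_sum_of_subset_of_nonneg Finset.inter_subset_right fun j _ _ => hnn i j
      · rw [if_neg hi.ne', zero_add]
        obtain ⟨i, rfl⟩ : ∃ m, i = m + 1 := ⟨i - 1, by omega⟩
        obtain ⟨x, hx⟩ := Nat.find_spec hex
        rw [Finset.mem_inter] at hx
        have hmt : m ≤ t ((p i).1.sup id) := by
          refine (hm _ (Finset.mem_image_of_mem t hx.1)).trans (ht.monotone ?_)
          exact (Finset.le_sup (f := id) hx.2).trans (hsup.monotone (Nat.lt_succ_iff.1 hi))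
        have := (hf (t ((p i).1.sup id)) (max k ((p i).1.sup id)) (i + 1)).2.2.2.2
        rw [← hp] at this
        refine this _ Finset.inter_subset_right ?_
        exact h.mono hmt ((h.regular m).subset hGm (Finset.image_subset_image Finset.inter_subset_left))
    refine (Finset.sum_le_sum fun i _ => hle i).trans ?_
    rw [Finset.sum_add_distrib, Finset.sum_ite_eq']
    have := sum_half_pow_le n
    split_ifs <;> linarith

/-- Averaging K > 2/δ terms of the sequence divides the bound 2 by K. Taking the terms beyond K
makes the union of their supports a member of 𝓢₁[𝓔]. -/
theorem BoundedConvexSeq.smallConvex {𝓔 : Set (Finset ℕ+)} (h : BoundedConvexSeq 𝓔) :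
    SmallConvex (compFamily schreierOne 𝓔) 𝓔 := by
  classical
  intro t ht δ hδ k
  obtain ⟨K, hK⟩ := exists_nat_gt (2 / δ)
  have hK0 : (0 : ℝ) < K := (by positivity : (0 : ℝ) < 2 / δ).trans hK
  obtain ⟨K', hK'⟩ : ∃ K' : ℕ+, (K' : ℕ) = K := ⟨⟨K, by exact_mod_cast hK0⟩, rfl⟩
  obtain ⟨E, a, h1, h2, h3, h4, h5, h6⟩ := h t ht (max k K')
  have key : ∀ G : Finset ℕ+, ∑ j ∈ G, (K : ℝ)⁻¹ * (∑ i ∈ Finset.range K,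
      if j ∈ E i then a i j else 0) = (K : ℝ)⁻¹ * ∑ i ∈ Finset.range K, ∑ j ∈ G ∩ E i, a i j := by
    intro G
    rw [← Finset.mul_sum, Finset.sum_comm]
    simp_rw [Finset.sum_ite_mem]
  refine ⟨(Finset.range K).biUnion E, ?_, fun j => (K : ℝ)⁻¹ * ∑ i ∈ Finset.range K,
    if j ∈ E i then a i j else 0, ?_, ?_, ?_, ?_⟩
  · refine mem_compFamily_of_finset _ _ (fun i _ j _ => h3 i j) (fun i _ => h1 i) fun j hj => ?_
    obtain ⟨i, -, hi⟩ := Finset.mem_biUnion.1 hj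
    have : K' ≤ j := ((le_max_right _ _).trans_lt (h2 i j hi)).le
    rw [Finset.card_range, ← hK']
    exact_mod_cast this
  · intro j hj
    obtain ⟨i, -, hi⟩ := Finset.mem_biUnion.1 hj
    exact (le_max_left _ _).trans_lt (h2 i j hi)
  · intro j
    refine mul_nonneg (by positivity) (Finset.sum_nonneg fun i _ => ?_)
    split_ifs
    · exact h4 i j
    · exact le_rfl
  · rw [key]
    have : ∀ i ∈ Finset.range K, ∑ j ∈ (Finset.range K).biUnion E ∩ E i, a i j = 1 := by
      intro i hi
      rw [Finset.inter_eq_right.2 (Finset.subset_biUnion_of_mem E hi), h5]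
    rw [Finset.sum_congr rfl this]
    simp [hK0.ne']
  · intro G _ hG
    rw [key, inv_mul_le_iff₀ hK0]
    refine (h6 K G hG).trans ?_
    rw [div_lt_iff₀ hδ] at hK
    exact hK.le

variable {Φ : FundamentalSystem}

/-- Unit masses at distinct points form a bounded sequence: t is injective, so a set whose image has
at most one point has mass at most 1. -/
theorem smallConvex_schreier_one : SmallConvex (compFamily schreierOne schreierZero) schreierZero := by
  refine BoundedConvexSeq.smallConvex (fun t ht k => ?_)
  have hsm : ∀ i : ℕ, ((k + ⟨i + 1, i.succ_pos⟩ : ℕ+) : ℕ) = k + (i + 1) := fun i => rfl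
  refine ⟨fun i => {k + ⟨i + 1, i.succ_pos⟩}, fun _ _ => 1, by simp [schreierZero], ?_, ?_, by simp,
    by simp, ?_⟩
  · intro i j hj
    rw [Finset.mem_singleton] at hj
    rw [hj]
    exact PNat.lt_add_right _ _
  · intro i j hij x hx y hy
    rw [Finset.mem_singleton] at hx hy
    rw [hx, hy, ← PNat.coe_lt_coe, hsm, hsm]
    omega
  · intro n G hG
    have hG1 : G.card ≤ 1 := by
      rw [← Finset.card_image_of_injective G ht.injective]; exact hG
    rw [← Finset.sum_biUnion, Finset.sum_const, nsmul_one]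
    · refine le_trans ?_ one_le_two
      exact_mod_cast (Finset.card_le_card (by
        intro x hx
        obtain ⟨i, -, hi⟩ := Finset.mem_biUnion.1 hx
        exact (Finset.mem_inter.1 hi).1)).trans hG1
    · intro i _ j _ hij
      simp only [Function.onFun]
      rw [Finset.disjoint_left]
      intro x hx hy
      rw [Finset.mem_inter, Finset.mem_singleton] at hx hy
      have := congrArg (fun z : ℕ+ => (z : ℕ)) (hx.2.symm.trans hy.2)
      simp only [hsm] at this
      omega

theorem isLevels_compFamily {𝓖 : Set (Finset ℕ+)} (h : Regular 𝓖) (h0 : ∅ ∈ 𝓖) :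
    IsLevels (compFamily schreierOne 𝓖) fun n => unions 𝓖 n where
  regular n := h.unions n
  mono _ _ hmn := unions_mono h0 hmn
  mem_iff _ := mem_compFamily_iff h0

theorem isLevels_limit (hΦ : Φ.Nested) {o : Ordinal.{0}} (hl : Order.IsSuccLimit o) (ho : o < ω₁) :
    IsLevels (schreier Φ o) fun n => schreier Φ (Φ.seq o n) where
  regular n := regular_schreier ((Φ.seq_lt o hl ho n).trans ho)
  mono _ _ hmn := hΦ.mono hl ho hmn
  mem_iff A := by rw [schreier_limit Φ o hl ho]; rfl

/-- The successor of oₙ is still below o, so its family lies in 𝓢_o beyond some point, and the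
combinations can be chosen beyond that point. -/
theorem smallConvex_limit {o : Ordinal.{0}} (hl : Order.IsSuccLimit o) (ho : o < ω₁)
    (ih : ∀ a < o, SmallConvex (schreier Φ (a + 1)) (schreier Φ a)) (n : ℕ+) :
    SmallConvex (schreier Φ o) (schreier Φ (Φ.seq o n)) := by
  have h1 := Φ.seq_lt o hl ho n
  obtain ⟨N, hN⟩ := schreier_tail_subset (Φ := Φ) o ho (Φ.seq o n + 1) (Order.add_one_le_iff.2 h1)
  exact (ih _ h1).of_tail hN

/-- The induction alternates between two notions: smallness against every level of a family gives a
bounded sequence in that family, and averaging it gives smallness one step higher. At a successor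
the levels are unions of n members, at a limit they are the approximating families. -/
theorem smallConvex_schreier (hΦ : Φ.Nested) (o : Ordinal.{0}) (ho : o < ω₁) :
    SmallConvex (schreier Φ (o + 1)) (schreier Φ o) := by
  induction o, ho using countable_induction with
  | zero ho =>
    rw [schreier_add_one, schreier_zero]
    exact smallConvex_schreier_one
  | succ o ho ih =>
    have ho' : o < ω₁ := (Order.lt_add_one_iff.2 le_rfl).trans ho
    rw [schreier_add_one Φ (o + 1)]
    refine BoundedConvexSeq.smallConvex ?_
    rw [schreier_add_one] at ih ⊢
    exact (isLevels_compFamily (regular_schreier ho') (empty_mem_schreier ho')).boundedConvexSeq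
      fun n => ih.unions (regular_schreier ho') n
  | limit o hl ho ih =>
    rw [schreier_add_one]
    exact ((isLevels_limit hΦ hl ho).boundedConvexSeq
      (smallConvex_limit hl ho ih)).smallConvex

/-! ### Absorption -/

/-- Diagonalization over a sequence of properties that pass to further subsequences. -/
theorem exists_diagonal (P : ℕ+ → (ℕ+ → ℕ+) → Prop)
    (hex : ∀ (n : ℕ+) (M : ℕ+ → ℕ+), StrictMono M → ∃ N : ℕ+ → ℕ+, StrictMono N ∧ P n (M ∘ N))
    (hinh : ∀ (n : ℕ+) (M N : ℕ+ → ℕ+), StrictMono N → P n M → P n (M ∘ N)) :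
    ∃ D : ℕ+ → ℕ+, StrictMono D ∧
      ∀ n, ∃ M, StrictMono M ∧ P n M ∧ ∀ i, n ≤ i → D i = M i := by
  choose! f hf using hex
  let c : ℕ → ℕ+ → ℕ+ := fun k => Nat.rec id (fun k M => M ∘ f k.succPNat M) k
  have hc : ∀ k, c (k + 1) = c k ∘ f k.succPNat (c k) := fun _ => rfl
  have hmono : ∀ k, StrictMono (c k) := by
    intro k
    induction k with
    | zero => exact strictMono_id
    | succ k ih => rw [hc]; exact ih.comp (hf _ _ ih).1
  have htail : ∀ m n, m ≤ n → ∃ h, StrictMono h ∧ c n = c m ∘ h := by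
    intro m n hmn
    induction n, hmn using Nat.le_induction with
    | base => exact ⟨id, strictMono_id, rfl⟩
    | succ n hmn ih =>
      obtain ⟨h, h1, h2⟩ := ih
      refine ⟨h ∘ f n.succPNat (c n), h1.comp (hf _ _ (hmono n)).1, ?_⟩
      rw [hc, ← Function.comp_assoc, ← h2]
  have hP : ∀ n : ℕ+, P n (c n) := by
    intro n
    obtain ⟨k, rfl⟩ : ∃ k : ℕ, n = k.succPNat := ⟨n.natPred, (PNat.succPNat_natPred n).symm⟩
    exact (hf _ _ (hmono k)).2
  -- From n on, the diagonal runs through values of `c n`, because each later sequence is a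
  -- subsequence of `c n`.
  have hD : StrictMono fun i : ℕ+ => c i i := by
    intro i j hij
    obtain ⟨h, h1, h2⟩ := htail i j (by exact_mod_cast hij.le)
    simp only [h2]
    exact hmono i (hij.trans_le h1.le_apply)
  refine ⟨_, hD, fun n => ?_⟩
  have htail' : ∀ i : ℕ+, ∃ h : ℕ+, i ≤ h ∧ (n ≤ i → c i i = c n h) := by
    intro i
    by_cases hi : n ≤ i
    · obtain ⟨h, h1, h2⟩ := htail n i (by exact_mod_cast hi)
      exact ⟨h i, h1.le_apply, fun _ => by rw [h2]; rfl⟩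
    · exact ⟨i, le_rfl, fun h => absurd h hi⟩
  choose h hle heq using htail'
  -- Below n the diagonal need not follow `c n`, and the identity is used there instead; the result
  -- is still increasing because `h j` is at least j.
  have hg : StrictMono fun i => if n ≤ i then h i else i := by
    intro i j hij
    by_cases hi : n ≤ i
    · have hj := hi.trans hij.le
      simp only [hi, hj, if_true]
      rw [← (hmono n).lt_iff_lt, ← heq i hi, ← heq j hj]
      exact hD hij
    · simp only [hi, if_false]
      split_ifs
      · exact hij.trans_le (hle j)
      · exact hij
  refine ⟨c n ∘ fun i => if n ≤ i then h i else i, (hmono n).comp hg, hinh _ _ _ hg (hP n), ?_⟩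
  intro i hi
  simp only [Function.comp_apply, hi, if_true]
  exact heq i hi

theorem le_of_mem_successive {G : ℕ+ → Finset ℕ+} (hG : Successive G)
    (hne : ∀ i, (G i).Nonempty) (i : ℕ+) : ∀ k ∈ G i, i ≤ k := by
  have hm : StrictMono fun i => (G i).min' (hne i) := fun i j hij =>
    hG i j hij _ (Finset.min'_mem _ _) _ (Finset.min'_mem _ _)
  exact fun k hk => hm.le_apply.trans (Finset.min'_le _ _ hk)

theorem Successive.comp {G : ℕ+ → Finset ℕ+} (hG : Successive G) {N : ℕ+ → ℕ+}
    (hN : StrictMono N) : Successive (G ∘ N) := fun _ _ hij => hG _ _ (hN hij)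

/-- Along some subsequence of every block sequence in `𝓖`, the unions indexed by members of `𝓕`
belong to `𝓔`. -/
def Absorbs (𝓕 𝓖 𝓔 : Set (Finset ℕ+)) : Prop :=
  ∀ G : ℕ+ → Finset ℕ+, Successive G → (∀ i, (G i).Nonempty) → (∀ i, G i ∈ 𝓖) →
    ∃ N : ℕ+ → ℕ+, StrictMono N ∧ ∀ E ∈ 𝓕, (E.biUnion fun i => G (N i)) ∈ 𝓔

variable {Φ : FundamentalSystem}

/-- Passing to the indices n * i pays for the factor n: the union over E has at most n|E| ≤ n · min
E elements and starts at n · min E or later. -/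
theorem absorbs_card_le (n : ℕ+) : Absorbs schreierOne {E | E.card ≤ n} schreierOne := by
  intro G hG hne hcard
  refine ⟨fun i => n * i, fun i j hij => mul_lt_mul_right hij n, fun E hE k hk => ?_⟩
  obtain ⟨i, hi, hk⟩ := Finset.mem_biUnion.1 hk
  calc (E.biUnion fun i => G (n * i)).card ≤ ∑ i ∈ E, (G (n * i)).card := Finset.card_biUnion_le
    _ ≤ ∑ _i ∈ E, (n : ℕ) := Finset.sum_le_sum fun i _ => hcard _
    _ = n * E.card := by rw [Finset.sum_const, smul_eq_mul, mul_comm]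
    _ ≤ n * i := Nat.mul_le_mul_left _ (hE i hi)
    _ ≤ k := by exact_mod_cast le_of_mem_successive hG hne _ k hk

/-- This is the inclusion of 𝓢_η[𝓢_ζ] in 𝓢_{ζ+η} along a subsequence. Successor steps keep the
subsequence; limit steps diagonalize over the approximating families of η. -/
theorem absorbs_schreier (ζ η : Ordinal.{0}) (hη : η < ω₁) (h : ζ + η < ω₁) :
    Absorbs (schreier Φ η) (schreier Φ ζ) (schreier Φ (ζ + η)) := by
  classical
  induction η, hη using countable_induction with
  | zero =>
    intro G _ _ hmem
    refine ⟨id, strictMono_id, fun E hE => ?_⟩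
    rw [schreier_zero] at hE
    rw [add_zero] at h ⊢
    rcases Finset.card_le_one_iff_subset_singleton.1 hE with ⟨i, hi⟩
    refine (regular_schreier h).subset (hmem i) fun k hk => ?_
    obtain ⟨j, hj, hk⟩ := Finset.mem_biUnion.1 hk
    rwa [← Finset.mem_singleton.1 (hi hj)]
  | succ η hη ih =>
    intro G hG hne hmem
    rw [← add_assoc] at h ⊢
    have h' : ζ + η < ω₁ := (Order.lt_add_one_iff.2 le_rfl).trans h
    obtain ⟨N, hN, hE⟩ := ih h' G hG hne hmem
    refine ⟨N, hN, fun E hE' => ?_⟩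
    rw [schreier_add_one] at hE' ⊢
    obtain ⟨n, F, hB, hF, hn, rfl⟩ := exists_of_mem_compFamily hE'
    have hU : ((Finset.univ.biUnion F).biUnion fun i => G (N i)) =
        Finset.univ.biUnion fun j => (F j).biUnion fun i => G (N i) := by
      rw [Finset.biUnion_biUnion]
    rw [hU]
    refine mem_compFamily_of_finset _ _ (fun i _ j _ hij x hx y hy => ?_) (fun i _ => hE _ (hF i))
      fun k hk => ?_
    · obtain ⟨a, ha, hx⟩ := Finset.mem_biUnion.1 hx
      obtain ⟨b, hb, hy⟩ := Finset.mem_biUnion.1 hy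
      exact hG _ _ (hN (hB i j hij a ha b hb)) x hx y hy
    · rw [← hU] at hk
      obtain ⟨i, hi, hk⟩ := Finset.mem_biUnion.1 hk
      rw [Finset.card_univ, Fintype.card_fin]
      refine (hn i hi).trans ?_
      exact_mod_cast hN.le_apply.trans (le_of_mem_successive hG hne _ k hk)
  | limit η hl hη ih =>
    intro G hG hne hmem
    have hlt : ∀ n, ζ + Φ.seq η n < ζ + η := fun n => by
      simpa using Φ.seq_lt η hl hη n
    -- 𝓢_{ζ+ηₙ} lies in 𝓢_{ζ+η} only beyond some point T n, so the sequences below are shifted by T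
    -- n.
    choose T hT using fun n => schreier_tail_subset (Φ := Φ) (ζ + η) h (ζ + Φ.seq η n) (hlt n).le
    obtain ⟨D, hD, hDP⟩ := exists_diagonal
      (fun n M => ∀ E ∈ schreier Φ (Φ.seq η n), (E.biUnion fun i => G (M i)) ∈ schreier Φ (ζ + η))
      (fun n M hM => by
        have hM' : StrictMono fun i => M (i + T n) := fun i j hij =>
          hM (add_lt_add_left hij (T n))
        obtain ⟨N, hN, hNE⟩ := ih (Φ.seq η n) (Φ.seq_lt η hl hη n) ((hlt n).trans h)
          (fun i => G (M (i + T n))) (hG.comp hM') (fun i => hne _) (fun i => hmem _)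
        refine ⟨fun i => N i + T n, fun i j hij => add_lt_add_left (hN hij) (T n),
          fun E hE => hT n _ (hNE E hE) fun k hk => ?_⟩
        obtain ⟨i, -, hk⟩ := Finset.mem_biUnion.1 hk
        refine le_trans ?_ (le_of_mem_successive hG hne _ k hk)
        exact (PNat.lt_add_left (T n) (N i)).le.trans hM.le_apply)
      (fun n M N hN hP E hE => by
        have := hP _ ((regular_schreier ((Φ.seq_lt η hl hη n).trans hη)).image_strictMono hE hN)
        rwa [Finset.image_biUnion] at this)
    refine ⟨D, hD, fun E hE => ?_⟩
    rw [schreier_limit Φ η hl hη] at hE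
    obtain ⟨n, hn, hE⟩ := hE
    obtain ⟨M, -, hP, hDM⟩ := hDP n
    have := hP E hE
    convert this using 1
    exact Finset.biUnion_congr rfl fun i hi => by rw [hDM i (hn i hi)]

/-! ### The levels of `𝓢_{ω^ξ}` -/

/-- What is used of the pair consisting of a family and its levels. -/
structure GoodLevels (𝓕 : Set (Finset ℕ+)) (𝓖 : ℕ+ → Set (Finset ℕ+)) : Prop
    extends IsLevels 𝓕 𝓖 where
  singleton_mem : ∀ k n, {k} ∈ 𝓖 n
  absorbs : ∀ n, Absorbs 𝓕 (𝓖 n) 𝓕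
  smallConvex : ∀ n, SmallConvex 𝓕 (𝓖 n)

theorem card_le_of_mem_unions {n : ℕ} {A : Finset ℕ+} (hA : A ∈ unions schreierZero n) :
    A.card ≤ n := by
  classical
  obtain ⟨E, -, hE, rfl⟩ := hA
  refine Finset.card_biUnion_le.trans ((Finset.sum_le_sum fun i _ => hE i).trans ?_)
  simp

theorem compFamily_schreierZero : compFamily schreierOne schreierZero = schreierOne := by
  classical
  ext A
  rw [mem_compFamily_iff (by simp [schreierZero])]
  constructor
  · rintro ⟨n, hn, hA⟩ k hk
    exact (card_le_of_mem_unions hA).trans (by exact_mod_cast hn k hk)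
  · intro hA
    rw [← mem_compFamily_iff (by simp [schreierZero])]
    have := mem_compFamily_of_finset (𝓖 := schreierZero) A (fun i => {i})
      (fun i _ j _ hij x hx y hy => by
        rw [Finset.mem_singleton] at hx hy
        rwa [hx, hy])
      (fun i _ => by simp [schreierZero]) (fun k hk => hA k (by simpa using hk))
    simpa using this

theorem omega0_opow_lt {ξ : Ordinal.{0}} (hξ : ξ < ω₁) : ω ^ ξ < (ω₁ : Ordinal.{0}) :=
  Ordinal.isPrincipal_opow_omega 1 Ordinal.omega0_lt_omega_one hξ

/-- For ξ ≠ 0 the ordinal ω^ξ is an additively indecomposable limit, and ζ + ω^ξ = ω^ξ turns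
`absorbs_schreier` into absorption by the family itself. For ξ = 0 the family is 𝓢₁ and its levels
are given by cardinality. -/
theorem exists_goodLevels (hΦ : Φ.Nested) {ξ : Ordinal.{0}} (hξ : ξ < ω₁) :
    ∃ 𝓖, GoodLevels (schreier Φ (ω ^ ξ)) 𝓖 := by
  have ho := omega0_opow_lt hξ
  rcases eq_or_ne ξ 0 with rfl | hne
  · refine ⟨fun n => unions schreierZero n, ?_⟩
    have h1 : schreier Φ (ω ^ (0 : Ordinal.{0})) = compFamily schreierOne schreierZero := by
      rw [Ordinal.opow_zero, ← zero_add (1 : Ordinal), schreier_add_one, schreier_zero]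
    rw [h1]
    refine ⟨isLevels_compFamily regular_schreierZero (by simp [schreierZero]), fun k n => ?_,
      fun n => ?_, fun n => smallConvex_schreier_one.unions regular_schreierZero n⟩
    · exact unions_mono (by simp [schreierZero]) n.2 (mem_unions_one (by simp [schreierZero]))
    · rw [compFamily_schreierZero]
      intro G hG hne hmem
      exact absorbs_card_le n G hG hne fun i => card_le_of_mem_unions (hmem i)
  · have hl : Order.IsSuccLimit (ω ^ ξ) := Ordinal.isSuccLimit_opow_left Ordinal.isSuccLimit_omega0 hne
    refine ⟨fun n => schreier Φ (Φ.seq (ω ^ ξ) n), isLevels_limit hΦ hl ho, fun k n => ?_,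
      fun n => ?_, smallConvex_limit hl ho fun a ha => smallConvex_schreier hΦ a (ha.trans ho)⟩
    · exact singleton_mem_schreier _ ((Φ.seq_lt _ hl ho n).trans ho) k
    · have h1 := Ordinal.add_omega0_opow (Φ.seq_lt _ hl ho n)
      have h2 := absorbs_schreier (Φ := Φ) (Φ.seq (ω ^ ξ) n) (ω ^ ξ) ho (h1.symm ▸ ho)
      rwa [h1] at h2

theorem IsLevels.regular_family {𝓕 : Set (Finset ℕ+)} {𝓖 : ℕ+ → Set (Finset ℕ+)}
    (h : IsLevels 𝓕 𝓖) : Regular 𝓕 := regular_of_levels h.regular h.mem_iff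

/-! ### Restrictions and pairings -/

/-- The restriction of a vector to a finite set of coordinates. -/
def restrict (S : Finset ℕ+) (f : ℕ+ →₀ ℝ) : ℕ+ →₀ ℝ := f.filter (· ∈ S)

theorem restrict_apply (S : Finset ℕ+) (f : ℕ+ →₀ ℝ) (k : ℕ+) :
    restrict S f k = if k ∈ S then f k else 0 := Finsupp.filter_apply _ _ _

theorem support_restrict (S : Finset ℕ+) (f : ℕ+ →₀ ℝ) :
    (restrict S f).support = f.support.filter (· ∈ S) := Finsupp.support_filter _ _

theorem support_restrict_subset (S : Finset ℕ+) (f : ℕ+ →₀ ℝ) :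
    (restrict S f).support ⊆ f.support := by
  rw [support_restrict]; exact Finset.filter_subset _ _

theorem support_restrict_subset_left (S : Finset ℕ+) (f : ℕ+ →₀ ℝ) :
    (restrict S f).support ⊆ S := fun k hk => by
  rw [support_restrict] at hk; exact (Finset.mem_filter.1 hk).2

theorem restrict_zero (S : Finset ℕ+) : restrict S 0 = 0 := Finsupp.filter_zero _

theorem restrict_smul (S : Finset ℕ+) (c : ℝ) (f : ℕ+ →₀ ℝ) :
    restrict S (c • f) = c • restrict S f := Finsupp.filter_smul

theorem restrict_sum {ι : Type*} (S : Finset ℕ+) (R : Finset ι) (f : ι → ℕ+ →₀ ℝ) :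
    restrict S (∑ i ∈ R, f i) = ∑ i ∈ R, restrict S (f i) := Finsupp.filter_sum _ _

theorem restrict_eq_self {S : Finset ℕ+} {f : ℕ+ →₀ ℝ} (h : f.support ⊆ S) : restrict S f = f :=
  (Finsupp.filter_eq_self_iff _ _).2 fun k hk => h (by simpa using hk)

theorem restrict_eq_zero {S : Finset ℕ+} {f : ℕ+ →₀ ℝ} (h : Disjoint f.support S) :
    restrict S f = 0 := by
  rw [← Finsupp.support_eq_empty, support_restrict, Finset.filter_eq_empty_iff]
  exact fun k hk hS => Finset.disjoint_left.1 h hk hS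

theorem Before.mono {A B A' B' : Finset ℕ+} (h : Before A B) (hA : A' ⊆ A) (hB : B' ⊆ B) :
    Before A' B' := fun a ha b hb => h a (hA ha) b (hB hb)

theorem pairing_add_left (f g x : ℕ+ →₀ ℝ) : pairing (f + g) x = pairing f x + pairing g x := by
  simp [pairing_eq, add_mul, Finset.sum_add_distrib]

theorem pairing_smul_left (c : ℝ) (f x : ℕ+ →₀ ℝ) : pairing (c • f) x = c * pairing f x := by
  simp [pairing_eq, Finset.mul_sum, mul_assoc]

theorem pairing_zero_left (x : ℕ+ →₀ ℝ) : pairing 0 x = 0 := by simp [pairing_eq]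

theorem pairing_zero_right (f : ℕ+ →₀ ℝ) : pairing f 0 = 0 := by simp [pairing_eq]

theorem pairing_sum_left {ι : Type*} (R : Finset ι) (f : ι → ℕ+ →₀ ℝ) (x : ℕ+ →₀ ℝ) :
    pairing (∑ i ∈ R, f i) x = ∑ i ∈ R, pairing (f i) x := by
  classical
  induction R using Finset.induction_on with
  | empty => simp [pairing_zero_left]
  | insert i R hi ih => rw [Finset.sum_insert hi, Finset.sum_insert hi, pairing_add_left, ih]

theorem pairing_sum_right {ι : Type*} (R : Finset ι) (f : ℕ+ →₀ ℝ) (x : ι → ℕ+ →₀ ℝ) :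
    pairing f (∑ i ∈ R, x i) = ∑ i ∈ R, pairing f (x i) := by
  classical
  induction R using Finset.induction_on with
  | empty => simp [pairing_zero_right]
  | insert i R hi ih => rw [Finset.sum_insert hi, Finset.sum_insert hi, pairing_add, ih]

theorem pairing_eq_sum {f x : ℕ+ →₀ ℝ} {T : Finset ℕ+} (h : x.support ⊆ T) :
    pairing f x = ∑ i ∈ T, f i * x i := by
  rw [pairing_eq]
  refine Finset.sum_subset h fun i _ hi => ?_
  rw [Finsupp.notMem_support_iff.1 hi, mul_zero]

theorem pairing_restrict (S : Finset ℕ+) (f x : ℕ+ →₀ ℝ) :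
    pairing (restrict S f) x = pairing f (restrict S x) := by
  rw [pairing_eq, pairing_eq_sum (support_restrict_subset S x)]
  refine Finset.sum_congr rfl fun i _ => ?_
  rw [restrict_apply, restrict_apply]
  split_ifs <;> simp

theorem pairing_restrict_support {S : Finset ℕ+} {x : ℕ+ →₀ ℝ} (h : x.support ⊆ S)
    (f : ℕ+ →₀ ℝ) : pairing (restrict S f) x = pairing f x := by
  rw [pairing_restrict, restrict_eq_self h]

theorem pairing_eq_zero {f x : ℕ+ →₀ ℝ} (h : Disjoint f.support x.support) : pairing f x = 0 := by
  rw [← pairing_restrict_support subset_rfl, restrict_eq_zero h, pairing_zero_left]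

/-! ### Averages and fast growing sequences of averages -/

/-- `f = (g₁ + ⋯ + g_d) / s` with `d ≤ s` and `g₁ < ⋯ < g_d` in `G`. -/
def AverageOf (G : Set (ℕ+ →₀ ℝ)) (s : ℕ) (f : ℕ+ →₀ ℝ) : Prop :=
  2 ≤ s ∧ ∃ (d : ℕ) (g : Fin d → ℕ+ →₀ ℝ), d ≤ s ∧ (∀ i, g i ∈ G) ∧
    (∀ i j, i < j → Before (g i).support (g j).support) ∧ f = (s : ℝ)⁻¹ • ∑ i, g i

/-- A very fast growing sequence of averages that is admissible for the family `𝓖`. -/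
structure IsFastSeq (G : Set (ℕ+ →₀ ℝ)) (𝓖 : Set (Finset ℕ+)) {ι : Type} [LinearOrder ι]
    (Q : Finset ι) (α : ι → ℕ+ →₀ ℝ) (s : ι → ℕ) : Prop where
  average : ∀ q ∈ Q, AverageOf G (s q) (α q)
  before : ∀ p ∈ Q, ∀ q ∈ Q, p < q → Before (α p).support (α q).support
  mins : ∃ φ : ι → ℕ+, StrictMonoOn φ Q ∧ Q.image φ ∈ 𝓖 ∧ ∀ q ∈ Q, ∀ k ∈ (α q).support, φ q ≤ k
  strictMono : StrictMonoOn s Q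
  fast : ∀ p ∈ Q, ∀ q ∈ Q, p < q → ∀ k ∈ (α p).support, (k : ℕ) < s q

theorem AverageOf.mono {G G' : Set (ℕ+ →₀ ℝ)} (h : G ⊆ G') {s : ℕ} {f : ℕ+ →₀ ℝ}
    (hf : AverageOf G s f) : AverageOf G' s f := by
  obtain ⟨hs, d, g, hd, hg, hB, rfl⟩ := hf
  exact ⟨hs, d, g, hd, fun i => h (hg i), hB, rfl⟩

theorem AverageOf.of_finset {ι : Type} [LinearOrder ι] {G : Set (ℕ+ →₀ ℝ)} {s : ℕ} (hs : 2 ≤ s)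
    (R : Finset ι) (g : ι → ℕ+ →₀ ℝ) (hc : R.card ≤ s) (hg : ∀ i ∈ R, g i ∈ G)
    (hB : ∀ i ∈ R, ∀ j ∈ R, i < j → Before (g i).support (g j).support) :
    AverageOf G s ((s : ℝ)⁻¹ • ∑ i ∈ R, g i) := by
  have he := R.orderEmbOfFin_mem rfl
  refine ⟨hs, R.card, fun i => g (R.orderEmbOfFin rfl i), hc, fun i => hg _ (he i),
    fun i j hij => hB _ (he i) _ (he j) ((R.orderEmbOfFin rfl).strictMono hij), ?_⟩
  conv_lhs => rw [← Finset.map_orderEmbOfFin_univ R rfl, Finset.sum_map]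
  rfl

theorem AverageOf.restrict {G G' : Set (ℕ+ →₀ ℝ)} {S : Finset ℕ+}
    (h : ∀ g ∈ G, restrict S g ∈ G') {s : ℕ} {f : ℕ+ →₀ ℝ} (hf : AverageOf G s f) :
    AverageOf G' s (restrict S f) := by
  obtain ⟨hs, d, g, hd, hg, hB, rfl⟩ := hf
  refine ⟨hs, d, fun i => X01.restrict S (g i), hd, fun i => h _ (hg i), fun i j hij => ?_, ?_⟩
  · exact (hB i j hij).mono (support_restrict_subset _ _) (support_restrict_subset _ _)
  · rw [restrict_smul, restrict_sum]

namespace IsFastSeq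

variable {G : Set (ℕ+ →₀ ℝ)} {𝓖 : Set (Finset ℕ+)} {ι : Type} [LinearOrder ι] {Q : Finset ι}
  {α : ι → ℕ+ →₀ ℝ} {s : ι → ℕ}

theorem subset (h : IsFastSeq G 𝓖 Q α s) (h𝓖 : Regular 𝓖) {Q' : Finset ι} (hQ : Q' ⊆ Q) :
    IsFastSeq G 𝓖 Q' α s where
  average q hq := h.average q (hQ hq)
  before p hp q hq := h.before p (hQ hp) q (hQ hq)
  mins := by
    obtain ⟨φ, h1, h2, h3⟩ := h.mins
    exact ⟨φ, h1.mono hQ, h𝓖.subset h2 (Finset.image_subset_image hQ), fun q hq => h3 q (hQ hq)⟩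
  strictMono := h.strictMono.mono hQ
  fast p hp q hq := h.fast p (hQ hp) q (hQ hq)

theorem transform (h : IsFastSeq G 𝓖 Q α s) {G' : Set (ℕ+ →₀ ℝ)} {β : ι → ℕ+ →₀ ℝ}
    (hβ : ∀ q ∈ Q, AverageOf G' (s q) (β q)) (hs : ∀ q ∈ Q, (β q).support ⊆ (α q).support) :
    IsFastSeq G' 𝓖 Q β s where
  average := hβ
  before p hp q hq hpq := (h.before p hp q hq hpq).mono (hs p hp) (hs q hq)
  mins := by
    obtain ⟨φ, h1, h2, h3⟩ := h.mins
    exact ⟨φ, h1, h2, fun q hq k hk => h3 q hq k (hs q hq hk)⟩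
  strictMono := h.strictMono
  fast p hp q hq hpq k hk := h.fast p hp q hq hpq k (hs p hp hk)

/-- The field `mins` asks only for lower bounds of the supports, so it survives restriction and
tolerates zero functionals. The true minima of non-zero functionals lie further to the right and are
admissible by regularity. -/
theorem exists_isLeast (h : IsFastSeq G 𝓖 Q α s) (h𝓖 : Regular 𝓖) (hne : ∀ q ∈ Q, α q ≠ 0) :
    ∃ μ : ι → ℕ+, (∀ q ∈ Q, IsLeast ((α q).support : Set ℕ+) (μ q)) ∧ StrictMonoOn μ Q ∧
      Q.image μ ∈ 𝓖 := by
  let μ : ι → ℕ+ := fun q => if hq : (α q).support.Nonempty then (α q).support.min' hq else 1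
  have hμ : ∀ q ∈ Q, IsLeast ((α q).support : Set ℕ+) (μ q) := fun q hq => by
    simp only [μ, dif_pos (Finsupp.support_nonempty_iff.2 (hne q hq))]
    exact Finset.isLeast_min' _ _
  have hmono : StrictMonoOn μ Q := fun p hp q hq hpq =>
    h.before p hp q hq hpq _ (hμ p hp).1 _ (hμ q hq).1
  obtain ⟨φ, h1, h2, h3⟩ := h.mins
  exact ⟨μ, hμ, hmono, h𝓖.subset_image h2 (fun b hb => Finset.mem_image_of_mem _ hb) h1 hmono
    fun q hq => h3 q hq _ (hμ q hq).1⟩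

end IsFastSeq

/-! ### The norming set with zero -/

/-- The norming set together with the zero functional. -/
def normingSetZero (𝓕 : Set (Finset ℕ+)) : Set (ℕ+ →₀ ℝ) := insert 0 (normingSet 𝓕)

variable {𝓕 : Set (Finset ℕ+)}

theorem zero_mem_normingSetZero : 0 ∈ normingSetZero 𝓕 := Set.mem_insert _ _

theorem normingSet_subset : normingSet 𝓕 ⊆ normingSetZero 𝓕 := Set.subset_insert _ _

theorem neg_mem_normingSetZero {f : ℕ+ →₀ ℝ} (hf : f ∈ normingSetZero 𝓕) :
    -f ∈ normingSetZero 𝓕 := by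
  rcases hf with rfl | hf
  · rw [neg_zero]; exact zero_mem_normingSetZero
  · exact normingSet_subset (neg_mem_normingSet 𝓕 f hf)

theorem normingStep_mono : Monotone (normingStep 𝓕) :=
  monotone_nat_of_le_succ fun _ _ hf => Or.inr hf

theorem exists_normingStep {d : ℕ} {g : Fin d → ℕ+ →₀ ℝ} (hg : ∀ i, g i ∈ normingSet 𝓕) :
    ∃ m, ∀ i, g i ∈ normingStep 𝓕 m := by
  choose m hm using fun i => Set.mem_iUnion.1 (hg i)
  exact ⟨Finset.univ.sup m, fun i => normingStep_mono (Finset.le_sup (Finset.mem_univ i)) (hm i)⟩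

/-- `AverageOf` tolerates zero summands. Dropping them keeps the size, since only d ≤ s is required,
and one more step of the construction contains the average itself. -/
theorem AverageOf.exists_isAverage {s : ℕ} {f : ℕ+ →₀ ℝ} (h : AverageOf (normingSetZero 𝓕) s f)
    (hf : f ≠ 0) : ∃ m, IsAverage (normingStep 𝓕 m) s f := by
  classical
  obtain ⟨hs, d, g, hd, hg, hB, rfl⟩ := h
  set R := Finset.univ.filter fun i => g i ≠ 0 with hR
  have hsum : ∑ i, g i = ∑ i ∈ R, g i := by
    rw [hR, Finset.sum_filter_ne_zero]
  have hRne : R.Nonempty := by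
    rw [Finset.nonempty_iff_ne_empty]
    intro h0
    rw [hsum, h0] at hf
    simp at hf
  have he := R.orderEmbOfFin_mem rfl
  have hgn : ∀ i ∈ R, g i ∈ normingSet 𝓕 := fun i hi =>
    (hg i).resolve_left (Finset.mem_filter.1 hi).2
  obtain ⟨m, hm⟩ := exists_normingStep fun i => hgn _ (he i)
  have hcard : R.card ≤ d := by simpa using Finset.card_filter_le (Finset.univ : Finset (Fin d)) fun i => g i ≠ 0
  have hav : ∀ m' ≥ m, (s : ℝ)⁻¹ • ∑ i, g i ∈ averages (normingStep 𝓕 m') s := by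
    intro m' hm'
    refine ⟨R.card, fun i => g (R.orderEmbOfFin rfl i), hRne.card_pos, hcard.trans hd,
      fun i => normingStep_mono hm' (hm i),
      fun i j hij => hB _ _ ((R.orderEmbOfFin rfl).strictMono hij), ?_⟩
    rw [hsum]
    conv_lhs => rw [← Finset.map_orderEmbOfFin_univ R rfl, Finset.sum_map]
    rfl
  exact ⟨m + 1, Or.inl (Or.inl ⟨s, hs, hav m le_rfl⟩), hs, hav (m + 1) (Nat.le_succ m)⟩

theorem IsAverage.mono {G G' : Set (ℕ+ →₀ ℝ)} (h : G ⊆ G') {s : ℕ} {f : ℕ+ →₀ ℝ}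
    (hf : IsAverage G s f) : IsAverage G' s f := by
  obtain ⟨h0, hs, d, g, hd, hd', hg, hB, rfl⟩ := hf
  exact ⟨h h0, hs, d, g, hd, hd', fun i => h (hg i), hB, rfl⟩

theorem averages_subset {G : Set (ℕ+ →₀ ℝ)} {s : ℕ} {f : ℕ+ →₀ ℝ} (hs : 2 ≤ s)
    (hf : f ∈ averages G s) : AverageOf G s f := by
  obtain ⟨d, g, hd, hd', hg, hB, rfl⟩ := hf
  exact ⟨hs, d, g, hd', hg, hB, rfl⟩

theorem AverageOf.mem_normingSetZero {s : ℕ} {f : ℕ+ →₀ ℝ}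
    (h : AverageOf (normingSetZero 𝓕) s f) : f ∈ normingSetZero 𝓕 := by
  by_cases hf : f = 0
  · rw [hf]; exact zero_mem_normingSetZero
  · obtain ⟨m, hm⟩ := h.exists_isAverage hf
    exact normingSet_subset (Set.mem_iUnion.2 ⟨m, hm.1⟩)

theorem IsFastSeq.sum_mem {ι : Type} [LinearOrder ι] {Q : Finset ι} {α : ι → ℕ+ →₀ ℝ} {s : ι → ℕ}
    (h : IsFastSeq (normingSetZero 𝓕) 𝓕 Q α s) (h𝓕 : Regular 𝓕) :
    ∑ q ∈ Q, α q ∈ normingSetZero 𝓕 := by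
  classical
  set R := Q.filter fun q => α q ≠ 0 with hR
  have hRQ : R ⊆ Q := Finset.filter_subset _ _
  have hsum : ∑ q ∈ Q, α q = ∑ q ∈ R, α q := (Finset.sum_filter_ne_zero Q).symm
  rcases R.eq_empty_or_nonempty with h0 | hRne
  · rw [hsum, h0, Finset.sum_empty]; exact zero_mem_normingSetZero
  have h' := h.subset h𝓕 hRQ
  have he := R.orderEmbOfFin_mem rfl
  have hemono := (R.orderEmbOfFin rfl).strictMono
  choose! m hm using fun q (hq : q ∈ R) =>
    (h'.average q hq).exists_isAverage (Finset.mem_filter.1 hq).2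
  let M := R.sup m
  have hM : ∀ q ∈ R, IsAverage (normingStep 𝓕 M) (s q) (α q) := fun q hq =>
    (hm q hq).mono (normingStep_mono (Finset.le_sup hq))
  obtain ⟨μ, hμ, -, hadm⟩ := h'.exists_isLeast h𝓕 fun q hq => (Finset.mem_filter.1 hq).2
  refine normingSet_subset (Set.mem_iUnion.2 ⟨M + 1, Or.inl (Or.inr ⟨R.card,
    fun i => α (R.orderEmbOfFin rfl i), fun i => s (R.orderEmbOfFin rfl i),
    fun i => μ (R.orderEmbOfFin rfl i), hRne.card_pos, fun i => hM _ (he i),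
    fun i j hij => h'.before _ (he i) _ (he j) (hemono hij), fun i => hμ _ (he i), ?_,
    fun i j hij => h'.strictMono (he i) (he j) (hemono hij),
    fun i j hij => h'.fast _ (he i) _ (he j) (hemono hij), ?_⟩)⟩)
  · rw [← Finset.image_orderEmbOfFin_univ R rfl, Finset.image_image] at hadm
    exact hadm
  · rw [hsum]
    conv_lhs => rw [← Finset.map_orderEmbOfFin_univ R rfl, Finset.sum_map]
    rfl

/-- Induction on the norming set. -/
theorem normingSetZero_induction {P : (ℕ+ →₀ ℝ) → Prop} (zero : P 0)
    (single : ∀ n, P (Finsupp.single n 1)) (neg_single : ∀ n, P (Finsupp.single n (-1)))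
    (average : ∀ s f, AverageOf {g | g ∈ normingSetZero 𝓕 ∧ P g} s f → P f)
    (sum : ∀ (Q : Finset ℕ) (α : ℕ → ℕ+ →₀ ℝ) (s : ℕ → ℕ),
      IsFastSeq {g | g ∈ normingSetZero 𝓕 ∧ P g} 𝓕 Q α s → P (∑ q ∈ Q, α q))
    {f : ℕ+ →₀ ℝ} (hf : f ∈ normingSetZero 𝓕) : P f := by
  rcases hf with rfl | hf
  · exact zero
  obtain ⟨m, hm⟩ := Set.mem_iUnion.1 hf
  clear hf
  induction m generalizing f with
  | zero =>
    obtain ⟨n, rfl | rfl⟩ := hm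
    · exact single n
    · exact neg_single n
  | succ m ih =>
    have hsub : normingStep 𝓕 m ⊆ {g | g ∈ normingSetZero 𝓕 ∧ P g} := fun g hg =>
      ⟨normingSet_subset (Set.mem_iUnion.2 ⟨m, hg⟩), ih hg⟩
    rcases hm with (⟨ℓ, hℓ, hf⟩ | ⟨d, α, s, l, -, hα, hB, hl, hadm, hs, hfast, rfl⟩) | hf
    · exact average ℓ f ((averages_subset hℓ hf).mono hsub)
    · let e : ∀ {T : Type}, T → (Fin d → T) → ℕ → T := fun x f q =>
        if h : q < d then f ⟨q, h⟩ else x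
      have he : ∀ {T : Type} (x : T) (f : Fin d → T) (q : ℕ) (h : q < d), e x f q = f ⟨q, h⟩ :=
        fun x f q h => dif_pos h
      have hsum : ∑ q, α q = ∑ q ∈ Finset.range d, e 0 α q := by
        rw [← Fin.sum_univ_eq_sum_range]
        exact Finset.sum_congr rfl fun q _ => (he _ _ _ q.2).symm
      have himage : (Finset.range d).image (e 1 l) = Finset.univ.image l := by
        ext k
        simp only [Finset.mem_image, Finset.mem_range, Finset.mem_univ, true_and]
        constructor
        · rintro ⟨q, hq, rfl⟩
          exact ⟨_, (he 1 l q hq).symm⟩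
        · rintro ⟨q, rfl⟩
          exact ⟨q, q.2, he 1 l q q.2⟩
      rw [hsum]
      refine sum (Finset.range d) (e 0 α) (e 0 s) ⟨fun q hq => ?_, fun p hp q hq hpq => ?_,
        ⟨e 1 l, fun p hp q hq hpq => ?_, himage ▸ hadm, fun q hq k hk => ?_⟩,
        fun p hp q hq hpq => ?_, fun p hp q hq hpq => ?_⟩
      · have hq' := Finset.mem_range.1 hq
        rw [he _ _ q hq', he _ _ q hq']
        exact (averages_subset (hα _).2.1 (hα _).2.2).mono hsub
      · rw [he _ _ p (Finset.mem_range.1 hp), he _ _ q (Finset.mem_range.1 hq)]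
        exact hB _ _ hpq
      · rw [Finset.coe_range, Set.mem_Iio] at hp hq
        rw [he _ _ p hp, he _ _ q hq]
        exact hB _ _ hpq _ (hl _).1 _ (hl _).1
      · rw [he _ _ q (Finset.mem_range.1 hq)] at hk ⊢
        exact (hl _).2 hk
      · rw [Finset.coe_range, Set.mem_Iio] at hp hq
        rw [he _ _ p hp, he _ _ q hq]
        exact hs hpq
      · rw [he _ _ p (Finset.mem_range.1 hp), he _ _ q (Finset.mem_range.1 hq)]
        exact hfast _ _ hpq
    · exact ih hf

/-- Restriction keeps sizes, shrinks supports and moves minima to the right, so both operations that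
generate W survive it. It can produce zero, which is why zero is added to W. -/
theorem restrict_mem_normingSetZero (h𝓕 : Regular 𝓕) (S : Finset ℕ+) {f : ℕ+ →₀ ℝ}
    (hf : f ∈ normingSetZero 𝓕) : restrict S f ∈ normingSetZero 𝓕 := by
  have hsingle : ∀ n (c : ℝ), Finsupp.single n c ∈ normingSetZero 𝓕 →
      restrict S (Finsupp.single n c) ∈ normingSetZero 𝓕 := by
    intro n c h
    by_cases hn : n ∈ S
    · rwa [restrict_eq_self (Finsupp.support_single_subset.trans (by simpa using hn))]
    · rw [restrict_eq_zero (Finset.disjoint_of_subset_left Finsupp.support_single_subset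
        (by simpa using hn))]
      exact zero_mem_normingSetZero
  refine normingSetZero_induction (P := fun f => restrict S f ∈ normingSetZero 𝓕) ?_
    (fun n => hsingle n 1 (normingSet_subset (single_mem_normingSet 𝓕 n)))
    (fun n => hsingle n (-1) (normingSet_subset (Set.mem_iUnion.2 ⟨0, n, Or.inr rfl⟩)))
    (fun s f hf => (hf.restrict fun g hg => hg.2).mem_normingSetZero) (fun Q α s h => ?_) hf
  · rw [restrict_zero]; exact zero_mem_normingSetZero
  · rw [restrict_sum]
    exact (h.transform (fun q hq => (h.average q hq).restrict fun g hg => hg.2)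
      fun q _ => support_restrict_subset _ _).sum_mem h𝓕

theorem AverageOf.restrict_normingSetZero (h𝓕 : Regular 𝓕) (S : Finset ℕ+) {s : ℕ} {f : ℕ+ →₀ ℝ}
    (hf : AverageOf (normingSetZero 𝓕) s f) : AverageOf (normingSetZero 𝓕) s (X01.restrict S f) :=
  hf.restrict fun _ hg => restrict_mem_normingSetZero h𝓕 S hg

theorem AverageOf.neg {s : ℕ} {f : ℕ+ →₀ ℝ} (hf : AverageOf (normingSetZero 𝓕) s f) :
    AverageOf (normingSetZero 𝓕) s (-f) := by
  obtain ⟨hs, d, g, hd, hg, hB, rfl⟩ := hf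
  exact ⟨hs, d, fun i => -g i, hd, fun i => neg_mem_normingSetZero (hg i), by simpa using hB,
    by simp⟩

theorem AverageOf.sign_smul {s : ℕ} {f : ℕ+ →₀ ℝ} (hf : AverageOf (normingSetZero 𝓕) s f) (c : ℝ) :
    AverageOf (normingSetZero 𝓕) s ((SignType.sign c : ℝ) • f) := by
  have h0 : AverageOf (normingSetZero 𝓕) s 0 :=
    ⟨hf.1, 0, fun _ => 0, Nat.zero_le _, by simp, by simp, by simp⟩
  rcases lt_trichotomy c 0 with hc | rfl | hc
  · rw [sign_neg hc]; simpa using hf.neg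
  · simpa using h0
  · rw [sign_pos hc]; simpa using hf

/-! ### The norm of finitely supported vectors -/

/-- The norm of a finitely supported vector. -/
noncomputable def nrm (𝓕 : Set (Finset ℕ+)) (x : ℕ+ →₀ ℝ) : ℝ := ‖C00.of 𝓕 x‖

theorem abs_pairing_le_nrm {f : ℕ+ →₀ ℝ} (hf : f ∈ normingSetZero 𝓕) (x : ℕ+ →₀ ℝ) :
    |pairing f x| ≤ nrm 𝓕 x := by
  rcases hf with rfl | hf
  · rw [pairing_zero_left, abs_zero]; exact norm_nonneg _
  · exact abs_pairing_le_norm 𝓕 f hf (C00.of 𝓕 x)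

theorem nrm_le {x : ℕ+ →₀ ℝ} {r : ℝ} (h : ∀ f ∈ normingSetZero 𝓕, pairing f x ≤ r) :
    nrm 𝓕 x ≤ r :=
  norm_le_of_pairing_le 𝓕 _ _ fun f hf => h f (normingSet_subset hf)

theorem nrm_smul (c : ℝ) (x : ℕ+ →₀ ℝ) : nrm 𝓕 (c • x) = |c| * nrm 𝓕 x := by
  unfold nrm
  rw [map_smul, norm_smul, Real.norm_eq_abs]

theorem nrm_sum_le {ι : Type*} (R : Finset ι) (x : ι → ℕ+ →₀ ℝ) :
    nrm 𝓕 (∑ i ∈ R, x i) ≤ ∑ i ∈ R, nrm 𝓕 (x i) := by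
  unfold nrm
  rw [map_sum]
  exact norm_sum_le _ _

theorem nrm_eq_zero {x : ℕ+ →₀ ℝ} : nrm 𝓕 x = 0 ↔ x = 0 := by
  unfold nrm
  rw [norm_eq_zero, LinearEquiv.map_eq_zero_iff]

theorem nrm_restrict_le (h𝓕 : Regular 𝓕) (S : Finset ℕ+) (x : ℕ+ →₀ ℝ) :
    nrm 𝓕 (restrict S x) ≤ nrm 𝓕 x := by
  refine nrm_le fun f hf => ?_
  rw [← pairing_restrict]
  exact (le_abs_self _).trans (abs_pairing_le_nrm (restrict_mem_normingSetZero h𝓕 S hf) x)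

theorem exists_lt_pairing (h𝓕 : Regular 𝓕) {x : ℕ+ →₀ ℝ} {r : ℝ} (hr : r < nrm 𝓕 x) :
    ∃ f ∈ normingSetZero 𝓕, f.support ⊆ x.support ∧ r < pairing f x := by
  by_contra! hc
  refine absurd hr (not_lt.2 (nrm_le fun f hf => ?_))
  rw [← pairing_restrict_support subset_rfl f]
  exact hc _ (restrict_mem_normingSetZero h𝓕 _ hf) (support_restrict_subset_left _ _)

variable {𝓕 : Set (Finset ℕ+)} {𝓖 : ℕ+ → Set (Finset ℕ+)}

/-! ### Lower `ℓ₁` estimates -/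

theorem exists_strictMono_bound (B : ℕ+ → ℕ+) :
    ∃ L : ℕ+ → ℕ+, StrictMono L ∧ ∀ i j, i < j → B (L i) < L j := by
  let c : ℕ → ℕ+ := fun k => Nat.rec 1 (fun _ x => max x (B x) + 1) k
  have hc : ∀ k, c (k + 1) = max (c k) (B (c k)) + 1 := fun _ => rfl
  have hmono : StrictMono c := strictMono_nat_of_lt_succ fun k => by
    rw [hc, PNat.lt_add_one_iff]; exact le_max_left _ _
  refine ⟨fun i => c i.natPred, fun i j hij => hmono (PNat.natPred_lt_natPred.2 hij),
    fun i j hij => ?_⟩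
  have h1 : B (c i.natPred) < c (i.natPred + 1) := by
    rw [hc, PNat.lt_add_one_iff]; exact le_max_right _ _
  exact h1.trans_le (hmono.monotone (PNat.natPred_lt_natPred.2 hij))

/-- Each average is restricted to the support of v, given the sign of its action, and dropped if it
vanishes. The total absolute action thus becomes the value of one sum of functionals whose minima
lie in the support of v. -/
theorem IsFastSeq.exists_supported {ι : Type} [LinearOrder ι] {𝓔 : Set (Finset ℕ+)}
    (h𝓕 : Regular 𝓕) (h𝓔 : Regular 𝓔) {Q : Finset ι} {α : ι → ℕ+ →₀ ℝ} {s : ι → ℕ}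
    (h : IsFastSeq (normingSetZero 𝓕) 𝓔 Q α s) (v : ℕ+ →₀ ℝ) :
    ∃ (Q' : Finset ι) (β : ι → ℕ+ →₀ ℝ) (μ : ι → ℕ+), Q' ⊆ Q ∧
      IsFastSeq (normingSetZero 𝓕) 𝓔 Q' β s ∧ (∀ q ∈ Q', (β q).support ⊆ v.support) ∧
      (∀ q ∈ Q', IsLeast ((β q).support : Set ℕ+) (μ q)) ∧ StrictMonoOn μ Q' ∧ Q'.image μ ∈ 𝓔 ∧
      ∑ q ∈ Q', pairing (β q) v = ∑ q ∈ Q, |pairing (α q) v| := by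
  classical
  let β : ι → ℕ+ →₀ ℝ := fun q =>
    (SignType.sign (pairing (α q) v) : ℝ) • restrict v.support (α q)
  have hβ : ∀ q, pairing (β q) v = |pairing (α q) v| := fun q => by
    simp only [β]
    rw [pairing_smul_left, pairing_restrict_support subset_rfl, sign_mul_self]
  have hsupp : ∀ q, (β q).support ⊆ (restrict v.support (α q)).support := fun q =>
    Finsupp.support_smul
  have h' := (h.transform (β := β) (fun q hq =>
    ((h.average q hq).restrict_normingSetZero h𝓕 _).sign_smul _)
    fun q _ => (hsupp q).trans (support_restrict_subset _ _)).subset h𝓔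
    (Finset.filter_subset (fun q => β q ≠ 0) Q)
  obtain ⟨μ, hμ, hm, hi⟩ := h'.exists_isLeast h𝓔 fun q hq => (Finset.mem_filter.1 hq).2
  refine ⟨_, β, μ, Finset.filter_subset _ _, h',
    fun q _ => (hsupp q).trans (support_restrict_subset_left _ _), hμ, hm, hi, ?_⟩
  rw [Finset.sum_filter_of_ne (p := fun q => β q ≠ 0)
    fun q _ hq h0 => hq (by rw [h0, pairing_zero_left])]
  exact Finset.sum_congr rfl fun q _ => hβ q

theorem IsFastSeq.singleton {ι : Type} [LinearOrder ι] {G : Set (ℕ+ →₀ ℝ)}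
    {𝓔 : Set (Finset ℕ+)} {q : ι} {α : ι → ℕ+ →₀ ℝ} {s : ι → ℕ} (h : AverageOf G (s q) (α q))
    (h1 : {1} ∈ 𝓔) : IsFastSeq G 𝓔 {q} α s where
  average p hp := by rwa [Finset.mem_singleton.1 hp]
  before p hp p' hp' hlt := absurd hlt (by
    rw [Finset.mem_singleton.1 hp, Finset.mem_singleton.1 hp']; exact lt_irrefl q)
  mins := ⟨fun _ => 1, by simp, by rwa [Finset.image_singleton], fun _ _ _ _ => one_le⟩
  strictMono := by simp
  fast p hp p' hp' hlt := absurd hlt (by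
    rw [Finset.mem_singleton.1 hp, Finset.mem_singleton.1 hp']; exact lt_irrefl q)

theorem disjoint_of_before {A B : Finset ℕ+} (h : Before A B) : Disjoint A B :=
  Finset.disjoint_left.2 fun a ha hb => lt_irrefl a (h a ha a hb)

theorem Successive.disjoint {G : ℕ+ → Finset ℕ+} (hG : Successive G) {i j : ℕ+} (hij : i ≠ j) :
    Disjoint (G i) (G j) := by
  rcases lt_or_gt_of_ne hij with h | h
  · exact disjoint_of_before (hG _ _ h)
  · exact (disjoint_of_before (hG _ _ h)).symm

/-- The sequences of averages belonging to well separated vectors are concatenated. Each set of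
minima is in 𝓖ₙ, so absorption puts their union over E into 𝓕, and sizes chosen large enough make
the concatenation very fast growing. The resulting functional acts on the term with index i by at
least c|aᵢ|. -/
theorem exists_ellOne_subsequence (hL : GoodLevels 𝓕 𝓖) {u : ℕ+ → ℕ+ →₀ ℝ}
    (hu : Successive fun i => (u i).support) {c : ℝ} (hc : 0 < c) (n : ℕ+)
    (H : ∀ K : ℕ+, ∃ k ≥ K, ∃ (Q : Finset ℕ) (α : ℕ → ℕ+ →₀ ℝ) (s : ℕ → ℕ),
      IsFastSeq (normingSetZero 𝓕) (𝓖 n) Q α s ∧ (∀ q ∈ Q, (K : ℕ) ≤ s q) ∧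
      c ≤ ∑ q ∈ Q, |pairing (α q) (u k)|) :
    ∃ M : ℕ+ → ℕ+, StrictMono M ∧ ∀ E ∈ 𝓕, ∀ a : ℕ+ → ℝ,
      c * ∑ i ∈ E, |a i| ≤ nrm 𝓕 (∑ i ∈ E, a i • u (M i)) := by
  classical
  have h𝓕 := hL.regular_family
  have H' : ∀ K : ℕ+, ∃ k ≥ K, ∃ (Q : Finset ℕ) (β : ℕ → ℕ+ →₀ ℝ) (s : ℕ → ℕ) (μ : ℕ → ℕ+),
      IsFastSeq (normingSetZero 𝓕) (𝓖 n) Q β s ∧ (∀ q ∈ Q, (K : ℕ) ≤ s q) ∧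
      (∀ q ∈ Q, (β q).support ⊆ (u k).support) ∧
      (∀ q ∈ Q, IsLeast ((β q).support : Set ℕ+) (μ q)) ∧ StrictMonoOn μ Q ∧ Q.image μ ∈ 𝓖 n ∧
      c ≤ ∑ q ∈ Q, pairing (β q) (u k) := by
    intro K
    obtain ⟨k, hk, Q, α, s, h1, h2, h3⟩ := H K
    obtain ⟨Q', β, μ, h4, h5, h6, h7, h8, h9, h10⟩ := h1.exists_supported h𝓕 (hL.regular n) (u k)
    exact ⟨k, hk, Q', β, s, μ, h5, fun q hq => h2 q (h4 hq), h6, h7, h8, h9, h10 ▸ h3⟩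
  choose k hk Q β s μ hfast hs hsupp hμ hμm hμi hsum using H'
  -- B K dominates the index, the sizes and the support chosen for K. A later choice is made for
  -- some K' > B K, and all its sizes are at least K'.
  have hB : ∀ K : ℕ+, ∃ b : ℕ+, k K ≤ b ∧ (∀ q ∈ Q K, s K q ≤ b) ∧
      ∀ x ∈ (u (k K)).support, x ≤ b := by
    intro K
    obtain ⟨z, hz⟩ : ∃ z : ℕ+, (z : ℕ) = (Q K).sup (s K) + 1 := ⟨⟨_, Nat.succ_pos _⟩, rfl⟩
    refine ⟨k K + z + (u (k K)).support.sup id, ?_, ?_, ?_⟩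
    · exact ((PNat.lt_add_right _ _).trans (PNat.lt_add_right _ _)).le
    · intro q hq
      have := Finset.le_sup (f := s K) hq
      simp only [PNat.add_coe]
      omega
    · intro x hx
      exact (Finset.le_sup (f := id) hx).trans (PNat.lt_add_left _ _).le
  choose B hBk hBs hBu using hB
  obtain ⟨L, hLm, hLB⟩ := exists_strictMono_bound B
  have hkL : StrictMono fun i => k (L i) := fun i j hij =>
    (hBk _).trans_lt ((hLB i j hij).trans_le (hk _))
  have huk : Successive fun i => (u (k (L i))).support := hu.comp hkL
  have hGsub : ∀ i, (Q (L i)).image (μ (L i)) ⊆ (u (k (L i))).support := by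
    intro i x hx
    obtain ⟨q, hq, rfl⟩ := Finset.mem_image.1 hx
    exact hsupp _ q hq (hμ _ q hq).1
  obtain ⟨N, hN, hNE⟩ := hL.absorbs n (fun i => (Q (L i)).image (μ (L i)))
    (fun i j hij => (huk i j hij).mono (hGsub i) (hGsub j))
    (fun i => by
      rw [Finset.image_nonempty, Finset.nonempty_iff_ne_empty]
      intro h0
      have := hsum (L i)
      rw [h0, Finset.sum_empty] at this
      exact absurd this (not_le.2 hc))
    fun i => hμi _
  refine ⟨fun i => k (L (N i)), hkL.comp hN, fun E hE a => ?_⟩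
  let K : ℕ+ → ℕ+ := fun i => L (N i)
  have hK : StrictMono K := hLm.comp hN
  have hKB : ∀ i j, i < j → B (K i) < K j := fun i j hij => hLB _ _ (hN hij)
  have huK : Successive fun i => (u (k (K i))).support := huk.comp hN
  -- The concatenation is indexed by pairs (vector, average) in lexicographic order.
  let e : (Σ _ : ℕ+, ℕ) ↪ ℕ+ ×ₗ ℕ := ⟨fun p => toLex (p.1, p.2), fun p p' h => by
    have h1 := Prod.mk.inj (toLex.injective h)
    exact Sigma.ext h1.1 (heq_of_eq h1.2)⟩
  let T : Finset (ℕ+ ×ₗ ℕ) := (E.sigma fun i => Q (K i)).map e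
  let γ : ℕ+ ×ₗ ℕ → ℕ+ →₀ ℝ := fun p =>
    (SignType.sign (a (ofLex p).1) : ℝ) • β (K (ofLex p).1) (ofLex p).2
  have hT : ∀ p ∈ T, ∃ i ∈ E, ∃ q ∈ Q (K i), p = toLex (i, q) := by
    intro p hp
    obtain ⟨⟨i, q⟩, hx, rfl⟩ := Finset.mem_map.1 hp
    rw [Finset.mem_sigma] at hx
    exact ⟨i, hx.1, q, hx.2, rfl⟩
  have hγ : ∀ i q, (γ (toLex (i, q))).support ⊆ (β (K i) q).support := fun i q =>
    Finsupp.support_smul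
  have hTfast : IsFastSeq (normingSetZero 𝓕) 𝓕 T γ fun p => s (K (ofLex p).1) (ofLex p).2 := by
    refine ⟨fun p hp => ?_, fun p hp p' hp' hlt => ?_,
      ⟨fun p => μ (K (ofLex p).1) (ofLex p).2, fun p hp p' hp' hlt => ?_, ?_, fun p hp x hx => ?_⟩,
      fun p hp p' hp' hlt => ?_, fun p hp p' hp' hlt x hx => ?_⟩
    · obtain ⟨i, hi, q, hq, rfl⟩ := hT p hp
      exact ((hfast (K i)).average q hq).sign_smul _
    · obtain ⟨i, hi, q, hq, rfl⟩ := hT p hp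
      obtain ⟨i', hi', q', hq', rfl⟩ := hT p' hp'
      refine Before.mono ?_ (hγ i q) (hγ i' q')
      rcases Prod.Lex.toLex_lt_toLex.1 hlt with h | ⟨h1, h2⟩
      · exact (huK _ _ h).mono (hsupp _ q hq) (hsupp _ q' hq')
      · dsimp only at h1 h2
        subst h1
        exact (hfast (K i)).before q hq q' hq' h2
    · obtain ⟨i, hi, q, hq, rfl⟩ := hT p hp
      obtain ⟨i', hi', q', hq', rfl⟩ := hT p' hp'
      rcases Prod.Lex.toLex_lt_toLex.1 hlt with h | ⟨h1, h2⟩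
      · exact huK _ _ h _ (hsupp _ q hq (hμ _ q hq).1) _ (hsupp _ q' hq' (hμ _ q' hq').1)
      · dsimp only at h1 h2
        subst h1
        exact hμm (K i) hq hq' h2
    · have := hNE E hE
      convert this using 1
      ext x
      simp only [Finset.mem_image, Finset.mem_biUnion]
      constructor
      · rintro ⟨p, hp, rfl⟩
        obtain ⟨i, hi, q, hq, rfl⟩ := hT p hp
        exact ⟨i, hi, q, hq, rfl⟩
      · rintro ⟨i, hi, q, hq, rfl⟩
        exact ⟨toLex (i, q), Finset.mem_map.2 ⟨⟨i, q⟩, Finset.mem_sigma.2 ⟨hi, hq⟩, rfl⟩, rfl⟩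
    · obtain ⟨i, hi, q, hq, rfl⟩ := hT p hp
      exact (hμ (K i) q hq).2 (hγ i q hx)
    · obtain ⟨i, hi, q, hq, rfl⟩ := hT p hp
      obtain ⟨i', hi', q', hq', rfl⟩ := hT p' hp'
      rcases Prod.Lex.toLex_lt_toLex.1 hlt with h | ⟨h1, h2⟩
      · have h1 : ((B (K i) : ℕ+) : ℕ) < K i' := by exact_mod_cast hKB i i' h
        exact ((hBs _ q hq).trans_lt h1).trans_le (hs _ q' hq')
      · dsimp only at h1 h2
        subst h1
        exact (hfast (K i)).strictMono hq hq' h2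
    · obtain ⟨i, hi, q, hq, rfl⟩ := hT p hp
      obtain ⟨i', hi', q', hq', rfl⟩ := hT p' hp'
      rcases Prod.Lex.toLex_lt_toLex.1 hlt with h | ⟨h1, h2⟩
      · have h1 : (x : ℕ) < K i' := by
          exact_mod_cast (hBu _ x (hsupp _ q hq (hγ i q hx))).trans_lt (hKB i i' h)
        exact h1.trans_le (hs _ q' hq')
      · dsimp only at h1 h2
        subst h1
        exact (hfast (K i)).fast q hq q' hq' h2 x (hγ i q hx)
  refine le_trans ?_ ((le_abs_self _).trans (abs_pairing_le_nrm (hTfast.sum_mem h𝓕) _))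
  rw [pairing_sum_left, Finset.sum_map, Finset.sum_sigma, Finset.mul_sum]
  refine Finset.sum_le_sum fun i hi => ?_
  have hval : ∀ q ∈ Q (K i), pairing (γ (e ⟨i, q⟩)) (∑ j ∈ E, a j • u (k (L (N j)))) =
      |a i| * pairing (β (K i) q) (u (k (K i))) := by
    intro q hq
    rw [pairing_sum_right, Finset.sum_eq_single_of_mem i hi]
    · change pairing ((SignType.sign (a i) : ℝ) • β (K i) q) (a i • u (k (K i))) = _
      rw [pairing_smul_left, pairing_smul, ← mul_assoc, sign_mul_self]
    · intro j _ hj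
      rw [pairing_smul, pairing_eq_zero, mul_zero]
      exact Finset.disjoint_of_subset_left ((hγ i q).trans (hsupp _ q hq)) (huK.disjoint hj.symm)
  rw [Finset.sum_congr rfl hval, ← Finset.mul_sum, mul_comm]
  exact mul_le_mul_of_nonneg_left (hsum _) (abs_nonneg _)

variable {𝓕 : Set (Finset ℕ+)} {𝓖 : ℕ+ → Set (Finset ℕ+)}

/-! ### Upper `c₀` estimates -/

/-- Very fast growing averages of large sizes, admissible for a fixed level, are small on the tail
of the sequence. -/
def IndexZero (𝓕 : Set (Finset ℕ+)) (𝓖 : ℕ+ → Set (Finset ℕ+)) (u : ℕ+ → ℕ+ →₀ ℝ) : Prop :=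
  ∀ (n : ℕ+) (δ : ℝ), 0 < δ → ∃ K : ℕ+, ∀ k ≥ K, ∀ (Q : Finset ℕ) (α : ℕ → ℕ+ →₀ ℝ) (s : ℕ → ℕ),
    IsFastSeq (normingSetZero 𝓕) (𝓖 n) Q α s → (∀ q ∈ Q, (K : ℕ) ≤ s q) →
    ∑ q ∈ Q, |pairing (α q) (u k)| ≤ δ

/-- The hypotheses of the upper estimate. -/
structure CZeroData (𝓕 : Set (Finset ℕ+)) (𝓖 : ℕ+ → Set (Finset ℕ+)) (v : ℕ+ → ℕ+ →₀ ℝ)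
    (p : ℕ+ → ℕ+) (δ : ℕ+ → ℝ) (E₀ : Finset ℕ+) (η : ℝ) (a : ℕ+ → ℝ) : Prop where
  successive : Successive fun i => (v i).support
  nrm_le_one : ∀ i, nrm 𝓕 (v i) ≤ 1
  le_of_mem : ∀ i, ∀ k ∈ (v i).support, p i ≤ k
  average_le : ∀ i j, i ≤ j → ∀ f s, AverageOf (normingSetZero 𝓕) s f → (p i : ℕ) ≤ s →
    |pairing f (v j)| ≤ δ i
  sum_le : ∀ i j, i < j → ∀ (Q : Finset ℕ) (α : ℕ → ℕ+ →₀ ℝ) (s : ℕ → ℕ),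
    IsFastSeq (normingSetZero 𝓕) (𝓖 ((v i).support.sup id)) Q α s →
    (∀ q ∈ Q, (p j : ℕ) ≤ s q) → ∑ q ∈ Q, |pairing (α q) (v j)| ≤ δ i
  delta_nonneg : ∀ i, 0 ≤ δ i
  eta_nonneg : 0 ≤ η
  le_eta : ∀ i ∈ E₀, 2 * E₀.card * δ i ≤ η
  abs_le_one : ∀ i ∈ E₀, |a i| ≤ 1

namespace CZeroData

variable {v : ℕ+ → ℕ+ →₀ ℝ} {p : ℕ+ → ℕ+} {δ : ℕ+ → ℝ} {E₀ : Finset ℕ+} {η : ℝ} {a : ℕ+ → ℝ}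

theorem eq_filter (f : ℕ+ →₀ ℝ) (E : Finset ℕ+) :
    pairing f (∑ i ∈ E, a i • v i) =
      pairing f (∑ i ∈ E.filter fun i => ¬ Disjoint f.support (v i).support, a i • v i) := by
  rw [pairing_sum_right, pairing_sum_right, Finset.sum_filter_of_ne]
  intro i _ h hd
  exact h (by rw [pairing_smul, pairing_eq_zero hd, mul_zero])

theorem abs_le_one_of_card (h : CZeroData 𝓕 𝓖 v p δ E₀ η a) {f : ℕ+ →₀ ℝ}
    (hf : f ∈ normingSetZero 𝓕) {E : Finset ℕ+} (hE : E ⊆ E₀)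
    (hc : (E.filter fun i => ¬ Disjoint f.support (v i).support).card ≤ 1) :
    |pairing f (∑ i ∈ E, a i • v i)| ≤ 1 := by
  rw [eq_filter]
  rcases Finset.eq_empty_or_nonempty
    (E.filter fun i => ¬ Disjoint f.support (v i).support) with h0 | ⟨i, hi⟩
  · rw [h0, Finset.sum_empty, pairing_zero_right, abs_zero]; exact zero_le_one
  · rw [Finset.card_le_one_iff_subset_singleton] at hc
    obtain ⟨j, hj⟩ := hc
    obtain rfl : i = j := Finset.mem_singleton.1 (hj hi)
    rw [Finset.Subset.antisymm hj (Finset.singleton_subset_iff.2 hi), Finset.sum_singleton,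
      pairing_smul, abs_mul]
    exact mul_le_one₀ (h.abs_le_one i (hE (Finset.mem_filter.1 hi).1)) (abs_nonneg _)
      ((abs_pairing_le_nrm hf _).trans (h.nrm_le_one i))

/-- Averaging gains one η over the bound assumed for the summands. If one summand meets all vᵢ,
every other meets at most one of them, since supports are successive; the excess (|E|+1)η is then
divided by s ≥ 2, which leaves at most |E|η. Otherwise every summand misses some vᵢ, and its own
bound, applied to fewer vectors, is at most 1 + |E|η. -/
theorem average_bound (h : CZeroData 𝓕 𝓖 v p δ E₀ η a) {s : ℕ} {f : ℕ+ →₀ ℝ}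
    (hf : AverageOf {g | g ∈ normingSetZero 𝓕 ∧ ∀ E ⊆ E₀,
      |pairing g (∑ i ∈ E, a i • v i)| ≤ 1 + (E.card + 1) * η} s f)
    {E : Finset ℕ+} (hE : E ⊆ E₀) : |pairing f (∑ i ∈ E, a i • v i)| ≤ 1 + E.card * η := by
  have hη := h.eta_nonneg
  by_cases hcard : E.card ≤ 1
  · refine (h.abs_le_one_of_card (hf.mono fun g hg => hg.1).mem_normingSetZero hE
      ((Finset.card_filter_le _ _).trans hcard)).trans ?_
    have : 0 ≤ E.card * η := by positivity
    linarith
  push Not at hcard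
  obtain ⟨hs, d, g, hd, hg, hB, rfl⟩ := hf
  have hs0 : (0 : ℝ) < s := by exact_mod_cast (by omega : 0 < s)
  have hds : (d : ℝ) ≤ s := by exact_mod_cast hd
  have hs2 : (2 : ℝ) ≤ s := by exact_mod_cast hs
  have hc2 : (1 : ℝ) < E.card := by exact_mod_cast hcard
  rw [pairing_smul_left, pairing_sum_left, abs_mul, abs_of_pos (inv_pos.2 hs0),
    inv_mul_le_iff₀ hs0]
  refine (Finset.abs_sum_le_sum_abs _ _).trans ?_
  let A : Fin d → Finset ℕ+ := fun r => E.filter fun i => ¬ Disjoint (g r).support (v i).support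
  have hAE : ∀ r, A r ⊆ E := fun r => Finset.filter_subset _ _
  by_cases hex : ∃ r, A r = E
  · obtain ⟨r, hr⟩ := hex
    have hother : ∀ t, t ≠ r → |pairing (g t) (∑ i ∈ E, a i • v i)| ≤ 1 := by
      intro t ht
      refine h.abs_le_one_of_card (hg t).1 hE (Finset.card_le_one.2 ?_)
      have key : ∀ i ∈ A t, ∀ j ∈ A t, ¬ i < j := by
        intro i hi j hj hij
        have hir : i ∈ A r := hr ▸ hAE t hi
        have hjr : j ∈ A r := hr ▸ hAE t hj
        obtain ⟨x, hx1, hx2⟩ := Finset.not_disjoint_iff.1 (Finset.mem_filter.1 hi).2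
        obtain ⟨y, hy1, hy2⟩ := Finset.not_disjoint_iff.1 (Finset.mem_filter.1 hj).2
        obtain ⟨x', hx1', hx2'⟩ := Finset.not_disjoint_iff.1 (Finset.mem_filter.1 hir).2
        obtain ⟨y', hy1', hy2'⟩ := Finset.not_disjoint_iff.1 (Finset.mem_filter.1 hjr).2
        rcases lt_or_gt_of_ne ht with hlt | hlt
        · exact lt_asymm (hB t r hlt y hy1 x' hx1') (h.successive i j hij x' hx2' y hy2)
        · exact lt_asymm (hB r t hlt y' hy1' x hx1) (h.successive i j hij x hx2 y' hy2')
      intro i hi j hj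
      rcases lt_trichotomy i j with hij | hij | hij
      · exact absurd hij (key i hi j hj)
      · exact hij
      · exact absurd hij (key j hj i hi)
    rw [← Finset.add_sum_erase _ _ (Finset.mem_univ r)]
    have h1 : ∑ t ∈ Finset.univ.erase r, |pairing (g t) (∑ i ∈ E, a i • v i)| ≤ (d : ℝ) - 1 := by
      refine (Finset.sum_le_sum fun t ht => hother t (Finset.ne_of_mem_erase ht)).trans ?_
      rw [Finset.sum_const, nsmul_one, Finset.card_erase_of_mem (Finset.mem_univ r),
        Finset.card_univ, Fintype.card_fin, Nat.cast_sub (by have := r.2; omega), Nat.cast_one]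
    have h2 := (hg r).2 E hE
    have h3 : ((E.card : ℝ) + 1) * η ≤ s * (E.card * η) := by
      nlinarith [mul_nonneg (by linarith : (0 : ℝ) ≤ E.card - 1) hη,
        mul_nonneg (by linarith : (0 : ℝ) ≤ (s : ℝ) - 2) (by positivity : (0 : ℝ) ≤ E.card * η)]
    linarith
  · push Not at hex
    have hall : ∀ t, |pairing (g t) (∑ i ∈ E, a i • v i)| ≤ 1 + E.card * η := by
      intro t
      rw [eq_filter]
      refine ((hg t).2 _ ((hAE t).trans hE)).trans ?_
      have hlt : (A t).card < E.card := Finset.card_lt_card ((hAE t).ssubset_of_ne (hex t))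
      have : ((A t).card : ℝ) + 1 ≤ E.card := by exact_mod_cast hlt
      have := mul_le_mul_of_nonneg_right this hη
      linarith
    refine (Finset.sum_le_sum fun t _ => hall t).trans ?_
    rw [Finset.sum_const, Finset.card_univ, Fintype.card_fin, nsmul_eq_mul]
    exact mul_le_mul_of_nonneg_right hds (by positivity)

/-- Let vⱼ be the first vector met and α_{q₁} the first average that meets it. Earlier averages meet
no vector, and the later ones contribute at most η on the vectors other than vⱼ. If α_{q₁} meets vⱼ
only, what remains is the action on vⱼ, at most 1. Otherwise the later averages miss vⱼ, and what
remains is the single average α_{q₁}, controlled by `average_bound`. -/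
theorem sum_bound (hL : IsLevels 𝓕 𝓖) (h : CZeroData 𝓕 𝓖 v p δ E₀ η a) {Q : Finset ℕ}
    {α : ℕ → ℕ+ →₀ ℝ} {s : ℕ → ℕ}
    (hQ : IsFastSeq {g | g ∈ normingSetZero 𝓕 ∧ ∀ E ⊆ E₀,
      |pairing g (∑ i ∈ E, a i • v i)| ≤ 1 + (E.card + 1) * η} 𝓕 Q α s)
    {E : Finset ℕ+} (hE : E ⊆ E₀) :
    |pairing (∑ q ∈ Q, α q) (∑ i ∈ E, a i • v i)| ≤ 1 + (E.card + 1) * η := by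
  classical
  have hη := h.eta_nonneg
  have hQ' : IsFastSeq (normingSetZero 𝓕) 𝓕 Q α s :=
    hQ.transform (fun q hq => (hQ.average q hq).mono fun g hg => hg.1) fun q _ => subset_rfl
  have hpos : 0 ≤ ((E.card : ℝ) + 1) * η := by positivity
  let act : ℕ → ℕ+ → Prop := fun q i => ¬ Disjoint (α q).support (v i).support
  have hact : ∀ q i, ¬ act q i → pairing (α q) (v i) = 0 := fun q i hqi =>
    pairing_eq_zero (not_not.1 hqi)
  by_cases hne : (E.filter fun i => ∃ q ∈ Q, act q i).Nonempty
  swap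
  · rw [Finset.not_nonempty_iff_eq_empty, Finset.filter_eq_empty_iff] at hne
    have : pairing (∑ q ∈ Q, α q) (∑ i ∈ E, a i • v i) = 0 := by
      rw [pairing_sum_left]
      refine Finset.sum_eq_zero fun q hq => ?_
      rw [pairing_sum_right]
      refine Finset.sum_eq_zero fun i hi => ?_
      rw [pairing_smul, hact q i fun hh => hne hi ⟨q, hq, hh⟩, mul_zero]
    rw [this, abs_zero]
    linarith
  obtain ⟨j, hj, hjmin⟩ : ∃ j, j ∈ (E.filter fun i => ∃ q ∈ Q, act q i) ∧
      ∀ i ∈ (E.filter fun i => ∃ q ∈ Q, act q i), j ≤ i :=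
    ⟨_, Finset.min'_mem _ hne, fun i hi => Finset.min'_le _ i hi⟩
  obtain ⟨hjE, hjQ⟩ := Finset.mem_filter.1 hj
  obtain ⟨q₁, hq₁, hqmin⟩ : ∃ q₁, q₁ ∈ (Q.filter fun q => act q j) ∧
      ∀ q ∈ (Q.filter fun q => act q j), q₁ ≤ q := by
    have hne' : (Q.filter fun q => act q j).Nonempty := by
      obtain ⟨q, hq, hqj⟩ := hjQ
      exact ⟨q, Finset.mem_filter.2 ⟨hq, hqj⟩⟩
    exact ⟨_, Finset.min'_mem _ hne', fun i hi => Finset.min'_le _ i hi⟩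
  obtain ⟨hq₁Q, hq₁j⟩ := Finset.mem_filter.1 hq₁
  obtain ⟨x, hxα, hxv⟩ := Finset.not_disjoint_iff.1 hq₁j
  have hsmall : ∀ q ∈ Q, q < q₁ → ∀ i ∈ E, ¬ act q i := by
    intro q hq hlt i hi hqi
    have hji : j ≤ i := hjmin i (Finset.mem_filter.2 ⟨hi, q, hq, hqi⟩)
    rcases hji.eq_or_lt with rfl | hji
    · exact absurd (hqmin q (Finset.mem_filter.2 ⟨hq, hqi⟩)) (not_le.2 hlt)
    · obtain ⟨y, hyα, hyv⟩ := Finset.not_disjoint_iff.1 hqi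
      exact lt_asymm (hQ'.before q hq q₁ hq₁Q hlt y hyα x hxα) (h.successive j i hji x hxv y hyv)
  -- The level n of admissibility satisfies n ≤ φ q₁, which is at most a point of supp vⱼ. So the
  -- level is bounded in terms of vⱼ, to which all later vectors are adapted.
  have hadm : IsFastSeq (normingSetZero 𝓕) (𝓖 ((v j).support.sup id)) Q α s := by
    refine { hQ' with mins := ?_ }
    obtain ⟨φ, h1, h2, h3⟩ := hQ'.mins
    obtain ⟨n, hn, hn'⟩ := (hL.mem_iff _).1 h2
    refine ⟨φ, h1, hL.mono ?_ hn', h3⟩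
    exact (hn _ (Finset.mem_image_of_mem φ hq₁Q)).trans
      ((h3 q₁ hq₁Q x hxα).trans (Finset.le_sup (f := id) hxv))
  let Q₂ := Q.filter fun q => q₁ < q
  have hlater : ∀ i ∈ E, i ≠ j → ∑ q ∈ Q₂, |pairing (α q) (v i)| ≤ 2 * δ j := by
    intro i hi hij
    have hδ := h.delta_nonneg j
    have heq : ∑ q ∈ Q₂, |pairing (α q) (v i)| =
        ∑ q ∈ Q₂.filter fun q => act q i, |pairing (α q) (v i)| := by
      rw [Finset.sum_filter_of_ne (p := fun q => act q i)]
      intro q _ hq0 hdis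
      exact hq0 (by rw [hact q i (not_not.2 hdis), abs_zero])
    rw [heq]
    rcases (Q₂.filter fun q => act q i).eq_empty_or_nonempty with h0 | hne
    · rw [h0, Finset.sum_empty]; linarith
    obtain ⟨q₂, hq₂, hq₂min⟩ : ∃ q₂, q₂ ∈ (Q₂.filter fun q => act q i) ∧
        ∀ q ∈ (Q₂.filter fun q => act q i), q₂ ≤ q :=
      ⟨_, Finset.min'_mem _ hne, fun i hi => Finset.min'_le _ i hi⟩
    obtain ⟨hq₂Q₂, hq₂i⟩ := Finset.mem_filter.1 hq₂
    obtain ⟨hq₂Q, hq₁₂⟩ := Finset.mem_filter.1 hq₂Q₂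
    have hji : j < i := lt_of_le_of_ne
      (hjmin i (Finset.mem_filter.2 ⟨hi, q₂, hq₂Q, hq₂i⟩)) hij.symm
    rw [← Finset.add_sum_erase _ _ hq₂]
    -- The size of α_{q₂} is only known to exceed a point of supp vⱼ, hence p j, which is enough for
    -- one average. The averages after it have size at least p i, as `sum_le` requires.
    have hfirst : |pairing (α q₂) (v i)| ≤ δ j := by
      refine h.average_le j i hji.le _ (s q₂) (hQ'.average q₂ hq₂Q) ?_
      refine le_trans ?_ (hQ'.fast q₁ hq₁Q q₂ hq₂Q hq₁₂ x hxα).le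
      exact_mod_cast h.le_of_mem j x hxv
    obtain ⟨y, hyα, hyv⟩ := Finset.not_disjoint_iff.1 hq₂i
    have hrest : ∑ q ∈ (Q₂.filter fun q => act q i).erase q₂, |pairing (α q) (v i)| ≤ δ j := by
      have hsub : (Q₂.filter fun q => act q i).erase q₂ ⊆ Q :=
        (Finset.erase_subset _ _).trans ((Finset.filter_subset _ _).trans (Finset.filter_subset _ _))
      refine h.sum_le j i hji _ α s (hadm.subset (hL.regular _) hsub) fun q hq => ?_
      have hlt : q₂ < q := lt_of_le_of_ne (hq₂min q (Finset.mem_of_mem_erase hq))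
        (Finset.ne_of_mem_erase hq).symm
      refine le_trans ?_ (hQ'.fast q₂ hq₂Q q (hsub hq) hlt y hyα).le
      exact_mod_cast h.le_of_mem i y hyv
    linarith
  let g := ∑ q ∈ Q₂, α q
  have hrest : |∑ i ∈ E.erase j, a i * pairing g (v i)| ≤ η := by
    calc |∑ i ∈ E.erase j, a i * pairing g (v i)|
        ≤ ∑ i ∈ E.erase j, |a i * pairing g (v i)| := Finset.abs_sum_le_sum_abs _ _
      _ ≤ ∑ _i ∈ E.erase j, 2 * δ j := by
          refine Finset.sum_le_sum fun i hi => ?_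
          have hiE := Finset.mem_of_mem_erase hi
          rw [abs_mul]
          refine (mul_le_of_le_one_left (abs_nonneg _) (h.abs_le_one i (hE hiE))).trans ?_
          simp only [g]
          rw [pairing_sum_left]
          exact (Finset.abs_sum_le_sum_abs _ _).trans (hlater i hiE (Finset.ne_of_mem_erase hi))
      _ = (E.erase j).card * (2 * δ j) := by rw [Finset.sum_const, nsmul_eq_mul]
      _ ≤ E₀.card * (2 * δ j) := by
          refine mul_le_mul_of_nonneg_right ?_ (by have := h.delta_nonneg j; linarith)
          exact_mod_cast Finset.card_le_card ((Finset.erase_subset _ _).trans hE)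
      _ ≤ η := by
          have := h.le_eta j (hE hjE)
          linarith
  have hsplit : ∀ i ∈ E, pairing (∑ q ∈ Q, α q) (v i) =
      pairing (α q₁) (v i) + pairing g (v i) := by
    intro i hi
    simp only [g]
    rw [pairing_sum_left, pairing_sum_left, ← Finset.add_sum_erase _ _ hq₁Q]
    congr 1
    refine (Finset.sum_subset ?_ ?_).symm
    · intro q hq
      obtain ⟨h1, h2⟩ := Finset.mem_filter.1 hq
      exact Finset.mem_erase.2 ⟨h2.ne', h1⟩
    · intro q hq hq'
      have hqQ := Finset.mem_of_mem_erase hq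
      have hlt : q < q₁ := lt_of_le_of_ne (not_lt.1 fun hlt => hq' (Finset.mem_filter.2 ⟨hqQ, hlt⟩))
        (Finset.ne_of_mem_erase hq)
      exact hact q i (hsmall q hqQ hlt i hi)
  have hexp : ∀ f : ℕ+ →₀ ℝ, pairing f (∑ i ∈ E, a i • v i) =
      a j * pairing f (v j) + ∑ i ∈ E.erase j, a i * pairing f (v i) := by
    intro f
    rw [pairing_sum_right, ← Finset.add_sum_erase _ _ hjE, pairing_smul]
    simp_rw [pairing_smul]
  have hsum : ∑ i ∈ E.erase j, a i * pairing (∑ q ∈ Q, α q) (v i) =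
      ∑ i ∈ E.erase j, a i * pairing (α q₁) (v i) + ∑ i ∈ E.erase j, a i * pairing g (v i) := by
    rw [← Finset.sum_add_distrib]
    refine Finset.sum_congr rfl fun i hi => ?_
    rw [hsplit i (Finset.mem_of_mem_erase hi), mul_add]
  rw [hexp, hsum]
  by_cases hq₁only : ∀ i ∈ E.erase j, ¬ act q₁ i
  · rw [Finset.sum_eq_zero (f := fun i => a i * pairing (α q₁) (v i))
      fun i hi => by rw [hact q₁ i (hq₁only i hi), mul_zero], zero_add]
    have h1 : |a j * pairing (∑ q ∈ Q, α q) (v j)| ≤ 1 := by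
      rw [abs_mul]
      exact mul_le_one₀ (h.abs_le_one j (hE hjE)) (abs_nonneg _)
        ((abs_pairing_le_nrm (hQ'.sum_mem (regular_of_levels hL.regular hL.mem_iff)) _).trans
          (h.nrm_le_one j))
    have h2 : η ≤ (E.card + 1) * η := by
      have : 0 ≤ E.card * η := by positivity
      linarith
    exact (abs_add_le _ _).trans (by linarith)
  · push Not at hq₁only
    obtain ⟨i, hi, hqi⟩ := hq₁only
    obtain ⟨y, hyα, hyv⟩ := Finset.not_disjoint_iff.1 hqi
    have hji : j < i := lt_of_le_of_ne
      (hjmin i (Finset.mem_filter.2 ⟨Finset.mem_of_mem_erase hi, q₁, hq₁Q, hqi⟩))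
      (Finset.ne_of_mem_erase hi).symm
    have hgj : pairing g (v j) = 0 := by
      simp only [g]
      rw [pairing_sum_left]
      refine Finset.sum_eq_zero fun q hq => hact q j fun hqj => ?_
      obtain ⟨hqQ, hlt⟩ := Finset.mem_filter.1 hq
      obtain ⟨z, hzα, hzv⟩ := Finset.not_disjoint_iff.1 hqj
      exact lt_asymm (hQ'.before q₁ hq₁Q q hqQ hlt y hyα z hzα) (h.successive j i hji z hzv y hyv)
    rw [hsplit j hjE, hgj, add_zero, ← add_assoc, ← hexp]
    have h1 := h.average_bound (hQ.average q₁ hq₁Q) hE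
    refine (abs_add_le _ _).trans ?_
    linarith

theorem bound (hL : IsLevels 𝓕 𝓖) (h : CZeroData 𝓕 𝓖 v p δ E₀ η a) :
    nrm 𝓕 (∑ i ∈ E₀, a i • v i) ≤ 1 + (E₀.card + 1) * η := by
  have hη := h.eta_nonneg
  refine nrm_le fun f hf => (le_abs_self _).trans ?_
  have hsingle : ∀ n (c : ℝ), Finsupp.single n c ∈ normingSetZero 𝓕 → ∀ E ⊆ E₀,
      |pairing (Finsupp.single n c) (∑ i ∈ E, a i • v i)| ≤ 1 + (E.card + 1) * η := by
    intro n c hf E hE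
    refine (h.abs_le_one_of_card hf hE (Finset.card_le_one.2 ?_)).trans
      (by have : 0 ≤ (E.card + 1) * η := by positivity
          linarith)
    have hmem : ∀ i ∈ E.filter fun i => ¬ Disjoint (Finsupp.single n c).support (v i).support,
        n ∈ (v i).support := by
      intro i hi
      obtain ⟨y, hy, hyv⟩ := Finset.not_disjoint_iff.1 (Finset.mem_filter.1 hi).2
      rwa [← Finset.mem_singleton.1 (Finsupp.support_single_subset hy)]
    intro i hi j hj
    by_contra hij
    exact Finset.disjoint_left.1 (h.successive.disjoint hij) (hmem i hi) (hmem j hj)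
  exact normingSetZero_induction
    (P := fun f => ∀ E ⊆ E₀, |pairing f (∑ i ∈ E, a i • v i)| ≤ 1 + (E.card + 1) * η)
    (fun E _ => by rw [pairing_zero_left, abs_zero]; positivity)
    (fun n => hsingle n 1 (normingSet_subset (single_mem_normingSet 𝓕 n)))
    (fun n => hsingle n (-1) (normingSet_subset (Set.mem_iUnion.2 ⟨0, n, Or.inr rfl⟩)))
    (fun s f hf E hE => (h.average_bound hf hE).trans (by linarith))
    (fun Q α s hQ E hE => h.sum_bound hL hQ hE) hf E₀ subset_rfl

end CZeroData

theorem exists_cZero_subsequence (hL : GoodLevels 𝓕 𝓖) {u : ℕ+ → ℕ+ →₀ ℝ}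
    (hu : Successive fun i => (u i).support) (hn : ∀ i, nrm 𝓕 (u i) = 1)
    (h0 : IndexZero 𝓕 𝓖 u) {ε : ℝ} (hε : 0 < ε) :
    ∃ M : ℕ+ → ℕ+, StrictMono M ∧ ∀ E ∈ schreierOne, ∀ a : ℕ+ → ℝ, (∀ i ∈ E, |a i| ≤ 1) →
      nrm 𝓕 (∑ i ∈ E, a i • u (M i)) ≤ 1 + ε := by
  -- If E ∈ 𝓢₁ has least element i₁, then |E| ≤ i₁ and 2|E|δᵢ ≤ 2i₁δ_{i₁} = ε/(i₁+1) for i ∈ E. With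
  -- this value as η, (|E|+1)η ≤ ε.
  let δ : ℕ+ → ℝ := fun i => ε / (2 * i * (i + 1))
  have hi0 : ∀ i : ℕ+, (0 : ℝ) < i := fun i => by exact_mod_cast i.pos
  have hδ : ∀ i, 0 < δ i := fun i => by have := hi0 i; positivity
  have hδm : ∀ i j, i ≤ j → δ j ≤ δ i := by
    intro i j hij
    have := hi0 i
    have : (i : ℝ) ≤ j := by exact_mod_cast hij
    simp only [δ]
    gcongr
  choose K hK using fun n i => h0 n (δ i) (hδ i)
  obtain ⟨L, hLm, hLB⟩ := exists_strictMono_bound fun x => max (K 1 x) (K ((u x).support.sup id) x)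
  -- The shift by one serves `average_le`, which includes i = j: it gives K 1 (L i) ≤ M i.
  let M : ℕ+ → ℕ+ := fun i => L (i + 1)
  have hM : StrictMono M := fun i j hij => hLm (add_lt_add_left hij 1)
  have hne : ∀ i, (u i).support.Nonempty := by
    intro i
    rw [Finsupp.support_nonempty_iff]
    intro h
    have := hn i
    rw [nrm_eq_zero.2 h] at this
    exact zero_ne_one this
  have hKA : ∀ i, K 1 (L i) ≤ M i := fun i =>
    (le_max_left _ _).trans (hLB i (i + 1) (PNat.lt_add_right i 1)).le
  have hKB : ∀ i j, i < j → K ((u (M i)).support.sup id) (M i) ≤ M j := fun i j hij =>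
    (le_max_right _ _).trans (hLB (i + 1) (j + 1) (add_lt_add_left hij 1)).le
  refine ⟨M, hM, fun E hE a ha => ?_⟩
  rcases E.eq_empty_or_nonempty with rfl | hEne
  · rw [Finset.sum_empty, nrm_eq_zero.2 rfl]; linarith
  obtain ⟨i₁, hi₁, hmin⟩ : ∃ i₁ ∈ E, ∀ i ∈ E, i₁ ≤ i :=
    ⟨_, Finset.min'_mem _ hEne, fun i hi => Finset.min'_le _ i hi⟩
  have hcard : (E.card : ℝ) ≤ i₁ := by exact_mod_cast hE i₁ hi₁
  have hi₁0 := hi0 i₁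
  have hdata : CZeroData 𝓕 𝓖 (fun i => u (M i)) M δ E (ε / (i₁ + 1)) a := by
    refine ⟨hu.comp hM, fun i => (hn _).le, fun i => le_of_mem_successive hu hne (M i), ?_, ?_,
      fun i => (hδ i).le, by positivity, fun i hi => ?_, ha⟩
    · intro i j hij f s hf hs
      have := hK 1 (L i) (M j) ((hKA i).trans (hM.monotone hij)) {0} (fun _ => f) (fun _ => s)
        (IsFastSeq.singleton hf (hL.singleton_mem 1 1)) ?_
      · rw [Finset.sum_singleton] at this
        exact this.trans (hδm _ _ hLm.le_apply)
      · intro _ _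
        exact le_trans (by exact_mod_cast hKA i) hs
    · intro i j hij Q α s hQ hs
      refine (hK _ (M i) (M j) (hKB i j hij) Q α s hQ fun q hq => ?_).trans (hδm _ _ hM.le_apply)
      exact le_trans (by exact_mod_cast hKB i j hij) (hs q hq)
    · calc 2 * E.card * δ i ≤ 2 * i₁ * δ i₁ := by
            have h1 := hδm _ _ (hmin i hi)
            have h2 := (hδ i).le
            gcongr
        _ = ε / (i₁ + 1) := by
            simp only [δ]
            field_simp
  refine (hdata.bound hL.toIsLevels).trans ?_
  have : ((E.card : ℝ) + 1) * (ε / (i₁ + 1)) ≤ ε := by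
    rw [mul_div_assoc', div_le_iff₀ (by positivity)]
    nlinarith
  linarith

theorem indexZero_or_exists_ellOne (hL : GoodLevels 𝓕 𝓖) {u : ℕ+ → ℕ+ →₀ ℝ}
    (hu : Successive fun i => (u i).support) :
    IndexZero 𝓕 𝓖 u ∨ ∃ M : ℕ+ → ℕ+, StrictMono M ∧ ∃ c : ℝ, 0 < c ∧ ∀ E ∈ 𝓕, ∀ a : ℕ+ → ℝ,
      c * ∑ i ∈ E, |a i| ≤ nrm 𝓕 (∑ i ∈ E, a i • u (M i)) := by
  by_cases h : IndexZero 𝓕 𝓖 u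
  · exact Or.inl h
  · right
    unfold IndexZero at h
    push Not at h
    obtain ⟨n, δ, hδ, h⟩ := h
    obtain ⟨M, hM, hME⟩ := exists_ellOne_subsequence hL hu hδ n fun K => by
      obtain ⟨k, hk, Q, α, s, h1, h2, h3⟩ := h K
      exact ⟨k, hk, Q, α, s, h1, h2, h3.le⟩
    exact ⟨M, hM, δ, hδ, hME⟩

variable {𝓕 : Set (Finset ℕ+)} {𝓖 : ℕ+ → Set (Finset ℕ+)}

/-! ### Sums over the members of a `c₀` sequence -/

theorem support_sum_smul_subset {v : ℕ+ → ℕ+ →₀ ℝ} (E : Finset ℕ+) (a : ℕ+ → ℝ) :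
    (∑ j ∈ E, a j • v j).support ⊆ E.biUnion fun j => (v j).support := by
  classical
  intro k hk
  obtain ⟨j, hj, hk⟩ := Finset.mem_biUnion.1 (Finsupp.support_finsetSum hk)
  exact Finset.mem_biUnion.2 ⟨j, hj, Finsupp.support_smul hk⟩

theorem Successive.sum_smul {v : ℕ+ → ℕ+ →₀ ℝ} (hv : Successive fun i => (v i).support)
    {E : ℕ+ → Finset ℕ+} (hE : Successive E) (a : ℕ+ → ℕ+ → ℝ) :
    Successive fun i => (∑ j ∈ E i, a i j • v j).support := by
  intro i j hij x hx y hy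
  obtain ⟨k, hk, hx⟩ := Finset.mem_biUnion.1 (support_sum_smul_subset _ _ hx)
  obtain ⟨l, hl, hy⟩ := Finset.mem_biUnion.1 (support_sum_smul_subset _ _ hy)
  exact hv k l (hE i j hij k hk l hl) x hx y hy

theorem strictMono_sup_support {v : ℕ+ → ℕ+ →₀ ℝ} (hv : Successive fun i => (v i).support)
    (hne : ∀ i, (v i).support.Nonempty) : StrictMono fun j => (v j).support.sup id := by
  intro i j hij
  obtain ⟨x, hx⟩ := hne i
  obtain ⟨y, hy⟩ := hne j
  have hlt : (v i).support.sup id < y :=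
    (Finset.sup_lt_iff (lt_of_le_of_lt bot_le (hv i j hij x hx y hy))).2
      fun z hz => hv i j hij z hz y hy
  exact hlt.trans_le (Finset.le_sup (f := id) hy)

/-- The average of |F| almost norming functionals has size |F| and acts by at least 1/2 on the sum
over F. A single average is admissible for every level, and |F| → ∞ makes the sizes as large as
required. -/
theorem exists_ellOne_of_sums (hL : GoodLevels 𝓕 𝓖) {v : ℕ+ → ℕ+ →₀ ℝ}
    (hv : Successive fun i => (v i).support) (hn : ∀ i, nrm 𝓕 (v i) = 1)
    {F : ℕ+ → Finset ℕ+} (hF : Successive F)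
    (hcard : Filter.Tendsto (fun i => (F i).card) Filter.atTop Filter.atTop) :
    ∃ N : ℕ+ → ℕ+, StrictMono N ∧ ∀ E ∈ 𝓕, ∀ a : ℕ+ → ℝ,
      1 / 2 * ∑ i ∈ E, |a i| ≤ nrm 𝓕 (∑ i ∈ E, a i • ∑ j ∈ F (N i), v j) := by
  have h𝓕 := hL.regular_family
  have hsucc : Successive fun i => (∑ j ∈ F i, v j).support := by
    simpa using hv.sum_smul hF fun _ _ => 1
  refine exists_ellOne_subsequence hL hsucc (by norm_num) 1 fun K => ?_
  obtain ⟨k, hk, hKk⟩ := ((hcard.eventually_ge_atTop (max K 2)).and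
    (Filter.eventually_ge_atTop K)).exists
  have hf : ∀ j, ∃ f ∈ normingSetZero 𝓕, f.support ⊆ (v j).support ∧ 1 / 2 < pairing f (v j) :=
    fun j => exists_lt_pairing h𝓕 (by rw [hn]; norm_num)
  choose f hfW hfs hfv using hf
  have hc2 : 2 ≤ (F k).card := (le_max_right _ _).trans hk
  have hc0 : (0 : ℝ) < (F k).card := by exact_mod_cast (by omega : 0 < (F k).card)
  have hav : AverageOf (normingSetZero 𝓕) (F k).card (((F k).card : ℝ)⁻¹ • ∑ j ∈ F k, f j) :=
    AverageOf.of_finset hc2 _ _ le_rfl (fun j _ => hfW j)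
      fun i _ j _ hij => (hv i j hij).mono (hfs i) (hfs j)
  refine ⟨k, hKk, {0}, fun _ => ((F k).card : ℝ)⁻¹ • ∑ j ∈ F k, f j, fun _ => (F k).card,
    IsFastSeq.singleton hav (hL.singleton_mem 1 1), fun _ _ => (le_max_left _ _).trans hk, ?_⟩
  rw [Finset.sum_singleton]
  refine le_trans ?_ (le_abs_self _)
  rw [pairing_smul_left, pairing_sum_left, le_inv_mul_iff₀ hc0]
  calc ((F k).card : ℝ) * (1 / 2) = ∑ _j ∈ F k, (1 / 2 : ℝ) := by
        rw [Finset.sum_const, nsmul_eq_mul]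
    _ ≤ _ := Finset.sum_le_sum fun j hj => ?_
  rw [pairing_sum_right, Finset.sum_eq_single_of_mem j hj]
  · exact (hfv j).le
  · intro i _ hij
    exact pairing_eq_zero (Finset.disjoint_of_subset_left (hfs j) (hv.disjoint hij.symm))

/-! ### Convex combinations of an `ℓ₁` sequence -/

/-- The vectors `v j`, `j ∈ E`, that are the first ones met by `f`. -/
def firstMet (v : ℕ+ → ℕ+ →₀ ℝ) (E : Finset ℕ+) (f : ℕ+ →₀ ℝ) : Finset ℕ+ :=
  E.filter fun j => ¬ Disjoint f.support (v j).support ∧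
    ∀ i ∈ E, i < j → Disjoint f.support (v i).support

/-- The vectors `v j`, `j ∈ E`, met by `f` after some other one. -/
def laterMet (v : ℕ+ → ℕ+ →₀ ℝ) (E : Finset ℕ+) (f : ℕ+ →₀ ℝ) : Finset ℕ+ :=
  E.filter fun j => ¬ Disjoint f.support (v j).support ∧
    ∃ i ∈ E, i < j ∧ ¬ Disjoint f.support (v i).support

section Met

variable {v : ℕ+ → ℕ+ →₀ ℝ} {E : Finset ℕ+}

theorem firstMet_subset (f : ℕ+ →₀ ℝ) : firstMet v E f ⊆ E := Finset.filter_subset _ _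

theorem laterMet_subset (f : ℕ+ →₀ ℝ) : laterMet v E f ⊆ E := Finset.filter_subset _ _

theorem eq_of_mem_firstMet {f : ℕ+ →₀ ℝ} {i j : ℕ+} (hi : i ∈ firstMet v E f)
    (hj : j ∈ firstMet v E f) : i = j := by
  obtain ⟨hiE, hi1, hi2⟩ := Finset.mem_filter.1 hi
  obtain ⟨hjE, hj1, hj2⟩ := Finset.mem_filter.1 hj
  rcases lt_trichotomy i j with h | h | h
  · exact absurd (hj2 i hiE h) hi1
  · exact h
  · exact absurd (hi2 j hjE h) hj1

theorem sum_eq_firstMet_add_laterMet (f : ℕ+ →₀ ℝ) (w : ℕ+ → ℝ)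
    (hw : ∀ j ∈ E, Disjoint f.support (v j).support → w j = 0) :
    ∑ j ∈ E, w j = ∑ j ∈ firstMet v E f, w j + ∑ j ∈ laterMet v E f, w j := by
  classical
  rw [← Finset.sum_union]
  · refine (Finset.sum_subset (Finset.union_subset (firstMet_subset f) (laterMet_subset f)) ?_).symm
    intro j hj hj'
    rw [Finset.mem_union, not_or] at hj'
    by_contra hw0
    have hact : ¬ Disjoint f.support (v j).support := fun hd => hw0 (hw j hj hd)
    by_cases hex : ∃ i ∈ E, i < j ∧ ¬ Disjoint f.support (v i).support
    · exact hj'.2 (Finset.mem_filter.2 ⟨hj, hact, hex⟩)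
    · push Not at hex
      exact hj'.1 (Finset.mem_filter.2 ⟨hj, hact, hex⟩)
  · rw [Finset.disjoint_left]
    intro j h1 h2
    obtain ⟨-, -, i, hi, hij, hd⟩ := Finset.mem_filter.1 h2
    exact hd ((Finset.mem_filter.1 h1).2.2 i hi hij)

/-- If g meets some vᵢ before vⱼ, then the support of f ends before a point of supp vᵢ, hence before
vⱼ begins. -/
theorem disjoint_laterMet (hv : Successive fun i => (v i).support) {f g : ℕ+ →₀ ℝ}
    (h : Before f.support g.support) : Disjoint (laterMet v E f) (laterMet v E g) := by
  rw [Finset.disjoint_left]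
  intro j h1 h2
  obtain ⟨x, hxf, hxv⟩ := Finset.not_disjoint_iff.1 (Finset.mem_filter.1 h1).2.1
  obtain ⟨-, -, i, -, hij, hd⟩ := Finset.mem_filter.1 h2
  obtain ⟨y, hyg, hyv⟩ := Finset.not_disjoint_iff.1 hd
  exact lt_asymm (h x hxf y hyg) (hv i j hij y hyv x hxv)

theorem sum_laterMet_le {ι : Type} [LinearOrder ι] (hv : Successive fun i => (v i).support)
    {a : ℕ+ → ℝ} (ha : ∀ i, 0 ≤ a i) {R : Finset ι} {g : ι → ℕ+ →₀ ℝ}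
    (hg : ∀ i ∈ R, ∀ j ∈ R, i < j → Before (g i).support (g j).support) :
    ∑ r ∈ R, ∑ j ∈ laterMet v E (g r), a j ≤ ∑ j ∈ E, a j := by
  classical
  rw [← Finset.sum_biUnion]
  · exact Finset.sum_le_sum_of_subset_of_nonneg
      (Finset.biUnion_subset.2 fun r _ => laterMet_subset _) fun i _ _ => ha i
  · intro i hi j hj hij
    rcases lt_or_gt_of_ne hij with h | h
    · exact disjoint_laterMet hv (hg i hi j hj h)
    · exact (disjoint_laterMet hv (hg j hj i hi h)).symm

/-- The first vector met by a summand costs at most m, and averaging d ≤ s such costs gives m. The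
later vectors of different summands are disjoint sets, so together they carry at most the whole
mass, divided by s. -/
theorem abs_sum_average_le (hv : Successive fun i => (v i).support) (hn : ∀ i, nrm 𝓕 (v i) ≤ 1)
    {a : ℕ+ → ℝ} (ha : ∀ i, 0 ≤ a i) {m : ℝ} (hm : ∀ i ∈ E, a i ≤ m) (hm0 : 0 ≤ m) {s : ℕ}
    {f : ℕ+ →₀ ℝ} (hf : AverageOf (normingSetZero 𝓕) s f) :
    |∑ j ∈ E, a j * pairing f (v j)| ≤ m + (s : ℝ)⁻¹ * ∑ j ∈ E, a j := by
  obtain ⟨hs, d, g, hd, hg, hB, rfl⟩ := hf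
  have hs0 : (0 : ℝ) < s := by exact_mod_cast (by omega : 0 < s)
  have h1 : ∀ r j, |a j * pairing (g r) (v j)| ≤ a j := fun r j => by
    rw [abs_mul, abs_of_nonneg (ha j)]
    exact mul_le_of_le_one_right (ha j) ((abs_pairing_le_nrm (hg r) _).trans (hn j))
  have h2 : ∀ r, |∑ j ∈ E, a j * pairing (g r) (v j)| ≤ m + ∑ j ∈ laterMet v E (g r), a j := by
    intro r
    rw [sum_eq_firstMet_add_laterMet (v := v) (g r) _
      fun j _ hd => by rw [pairing_eq_zero hd, mul_zero]]
    refine (abs_add_le _ _).trans (add_le_add ?_ ?_)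
    · rcases (firstMet v E (g r)).eq_empty_or_nonempty with h0 | ⟨i, hi⟩
      · rw [h0, Finset.sum_empty, abs_zero]; exact hm0
      · have : firstMet v E (g r) = {i} := Finset.eq_singleton_iff_unique_mem.2
          ⟨hi, fun j hj => eq_of_mem_firstMet hj hi⟩
        rw [this, Finset.sum_singleton]
        exact (h1 r i).trans (hm i (firstMet_subset _ hi))
    · exact (Finset.abs_sum_le_sum_abs _ _).trans (Finset.sum_le_sum fun j _ => h1 r j)
  have h3 : ∑ j ∈ E, a j * pairing ((s : ℝ)⁻¹ • ∑ i, g i) (v j) =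
      (s : ℝ)⁻¹ * ∑ r, ∑ j ∈ E, a j * pairing (g r) (v j) := by
    rw [Finset.sum_comm, Finset.mul_sum]
    refine Finset.sum_congr rfl fun j _ => ?_
    rw [pairing_smul_left, pairing_sum_left, ← Finset.mul_sum]
    ring
  rw [h3, abs_mul, abs_of_pos (inv_pos.2 hs0), inv_mul_le_iff₀ hs0, mul_add,
    mul_inv_cancel_left₀ hs0.ne']
  refine (Finset.abs_sum_le_sum_abs _ _).trans ((Finset.sum_le_sum fun r _ => h2 r).trans ?_)
  rw [Finset.sum_add_distrib, Finset.sum_const, Finset.card_univ, Fintype.card_fin, nsmul_eq_mul]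
  refine add_le_add (mul_le_mul_of_nonneg_right (by exact_mod_cast hd) hm0) ?_
  exact sum_laterMet_le hv ha fun i _ j _ => hB i j

/-- After restriction to the support of x the minima lie beyond n, where admissibility for 𝓖ₙ
implies admissibility for 𝓕. -/
theorem sum_abs_pairing_le_nrm (hL : IsLevels 𝓕 𝓖) {n : ℕ+} {Q : Finset ℕ} {α : ℕ → ℕ+ →₀ ℝ}
    {s : ℕ → ℕ} (h : IsFastSeq (normingSetZero 𝓕) (𝓖 n) Q α s) {x : ℕ+ →₀ ℝ}
    (hx : ∀ k ∈ x.support, n ≤ k) : ∑ q ∈ Q, |pairing (α q) x| ≤ nrm 𝓕 x := by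
  classical
  have h𝓕 := regular_of_levels hL.regular hL.mem_iff
  obtain ⟨Q', β, μ, -, h1, h2, h3, h4, h5, h6⟩ := h.exists_supported h𝓕 (hL.regular n) x
  rw [← h6, ← pairing_sum_left]
  refine (le_abs_self _).trans (abs_pairing_le_nrm (IsFastSeq.sum_mem (s := s) ?_ h𝓕) x)
  refine { h1 with mins := ⟨μ, h4, (hL.mem_iff _).2 ⟨n, fun k hk => ?_, h5⟩, fun q hq => (h3 q hq).2⟩ }
  obtain ⟨q, hq, rfl⟩ := Finset.mem_image.1 hk
  exact hx _ (h2 q hq (h3 q hq).1)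

/-- The action of each average is split into the first vector it meets and the later ones. The first
vectors carry mass at most δ. On the later ones, each average costs its largest coefficient there
plus 1/S times their mass; the largest coefficients again add up to at most δ, and the masses to at
most 1. -/
theorem sum_abs_pairing_convex_le (hL : IsLevels 𝓕 𝓖) (hv : Successive fun i => (v i).support)
    (hn : ∀ i, nrm 𝓕 (v i) ≤ 1) {n : ℕ+} (hvn : ∀ j ∈ E, ∀ k ∈ (v j).support, n ≤ k)
    (hne : ∀ i, (v i).support.Nonempty)
    {a : ℕ+ → ℝ} (ha : ∀ i, 0 ≤ a i) (ha1 : ∑ i ∈ E, a i = 1) {δ : ℝ}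
    (hmass : ∀ G ⊆ E, (G.image fun j => (v j).support.sup id) ∈ 𝓖 n → ∑ i ∈ G, a i ≤ δ)
    {Q : Finset ℕ} {α : ℕ → ℕ+ →₀ ℝ} {s : ℕ → ℕ}
    (h : IsFastSeq (normingSetZero 𝓕) (𝓖 n) Q α s) {S : ℕ} (hS0 : 0 < S) (hS : ∀ q ∈ Q, S ≤ s q) :
    ∑ q ∈ Q, |pairing (α q) (∑ j ∈ E, a j • v j)| ≤ 2 * δ + (S : ℝ)⁻¹ := by
  classical
  have hS0' : (0 : ℝ) < S := by exact_mod_cast hS0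
  have htm := strictMono_sup_support hv hne
  -- When different vectors of G are met by different averages, the lower bounds φ(κ j) are
  -- admissible for 𝓖ₙ and at most max supp vⱼ. Regularity then puts the image of G into 𝓖ₙ.
  have hspread : ∀ (G : Finset ℕ+) (κ : ℕ+ → ℕ), G ⊆ E → (∀ j ∈ G, κ j ∈ Q) →
      (∀ j ∈ G, ¬ Disjoint (α (κ j)).support (v j).support) → Set.InjOn κ G →
      ∑ i ∈ G, a i ≤ δ := by
    intro G κ hG hκ hact hinj
    have hκm : StrictMonoOn κ G := by
      intro i hi j hj hij
      refine lt_of_le_of_ne (not_lt.1 fun hlt => ?_) fun heq => hij.ne (hinj hi hj heq)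
      obtain ⟨x, hxα, hxv⟩ := Finset.not_disjoint_iff.1 (hact i hi)
      obtain ⟨y, hyα, hyv⟩ := Finset.not_disjoint_iff.1 (hact j hj)
      exact lt_asymm (h.before _ (hκ j hj) _ (hκ i hi) hlt y hyα x hxα) (hv i j hij x hxv y hyv)
    obtain ⟨φ, h1, h2, h3⟩ := h.mins
    refine hmass G hG ((hL.regular n).subset_image h2 (φ := fun j => φ (κ j))
      (fun j hj => Finset.mem_image_of_mem _ (hκ j hj))
      (fun i hi j hj hij => h1 (hκ i hi) (hκ j hj) (hκm hi hj hij)) (htm.strictMonoOn _) ?_)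
    intro j hj
    obtain ⟨x, hxα, hxv⟩ := Finset.not_disjoint_iff.1 (hact j hj)
    exact (h3 _ (hκ j hj) x hxα).trans (Finset.le_sup (f := id) hxv)
  have hfirst : ∑ q ∈ Q, ∑ j ∈ firstMet v E (α q), a j * |pairing (α q) (v j)| ≤ δ := by
    let G := E.filter fun j => ∃ q ∈ Q, j ∈ firstMet v E (α q)
    have hκ : ∀ j ∈ G, ∃ q ∈ Q, j ∈ firstMet v E (α q) := fun j hj => (Finset.mem_filter.1 hj).2
    choose! κ hκQ hκf using hκ
    refine le_trans ?_ (hspread G κ (Finset.filter_subset _ _) hκQ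
      (fun j hj => (Finset.mem_filter.1 (hκf j hj)).2.1) fun i hi j hj hij =>
        eq_of_mem_firstMet (hκf i hi) (hij ▸ hκf j hj))
    have hcomm : ∑ q ∈ Q, ∑ j ∈ firstMet v E (α q), a j * |pairing (α q) (v j)| =
        ∑ j ∈ G, ∑ q ∈ Q.filter fun q => j ∈ firstMet v E (α q), a j * |pairing (α q) (v j)| := by
      refine Finset.sum_comm' fun q j => ?_
      simp only [G, Finset.mem_filter]
      exact ⟨fun hh => ⟨⟨hh.1, hh.2⟩, firstMet_subset _ hh.2, q, hh.1, hh.2⟩, fun hh => hh.1⟩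
    rw [hcomm]
    refine Finset.sum_le_sum fun j hj => ?_
    rw [← Finset.mul_sum]
    refine mul_le_of_le_one_right (ha j) ?_
    -- Several averages may share the first vector vⱼ; together they act on it by at most its norm.
    exact (sum_abs_pairing_le_nrm hL (h.subset (hL.regular n) (Finset.filter_subset _ _))
      (hvn j (Finset.filter_subset _ _ hj))).trans (hn j)
  have hlater : ∑ q ∈ Q, |∑ j ∈ laterMet v E (α q), a j * pairing (α q) (v j)| ≤
      δ + (S : ℝ)⁻¹ := by
    have hmax : ∀ q, ∃ j, (laterMet v E (α q)).Nonempty →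
        j ∈ laterMet v E (α q) ∧ ∀ i ∈ laterMet v E (α q), a i ≤ a j := by
      intro q
      by_cases hq : (laterMet v E (α q)).Nonempty
      · obtain ⟨j, hj, hj'⟩ := Finset.exists_max_image _ a hq
        exact ⟨j, fun _ => ⟨hj, hj'⟩⟩
      · exact ⟨1, fun hh => absurd hh hq⟩
    choose κ hκ using hmax
    let R := Q.filter fun q => (laterMet v E (α q)).Nonempty
    have hRκ : ∀ q ∈ R, κ q ∈ laterMet v E (α q) ∧ ∀ i ∈ laterMet v E (α q), a i ≤ a (κ q) :=
      fun q hq => hκ q (Finset.mem_filter.1 hq).2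
    have hRQ : R ⊆ Q := Finset.filter_subset _ _
    have hinj : Set.InjOn κ R := by
      intro p hp q hq hpq
      by_contra hne
      have h1 := (hRκ p hp).1
      have h2 := hpq ▸ (hRκ q hq).1
      rcases lt_or_gt_of_ne hne with hlt | hlt
      · exact Finset.disjoint_left.1
          (disjoint_laterMet hv (h.before p (hRQ hp) q (hRQ hq) hlt)) h1 h2
      · exact Finset.disjoint_left.1
          (disjoint_laterMet hv (h.before q (hRQ hq) p (hRQ hp) hlt)) h2 h1
    have hinv : ∀ q ∈ R, Function.invFunOn κ R (κ q) = q := fun q hq =>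
      hinj.leftInvOn_invFunOn hq
    have hmaxsum : ∑ q ∈ R, a (κ q) ≤ δ := by
      rw [← Finset.sum_image (g := κ) (f := a) hinj]
      refine hspread _ (Function.invFunOn κ R) (fun j hj => ?_) (fun j hj => ?_) (fun j hj => ?_)
        fun i hi j hj hij => ?_
      · obtain ⟨q, hq, rfl⟩ := Finset.mem_image.1 hj
        exact laterMet_subset _ (hRκ q hq).1
      · obtain ⟨q, hq, rfl⟩ := Finset.mem_image.1 hj
        rw [hinv q hq]
        exact hRQ hq
      · obtain ⟨q, hq, rfl⟩ := Finset.mem_image.1 hj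
        rw [hinv q hq]
        exact (Finset.mem_filter.1 (hRκ q hq).1).2.1
      · obtain ⟨q, hq, rfl⟩ := Finset.mem_image.1 (Finset.mem_coe.1 hi)
        obtain ⟨p, hp, rfl⟩ := Finset.mem_image.1 (Finset.mem_coe.1 hj)
        rw [hinv q hq, hinv p hp] at hij
        rw [hij]
    have hred : ∑ q ∈ Q, |∑ j ∈ laterMet v E (α q), a j * pairing (α q) (v j)| =
        ∑ q ∈ R, |∑ j ∈ laterMet v E (α q), a j * pairing (α q) (v j)| := by
      rw [Finset.sum_filter_of_ne]
      intro q _ hq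
      by_contra h0
      rw [Finset.not_nonempty_iff_eq_empty.1 h0, Finset.sum_empty, abs_zero] at hq
      exact hq rfl
    rw [hred]
    calc ∑ q ∈ R, |∑ j ∈ laterMet v E (α q), a j * pairing (α q) (v j)|
        ≤ ∑ q ∈ R, (a (κ q) + (S : ℝ)⁻¹ * ∑ j ∈ laterMet v E (α q), a j) := by
          refine Finset.sum_le_sum fun q hq => ?_
          refine (abs_sum_average_le hv hn ha (hRκ q hq).2 (ha _)
            (h.average q (hRQ hq))).trans ?_
          refine add_le_add le_rfl (mul_le_mul_of_nonneg_right ?_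
            (Finset.sum_nonneg fun i _ => ha i))
          exact inv_anti₀ hS0' (by exact_mod_cast hS q (hRQ hq))
      _ = ∑ q ∈ R, a (κ q) + (S : ℝ)⁻¹ * ∑ q ∈ R, ∑ j ∈ laterMet v E (α q), a j := by
          rw [Finset.sum_add_distrib, Finset.mul_sum]
      _ ≤ δ + (S : ℝ)⁻¹ * 1 := by
          refine add_le_add hmaxsum (mul_le_mul_of_nonneg_left ?_ (by positivity))
          rw [← ha1]
          exact sum_laterMet_le hv ha fun p hp q hq => h.before p (hRQ hp) q (hRQ hq)
      _ = δ + (S : ℝ)⁻¹ := by rw [mul_one]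
  have hsplit : ∀ q ∈ Q, |pairing (α q) (∑ j ∈ E, a j • v j)| ≤
      ∑ j ∈ firstMet v E (α q), a j * |pairing (α q) (v j)| +
        |∑ j ∈ laterMet v E (α q), a j * pairing (α q) (v j)| := by
    intro q _
    rw [pairing_sum_right]
    simp_rw [pairing_smul]
    rw [sum_eq_firstMet_add_laterMet (v := v) (α q) _
      fun j _ hd => by rw [pairing_eq_zero hd, mul_zero]]
    refine (abs_add_le _ _).trans (add_le_add ?_ le_rfl)
    refine (Finset.abs_sum_le_sum_abs _ _).trans (Finset.sum_le_sum fun j _ => ?_)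
    rw [abs_mul, abs_of_nonneg (ha j)]
  refine (Finset.sum_le_sum hsplit).trans ?_
  rw [Finset.sum_add_distrib]
  linarith

end Met

/-- The lower estimate keeps the norms of the convex combinations at least c, so normalizing costs a
factor 1/c at most, and the normalized vectors have index zero. -/
theorem exists_cZero_of_ellOne (hL : GoodLevels 𝓕 𝓖) {v : ℕ+ → ℕ+ →₀ ℝ}
    (hv : Successive fun i => (v i).support) (hn : ∀ i, nrm 𝓕 (v i) = 1) {c : ℝ} (hc : 0 < c)
    (hlow : ∀ E ∈ 𝓕, ∀ a : ℕ+ → ℝ, c * ∑ i ∈ E, |a i| ≤ nrm 𝓕 (∑ i ∈ E, a i • v i))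
    {ε : ℝ} (hε : 0 < ε) :
    ∃ (E : ℕ+ → Finset ℕ+) (b : ℕ+ → ℝ), Successive E ∧ (∀ i, E i ∈ 𝓕) ∧
      (∀ i, nrm 𝓕 (∑ j ∈ E i, b j • v j) = 1) ∧
      ∀ G ∈ schreierOne, ∀ a : ℕ+ → ℝ, (∀ i ∈ G, |a i| ≤ 1) →
        nrm 𝓕 (∑ i ∈ G, a i • ∑ j ∈ E i, b j • v j) ≤ 1 + ε := by
  classical
  have hne : ∀ i, (v i).support.Nonempty := by
    intro i
    rw [Finsupp.support_nonempty_iff]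
    intro h
    have := hn i
    rw [nrm_eq_zero.2 h] at this
    exact zero_ne_one this
  have htm := strictMono_sup_support hv hne
  have hK0 : ∀ K : ℕ+, (0 : ℝ) < K := fun K => by exact_mod_cast K.pos
  -- The combination with index K has mass at most 1/K on sets from level K, and by monotonicity on
  -- sets from every level n ≤ K.
  choose E hE a hEk ha ha1 hmass using fun K : ℕ+ =>
    hL.smallConvex K _ htm (K : ℝ)⁻¹ (inv_pos.2 (hK0 K)) K
  obtain ⟨L, hLm, hLB⟩ := exists_strictMono_bound fun K => (E K).sup id
  have hEL : Successive fun i => E (L i) := fun i j hij x hx y hy =>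
    (Finset.le_sup (f := id) hx).trans_lt ((hLB i j hij).trans (hEk _ y hy))
  let z : ℕ+ → ℕ+ →₀ ℝ := fun i => ∑ j ∈ E (L i), a (L i) j • v j
  have hz : ∀ i, c ≤ nrm 𝓕 (z i) := by
    intro i
    have := hlow _ (hE (L i)) (a (L i))
    rwa [Finset.sum_congr rfl fun j _ => abs_of_nonneg (ha (L i) j), ha1, mul_one] at this
  have hz0 : ∀ i, 0 < nrm 𝓕 (z i) := fun i => hc.trans_le (hz i)
  let y : ℕ+ → ℕ+ →₀ ℝ := fun i => (nrm 𝓕 (z i))⁻¹ • z i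
  have hy1 : ∀ i, nrm 𝓕 (y i) = 1 := fun i => by
    simp only [y]
    rw [nrm_smul, abs_of_pos (inv_pos.2 (hz0 i)), inv_mul_cancel₀ (hz0 i).ne']
  have hysucc : Successive fun i => (y i).support := fun i j hij =>
    (hv.sum_smul hEL (fun i => a (L i)) i j hij).mono Finsupp.support_smul Finsupp.support_smul
  have hzero : IndexZero 𝓕 𝓖 y := by
    intro n δ hδ
    -- The constant makes 2/K + 1/K ≤ cδ, where 1/K bounds both the mass and the inverse of the
    -- sizes.
    obtain ⟨K₀, hK₀⟩ := exists_nat_gt (3 / (c * δ))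
    have hcδ : 0 < c * δ := mul_pos hc hδ
    obtain ⟨K, hKn, hKK⟩ : ∃ K : ℕ+, n ≤ K ∧ (3 / (c * δ) : ℝ) < K := by
      refine ⟨n + ⟨K₀ + 1, Nat.succ_pos _⟩, (PNat.lt_add_right _ _).le, hK₀.trans ?_⟩
      have : ((n + ⟨K₀ + 1, Nat.succ_pos _⟩ : ℕ+) : ℕ) = n + (K₀ + 1) := rfl
      rw [this]
      push_cast
      have := hK0 n
      linarith
    refine ⟨K, fun k hk Q α s hQ hs => ?_⟩
    have hkL : k ≤ L k := hLm.le_apply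
    have hnL : n ≤ L k := hKn.trans (hk.trans hkL)
    have hmassn : ∀ G ⊆ E (L k), (G.image fun j => (v j).support.sup id) ∈ 𝓖 n →
        ∑ i ∈ G, a (L k) i ≤ (K : ℝ)⁻¹ := fun G hG hG' =>
      (hmass (L k) G hG (hL.mono hnL hG')).trans
        (inv_anti₀ (hK0 K) (by exact_mod_cast hk.trans hkL))
    have hest := sum_abs_pairing_convex_le hL.toIsLevels hv (fun i => (hn i).le)
      (fun j hj x hx => hnL.trans ((hEk _ j hj).le.trans (le_of_mem_successive hv hne j x hx)))
      hne (ha (L k)) (ha1 (L k)) hmassn hQ K.pos hs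
    have hterm : ∀ q ∈ Q, |pairing (α q) (y k)| = (nrm 𝓕 (z k))⁻¹ * |pairing (α q) (z k)| := by
      intro q _
      simp only [y]
      rw [pairing_smul, abs_mul, abs_of_pos (inv_pos.2 (hz0 k))]
    rw [Finset.sum_congr rfl hterm, ← Finset.mul_sum, inv_mul_le_iff₀ (hz0 k)]
    refine hest.trans ?_
    have h1 : 2 * (K : ℝ)⁻¹ + (K : ℝ)⁻¹ ≤ c * δ := by
      rw [div_lt_iff₀ hcδ] at hKK
      have : 2 * (K : ℝ)⁻¹ + (K : ℝ)⁻¹ = 3 / K := by ring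
      rw [this, div_le_iff₀ (hK0 K)]
      linarith
    exact h1.trans (mul_le_mul_of_nonneg_right (hz k) hδ.le)
  obtain ⟨M, hM, hMG⟩ := exists_cZero_subsequence hL hysucc hy1 hzero hε
  -- The sets `E (L i)` are disjoint, so the coefficients of all normalized combinations fit into
  -- one sequence.
  let b : ℕ+ → ℝ := fun j => if h : ∃ i, j ∈ E (L i) then
    (nrm 𝓕 (z h.choose))⁻¹ * a (L h.choose) j else 0
  have hb : ∀ i, ∀ j ∈ E (L i), b j = (nrm 𝓕 (z i))⁻¹ * a (L i) j := by
    intro i j hj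
    have hex : ∃ i, j ∈ E (L i) := ⟨i, hj⟩
    have hi : hex.choose = i := by
      by_contra hne
      exact Finset.disjoint_left.1 (hEL.disjoint hne) hex.choose_spec hj
    simp only [b]
    rw [dif_pos hex, hi]
  have hyb : ∀ i, ∑ j ∈ E (L i), b j • v j = y i := by
    intro i
    simp only [y, z]
    rw [Finset.smul_sum]
    refine Finset.sum_congr rfl fun j hj => ?_
    rw [hb i j hj, mul_smul]
  refine ⟨fun i => E (L (M i)), b, hEL.comp hM, fun i => hE _, fun i => ?_, fun G hG a' ha' => ?_⟩
  · rw [hyb, hy1]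
  · simp_rw [hyb]
    exact hMG G hG a' ha'

/-! ### Basic sequences -/

section Basic

variable {X : Type} [NormedAddCommGroup X] [NormedSpace ℝ X]

/-- A sequence of non-zero vectors such that dropping terms of a linear combination does not
increase its norm is basic. -/
theorem isBasicSequence_of_suppression {x : ℕ+ → X} (hx : ∀ i, x i ≠ 0)
    (h : ∀ (A B : Finset ℕ+) (a : ℕ+ → ℝ), A ⊆ B →
      ‖∑ i ∈ A, a i • x i‖ ≤ ‖∑ i ∈ B, a i • x i‖) : IsBasicSequence x := by
  classical
  set Y := (Submodule.span ℝ (Set.range x)).topologicalClosure with hY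
  have hspan : ∀ c : ℕ+ →₀ ℝ, Finsupp.linearCombination ℝ x c ∈ Y := fun c =>
    Submodule.le_topologicalClosure _ (by
      rw [← Finsupp.range_linearCombination]; exact LinearMap.mem_range_self _ c)
  let e : (ℕ+ →₀ ℝ) →ₗ[ℝ] Y := (Finsupp.linearCombination ℝ x).codRestrict Y hspan
  have he : ∀ (c : ℕ+ →₀ ℝ) (B : Finset ℕ+), c.support ⊆ B → (e c : X) = ∑ i ∈ B, c i • x i := by
    intro c B hB
    change Finsupp.linearCombination ℝ x c = _
    rw [Finsupp.linearCombination_apply, Finsupp.sum_of_support_subset c hB _ (by simp)]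
  have hdense : DenseRange e := by
    intro y
    rw [Metric.mem_closure_iff]
    intro ε hε
    have hy : (y : X) ∈ closure (Submodule.span ℝ (Set.range x) : Set X) := y.2
    obtain ⟨z, hz, hd⟩ := Metric.mem_closure_iff.1 hy ε hε
    rw [SetLike.mem_coe, ← Finsupp.range_linearCombination] at hz
    obtain ⟨c, rfl⟩ := hz
    exact ⟨e c, Set.mem_range_self c, hd⟩
  -- Dropping all terms but one bounds the i-th coordinate by ‖xᵢ‖⁻¹ times the norm, so it extends
  -- to the closed span.
  have hcoord : ∀ i, ∃ C, ∀ c : ℕ+ →₀ ℝ, ‖(Finsupp.lapply i : (ℕ+ →₀ ℝ) →ₗ[ℝ] ℝ) c‖ ≤ C * ‖e c‖ := by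
    intro i
    refine ⟨‖x i‖⁻¹, fun c => ?_⟩
    have h1 := h {i} (insert i c.support) c (by simp)
    rw [Finset.sum_singleton, norm_smul, ← he c _ (Finset.subset_insert _ _)] at h1
    rw [inv_mul_eq_div, le_div_iff₀ (norm_pos_iff.2 (hx i))]
    exact h1
  let f : ℕ+ → StrongDual ℝ Y := fun i => (Finsupp.lapply i : (ℕ+ →₀ ℝ) →ₗ[ℝ] ℝ).extendOfNorm e
  have hf : ∀ i c, f i (e c) = c i := fun i c =>
    LinearMap.extendOfNorm_eq hdense (hcoord i) c
  let b : ℕ+ → Y := fun i => e (Finsupp.single i 1)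
  have hb : ∀ i, (b i : X) = x i := fun i => by
    rw [he _ {i} Finsupp.support_single_subset]
    simp
  have hproj : ∀ (A : Finset ℕ+) (y : Y), ‖∑ i ∈ A, f i y • b i‖ ≤ ‖y‖ := by
    intro A
    refine isClosed_property hdense (isClosed_le (by fun_prop) (by fun_prop)) fun c => ?_
    change ‖((∑ i ∈ A, f i (e c) • b i : Y) : X)‖ ≤ ‖((e c : Y) : X)‖
    rw [Submodule.coe_sum, he c (A ∪ c.support) Finset.subset_union_right]
    refine le_trans (le_of_eq ?_) (h A (A ∪ c.support) c Finset.subset_union_left)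
    congr 1
    exact Finset.sum_congr rfl fun i _ => by rw [Submodule.coe_smul, hb, hf]
  refine ⟨⟨b, f, fun i j => ?_, fun y => ?_⟩, hb⟩
  · rw [hf, Finsupp.single_eq_pi_single]
    congr
  -- Convergence is shown along the net of all finite sets, which is stronger than the conditional
  -- convergence required.
  · refine Filter.Tendsto.mono_left ?_ SummationFilter.LeAtTop.le_atTop
    rw [Metric.tendsto_atTop]
    intro ε hε
    obtain ⟨_, ⟨c, rfl⟩, hd⟩ := Metric.mem_closure_iff.1 (hdense y) (ε / 2) (by positivity)
    refine ⟨c.support, fun A hA => ?_⟩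
    have h1 : ∑ i ∈ A, f i (e c) • b i = e c := by
      apply Subtype.ext
      rw [he c A hA, Submodule.coe_sum]
      exact Finset.sum_congr rfl fun i _ => by rw [Submodule.coe_smul, hb, hf]
    have h2 : ∑ i ∈ A, f i y • b i - y = ∑ i ∈ A, f i (y - e c) • b i - (y - e c) := by
      simp only [map_sub, sub_smul, Finset.sum_sub_distrib, h1]
      abel
    rw [dist_eq_norm] at hd ⊢
    rw [h2]
    have := hproj A (y - e c)
    exact (norm_sub_le _ _).trans_lt (by linarith)

end Basic

/-! ### Spreading models in the space -/

variable {Φ : FundamentalSystem} {ξ : Ordinal.{0}}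

theorem norm_of (u : ℕ+ →₀ ℝ) : ‖Space.of Φ ξ u‖ = nrm (schreier Φ (ω ^ ξ)) u :=
  UniformSpace.Completion.norm_coe _

/-- `Space.of` as a linear map. -/
noncomputable def Space.ofLinear (Φ : FundamentalSystem) (ξ : Ordinal.{0}) :
    (ℕ+ →₀ ℝ) →ₗ[ℝ] Space Φ ξ :=
  (UniformSpace.Completion.toComplL (𝕜 := ℝ)
    (E := C00 (schreier Φ (ω ^ ξ)))).toLinearMap ∘ₗ (C00.of (schreier Φ (ω ^ ξ))).toLinearMap

theorem Space.ofLinear_apply (u : ℕ+ →₀ ℝ) : Space.ofLinear Φ ξ u = Space.of Φ ξ u := rfl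

theorem norm_sum_smul_of (E : Finset ℕ+) (a : ℕ+ → ℝ) (y : ℕ+ → ℕ+ →₀ ℝ) :
    ‖∑ i ∈ E, a i • Space.of Φ ξ (y i)‖ = nrm (schreier Φ (ω ^ ξ)) (∑ i ∈ E, a i • y i) := by
  rw [← norm_of]
  simp only [← Space.ofLinear_apply, map_sum, map_smul]

/-- The supports are disjoint, so the smaller sum is a restriction of the larger one. -/
theorem nrm_sum_mono {𝓕 : Set (Finset ℕ+)} (h𝓕 : Regular 𝓕) {y : ℕ+ → ℕ+ →₀ ℝ}
    (hy : Successive fun i => (y i).support) {A B : Finset ℕ+} (a : ℕ+ → ℝ) (hAB : A ⊆ B) :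
    nrm 𝓕 (∑ i ∈ A, a i • y i) ≤ nrm 𝓕 (∑ i ∈ B, a i • y i) := by
  classical
  have : ∑ i ∈ A, a i • y i =
      restrict (A.biUnion fun i => (y i).support) (∑ i ∈ B, a i • y i) := by
    rw [restrict_sum, ← Finset.sum_subset hAB]
    · refine Finset.sum_congr rfl fun i hi => ?_
      rw [restrict_smul, restrict_eq_self (Finset.subset_biUnion_of_mem (fun i => (y i).support) hi)]
    · intro i _ hi
      rw [restrict_smul, restrict_eq_zero, smul_zero]
      rw [Finset.disjoint_biUnion_right]
      exact fun j hj => hy.disjoint fun hij => hi (hij ▸ hj)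
  rw [this]
  exact nrm_restrict_le h𝓕 _ _

theorem isBasicSequence_of (hξ : ξ < ω₁) {y : ℕ+ → ℕ+ →₀ ℝ}
    (hy : Successive fun i => (y i).support) (hne : ∀ i, 0 < nrm (schreier Φ (ω ^ ξ)) (y i)) :
    IsBasicSequence fun i => Space.of Φ ξ (y i) := by
  refine isBasicSequence_of_suppression (fun i => ?_) fun A B a hAB => ?_
  · rw [← norm_pos_iff, norm_of]
    exact hne i
  · rw [norm_sum_smul_of, norm_sum_smul_of]
    exact nrm_sum_mono (regular_schreier (omega0_opow_lt hξ)) hy a hAB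

theorem isEllOneSpreadingModel_of (hξ : ξ < ω₁) {y : ℕ+ → ℕ+ →₀ ℝ}
    (hy : Successive fun i => (y i).support) {c C : ℝ} (hc : 0 < c)
    (hC : ∀ i, nrm (schreier Φ (ω ^ ξ)) (y i) ≤ C)
    (hlow : ∀ E ∈ schreier Φ (ω ^ ξ), ∀ a : ℕ+ → ℝ,
      c * ∑ i ∈ E, |a i| ≤ nrm (schreier Φ (ω ^ ξ)) (∑ i ∈ E, a i • y i)) :
    IsEllOneSpreadingModel (schreier Φ (ω ^ ξ)) fun i => Space.of Φ ξ (y i) := by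
  have hpos : ∀ i, c ≤ nrm (schreier Φ (ω ^ ξ)) (y i) := fun i => by
    simpa using hlow {i} (singleton_mem_schreier _ (omega0_opow_lt hξ) i) fun _ => 1
  have hC0 : 0 < C := hc.trans_le ((hpos 1).trans (hC 1))
  refine ⟨max 1 (c⁻¹ * C), le_max_left _ _, isBasicSequence_of hξ hy fun i => hc.trans_le (hpos i),
    c⁻¹, C, inv_pos.2 hc, hC0, le_max_right _ _, fun E hE a => ⟨?_, ?_⟩⟩
  · rw [inv_inv, norm_sum_smul_of]
    exact hlow E hE a
  · rw [norm_sum_smul_of, Finset.mul_sum]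
    refine (nrm_sum_le _ _).trans (Finset.sum_le_sum fun i _ => ?_)
    rw [nrm_smul, mul_comm]
    exact mul_le_mul_of_nonneg_right (hC i) (abs_nonneg _)

/-- The lower estimate, with constant 1, comes from dropping all terms but one; the upper one
follows by scaling. -/
theorem isCZeroSpreadingModelWith_of (hξ : ξ < ω₁) {y : ℕ+ → ℕ+ →₀ ℝ}
    (hy : Successive fun i => (y i).support) (hn : ∀ i, nrm (schreier Φ (ω ^ ξ)) (y i) = 1)
    {ε : ℝ} (hε : 0 < ε)
    (hup : ∀ E ∈ schreierOne, ∀ a : ℕ+ → ℝ, (∀ i ∈ E, |a i| ≤ 1) →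
      nrm (schreier Φ (ω ^ ξ)) (∑ i ∈ E, a i • y i) ≤ 1 + ε) :
    IsCZeroSpreadingModelWith (1 + ε) schreierOne fun i => Space.of Φ ξ (y i) := by
  refine ⟨isBasicSequence_of hξ hy fun i => by rw [hn]; exact one_pos,
    1, 1 + ε, one_pos, by positivity, by rw [one_mul], fun E hE a => ⟨?_, ?_⟩⟩
  · rw [inv_one, one_mul, ← coe_nnnorm, NNReal.coe_le_coe]
    refine Finset.sup_le fun i hi => ?_
    rw [← NNReal.coe_le_coe, coe_nnnorm, coe_nnnorm, norm_sum_smul_of]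
    have := nrm_sum_mono (regular_schreier (Φ := Φ) (omega0_opow_lt hξ)) hy a
      (Finset.singleton_subset_iff.2 hi)
    rwa [Finset.sum_singleton, nrm_smul, hn, mul_one] at this
  · rw [norm_sum_smul_of]
    set m : ℝ≥0 := E.sup fun i => ‖a i‖₊ with hm
    have ham : ∀ i ∈ E, |a i| ≤ m := fun i hi => by
      have := Finset.le_sup (f := fun i => ‖a i‖₊) hi
      exact_mod_cast this
    rcases eq_or_ne m 0 with h0 | h0
    · have : ∑ i ∈ E, a i • y i = 0 := Finset.sum_eq_zero fun i hi => by
        have := ham i hi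
        rw [h0, NNReal.coe_zero] at this
        rw [abs_nonpos_iff.1 this, zero_smul]
      rw [this, nrm_eq_zero.2 rfl, h0]
      simp
    · have hm0 : (0 : ℝ) < m := by exact_mod_cast pos_iff_ne_zero.2 h0
      have h1 := hup E hE (fun i => (m : ℝ)⁻¹ * a i) fun i hi => by
        rw [abs_mul, abs_of_pos (inv_pos.2 hm0), inv_mul_le_iff₀ hm0, mul_one]
        exact ham i hi
      have h2 : ∑ i ∈ E, ((m : ℝ)⁻¹ * a i) • y i = (m : ℝ)⁻¹ • ∑ i ∈ E, a i • y i := by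
        rw [Finset.smul_sum]
        exact Finset.sum_congr rfl fun i _ => mul_smul _ _ _
      rw [h2, nrm_smul, abs_of_pos (inv_pos.2 hm0), inv_mul_le_iff₀ hm0] at h1
      linarith

/-- The c₀ hypothesis serves only to bound the norms of the sums; the lower ℓ₁ estimate holds for
every normalized block sequence. -/
theorem isEllOneSpreadingModel_sums (hξ : ξ < ω₁) {𝓖 : ℕ+ → Set (Finset ℕ+)}
    (hL : GoodLevels (schreier Φ (ω ^ ξ)) 𝓖) {v : ℕ+ → ℕ+ →₀ ℝ}
    (hv : Successive fun i => (v i).support) (hn : ∀ i, nrm (schreier Φ (ω ^ ξ)) (v i) = 1)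
    (hc : IsCZeroSpreadingModel schreierOne fun i => Space.of Φ ξ (v i))
    {F : ℕ+ → Finset ℕ+} (hF : Successive F) (hF1 : ∀ i, F i ∈ schreierOne)
    (hcard : Filter.Tendsto (fun i => (F i).card) Filter.atTop Filter.atTop) :
    ∃ N : ℕ+ → ℕ+, StrictMono N ∧ IsEllOneSpreadingModel (schreier Φ (ω ^ ξ))
      fun i => ∑ j ∈ F (N i), Space.of Φ ξ (v j) := by
  obtain ⟨N, hN, hlow⟩ := exists_ellOne_of_sums hL hv hn hF hcard
  refine ⟨N, hN, ?_⟩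
  have heq : (fun i => ∑ j ∈ F (N i), Space.of Φ ξ (v j)) =
      fun i => Space.of Φ ξ (∑ j ∈ F (N i), v j) := by
    funext i
    simp only [← Space.ofLinear_apply, map_sum]
  rw [heq]
  obtain ⟨K, -, -, c, C, -, hC0, -, hC⟩ := hc
  refine isEllOneSpreadingModel_of hξ (C := C) ?_ (by norm_num : (0 : ℝ) < 1 / 2) (fun i => ?_) hlow
  · simpa using hv.sum_smul (hF.comp hN) fun _ _ => 1
  · have h1 := (hC (F (N i)) (hF1 _) fun _ => 1).2
    rw [norm_sum_smul_of] at h1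
    simp only [one_smul, nnnorm_one] at h1
    refine h1.trans (mul_le_of_le_one_right hC0.le ?_)
    have : (F (N i)).sup (fun _ => (1 : ℝ≥0)) ≤ 1 := Finset.sup_le fun _ _ => le_rfl
    exact_mod_cast this

/-- The dyadic interval [2ⁱ, 2ⁱ⁺¹) has exactly as many elements as its least element allows. -/
theorem exists_successive_card : ∃ F : ℕ+ → Finset ℕ+, Successive F ∧ (∀ i, F i ∈ schreierOne) ∧
    Filter.Tendsto (fun i => (F i).card) Filter.atTop Filter.atTop := by
  have hcard : ∀ i : ℕ+, (Finset.Ico ((2 : ℕ+) ^ (i : ℕ)) (2 ^ ((i : ℕ) + 1))).card = 2 ^ (i : ℕ) := by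
    intro i
    rw [PNat.card_Ico, PNat.pow_coe, PNat.pow_coe, pow_succ]
    change 2 ^ (i : ℕ) * 2 - 2 ^ (i : ℕ) = _
    omega
  refine ⟨fun i => Finset.Ico (2 ^ (i : ℕ)) (2 ^ ((i : ℕ) + 1)), fun i j hij x hx y hy => ?_,
    fun i n hn => ?_, ?_⟩
  · rw [Finset.mem_Ico] at hx hy
    refine hx.2.trans_le (le_trans ?_ hy.1)
    exact pow_le_pow_right' one_le hij
  · rw [hcard]
    exact_mod_cast (Finset.mem_Ico.1 hn).1
  · simp_rw [hcard]
    refine Filter.tendsto_atTop.2 fun b => ?_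
    filter_upwards [Filter.eventually_ge_atTop (⟨b + 1, b.succ_pos⟩ : ℕ+)] with i hi
    have h1 : b + 1 ≤ (i : ℕ) := hi
    exact (by omega : b ≤ i).trans Nat.lt_two_pow_self.le

end X01

/-! ### The dichotomy and the two transfer statements -/

theorem proposition5 (Φ : X01.FundamentalSystem) (hΦ : Φ.Nested) (ξ : Ordinal.{0}) (hξ : ξ < ω₁) :
    (∀ x : ℕ+ → X01.Space Φ ξ, X01.IsNormalizedBlock Φ ξ x →
      (∃ M : ℕ+ → ℕ+, StrictMono M ∧
        X01.IsEllOneSpreadingModel (X01.schreier Φ (ω ^ ξ)) fun i => x (M i)) ∨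
      (∀ ε : ℝ, 0 < ε → ∃ M : ℕ+ → ℕ+, StrictMono M ∧
        X01.IsCZeroSpreadingModelWith (1 + ε) X01.schreierOne fun i => x (M i))) ∧
    (∀ x : ℕ+ → X01.Space Φ ξ, X01.IsNormalizedBlock Φ ξ x →
      ∀ M : ℕ+ → ℕ+, StrictMono M →
      X01.IsCZeroSpreadingModel X01.schreierOne (fun i => x (M i)) →
      (∃ E : ℕ+ → Finset ℕ+, X01.Successive E ∧ (∀ i, E i ∈ X01.schreierOne) ∧
        X01.IsEllOneSpreadingModel (X01.schreier Φ (ω ^ ξ)) fun i => ∑ j ∈ E i, x (M j)) ∧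
      (∀ F : ℕ+ → Finset ℕ+, X01.Successive F → (∀ i, F i ∈ X01.schreierOne) →
        Filter.Tendsto (fun i => (F i).card) Filter.atTop Filter.atTop →
        ∃ N : ℕ+ → ℕ+, StrictMono N ∧
          X01.IsEllOneSpreadingModel (X01.schreier Φ (ω ^ ξ))
            fun i => ∑ j ∈ F (N i), x (M j))) ∧
    (∀ x : ℕ+ → X01.Space Φ ξ, X01.IsNormalizedBlock Φ ξ x →
      ∀ M : ℕ+ → ℕ+, StrictMono M →
      X01.IsEllOneSpreadingModel (X01.schreier Φ (ω ^ ξ)) (fun i => x (M i)) →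
      ∀ ε : ℝ, 0 < ε → ∃ (E : ℕ+ → Finset ℕ+) (a : ℕ+ → ℝ), X01.Successive E ∧
        (∀ i, E i ∈ X01.schreier Φ (ω ^ ξ)) ∧ (∀ i, ‖∑ j ∈ E i, a j • x (M j)‖ = 1) ∧
        X01.IsCZeroSpreadingModelWith (1 + ε) X01.schreierOne
          fun i => ∑ j ∈ E i, a j • x (M j)) := by
  obtain ⟨𝓖, hL⟩ := X01.exists_goodLevels hΦ hξ
  refine ⟨fun x hx => ?_, fun x hx M hM hc => ?_, fun x hx M hM hl ε hε => ?_⟩ <;>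
    obtain ⟨u, hxu, hx1, hu⟩ := hx <;>
    obtain rfl : x = fun i => X01.Space.of Φ ξ (u i) := funext hxu <;>
    simp only [X01.norm_of] at hx1
  · rcases X01.indexZero_or_exists_ellOne hL hu with h0 | ⟨M, hM, c, hc, hlow⟩
    · right
      intro ε hε
      obtain ⟨M, hM, hup⟩ := X01.exists_cZero_subsequence hL hu hx1 h0 hε
      exact ⟨M, hM, X01.isCZeroSpreadingModelWith_of hξ (hu.comp hM) (fun i => hx1 _) hε hup⟩
    · left
      exact ⟨M, hM, X01.isEllOneSpreadingModel_of hξ (hu.comp hM) hc (fun i => (hx1 _).le) hlow⟩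
  · have key := fun F hF hF1 => X01.isEllOneSpreadingModel_sums hξ hL (v := fun i => u (M i))
      (F := F) (hu.comp hM) (fun i => hx1 _) hc hF hF1
    refine ⟨?_, key⟩
    obtain ⟨F, hF, hF1, hcard⟩ := X01.exists_successive_card
    obtain ⟨N, hN, h⟩ := key F hF hF1 hcard
    exact ⟨fun i => F (N i), hF.comp hN, fun i => hF1 _, h⟩
  · obtain ⟨K, -, -, c, C, hc, -, -, hlow⟩ := hl
    obtain ⟨E, b, hE, hEF, hn, hup⟩ := X01.exists_cZero_of_ellOne hL (v := fun i => u (M i))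
      (hu.comp hM) (fun i => hx1 _) (inv_pos.2 hc)
      (fun E hE a => by
        have := (hlow E hE a).1
        rwa [X01.norm_sum_smul_of] at this) hε
    refine ⟨E, b, hE, hEF, fun i => ?_, ?_⟩
    · rw [X01.norm_sum_smul_of]
      exact hn i
    · have heq : (fun i => ∑ j ∈ E i, b j • X01.Space.of Φ ξ (u (M j))) =
          fun i => X01.Space.of Φ ξ (∑ j ∈ E i, b j • u (M j)) := by
        funext i
        simp only [← X01.Space.ofLinear_apply, map_sum, map_smul]
      rw [heq]
      exact X01.isCZeroSpreadingModelWith_of hξ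
        (X01.Successive.sum_smul (hu.comp hM) hE fun _ => b) hn hε hup
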